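/- Let $(M,\gamma)$ be a connected smooth Riemannian manifold of dimension $n\ge 3$ (Hausdorff and second countable, without boundary), let $\pi\colon UM\to M$ be its unit tangent bundle, and let $k$ be an integer with $1<k<n$. Let $\varphi^t\colon UM\to UM$, $t\in\mathbb R$, be a smooth flow with infinitesimal generator $X$. With the Levi-Civita connector $K\colon TUM\to TM$ (so that $K$ sends the velocity of a curve $(x(t),v(t))$ to the covariant derivative $\mathrm{D}v/\mathrm{d}t$), let $X_H=\mathrm d\pi(X)$ and $X_V=K(X)$ be the horizontal and vertical components of $X$. Assume: * $\varphi^t$ is odd, i.e. $X_H(x,-v)=-X_H(x,v)$ and $X_V(x,-v)=-X_V(x,v)$ for all $(x,v)\in UM$; * $\varphi^t$ is without fixed points in $M$, i.e. there is no $(x,v)\in UM$ with $\pi(\varphi^t(x,v))=x$ for all $t\in\mathbb R$ (in particular this holds if $X_H$ never vanishes); * for every $x\in M$ and every $k$-dimensional subspace $W\subseteq T_xM$ there is a $k$-dimensional immersed (not necessarily injectively immersed) smooth submanifold $f\colon N\to M$, with $N$ Hausdorff and second countable, which is totally $\varphi$-invariant and such that $f(y)=x$ and $\mathrm df_y(T_yN)=W$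 for some $y\in N$. Here totally $\varphi$-invariant means that the set $UN=\{\mathrm df_y(u) : y\in N,\ u\in T_yN,\ \|\mathrm df_y(u)\|=1\}\subseteq UM$ satisfies $\varphi^t(UN)\subseteq UN$ for all $t\in\mathbb R$. Then $\gamma$ has constant sectional curvature, and $\varphi^t$ is a smooth time-change of the geodesic flow of $\gamma$: there is a smooth function $\lambda\colon UM\to\mathbb R$ without zeros such that $X=\lambda X^\gamma$, where $X^\gamma$ is the generator of the geodesic flow (the vector field with $\mathrm d\pi(X^\gamma(x,v))=v$ and $K(X^\gamma(x,v))=0$). Moreover, if $\varphi^t$ is a semi-spray flow, i.e. $X_H(x,v)=v$ for all $(x,v)\in UM$, then $\varphi^t$ is the geodesic flow of $\gamma$: for every $(x,v)\in UM$ the curve $c(t)=\pi(\varphi^t(x,v))$ is a geodesic and $\varphi^t(x,v)=(c(t),\dot c(t))$. -/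

import Mathlib

open Set Bundle Manifold
open scoped ContDiff Topology

universe u

noncomputable section

/-- A smooth Riemannian metric on a smooth `n`-manifold `M`. -/
abbrev SmoothMetric (n : ℕ) (M : Type u) [TopologicalSpace M]
    [ChartedSpace (EuclideanSpace ℝ (Fin n)) M] [IsManifold (𝓡 n) ∞ M] : Type u :=
  ContMDiffRiemannianMetric (𝓡 n) ∞ (EuclideanSpace ℝ (Fin n))
    (fun x : M => TangentSpace (𝓡 n) x)

section Riemannian

variable {n : ℕ} {M : Type u} [TopologicalSpace M]
  [ChartedSpace (EuclideanSpace ℝ (Fin n)) M] [IsManifold (𝓡 n) ∞ M]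

/-! ### Levi-Civita connection and curvature, in charts -/

/-- The coefficients of the metric in the preferred chart `ψ` around `x₀`: at a point `y` of the
target of `ψ` this is the bilinear form `(a, b) ↦ g (d(ψ⁻¹)_y a, d(ψ⁻¹)_y b)`. -/
def chartMetric (g : SmoothMetric n M) (x₀ : M) (y : EuclideanSpace ℝ (Fin n)) :
    EuclideanSpace ℝ (Fin n) →L[ℝ] EuclideanSpace ℝ (Fin n) →L[ℝ] ℝ :=
  let B : EuclideanSpace ℝ (Fin n) →L[ℝ] EuclideanSpace ℝ (Fin n) →L[ℝ] ℝ :=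
    g.inner ((extChartAt (𝓡 n) x₀).symm y)
  let A : EuclideanSpace ℝ (Fin n) →L[ℝ] EuclideanSpace ℝ (Fin n) :=
    mfderiv (𝓡 n) (𝓡 n) (extChartAt (𝓡 n) x₀).symm y
  B.bilinearComp A A

/-- The Christoffel symbols of the first kind in the preferred chart around `x₀`: the covector
`w ↦ ½ (∂_a G(b, w) + ∂_b G(a, w) - ∂_w G(a, b))`, where `G` is the metric in that chart. -/
def christoffelFirst (g : SmoothMetric n M) (x₀ : M) (y a b : EuclideanSpace ℝ (Fin n)) :
    EuclideanSpace ℝ (Fin n) →L[ℝ] ℝ :=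
  (1 / 2 : ℝ) • (fderiv ℝ (chartMetric g x₀) y a b + fderiv ℝ (chartMetric g x₀) y b a
    - ((fderiv ℝ (chartMetric g x₀) y).flip a).flip b)

/-- The Christoffel symbols `Γ_y(a, b)` of the Levi-Civita connection in the preferred chart around
`x₀`, i.e. the vector `c` with `G_y(c, w) = ½ (∂_a G(b, w) + ∂_b G(a, w) - ∂_w G(a, b))` for all `w`.
(On the target of the chart `G_y` is positive definite, so it is invertible as a map to the dual.) -/
def christoffel (g : SmoothMetric n M) (x₀ : M) (y a b : EuclideanSpace ℝ (Fin n)) :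
    EuclideanSpace ℝ (Fin n) :=
  (chartMetric g x₀ y).inverse (christoffelFirst g x₀ y a b)

/-- The curvature tensor `R(a, b) w` of the Levi-Civita connection at `x`, computed in the preferred
chart around `x` (whose differential at `x` is the identity of `TangentSpace (𝓡 n) x`):
`R(a, b) w = ∂_a Γ(b, w) - ∂_b Γ(a, w) + Γ(a, Γ(b, w)) - Γ(b, Γ(a, w))`. -/
def curvature (g : SmoothMetric n M) (x : M) (a b w : TangentSpace (𝓡 n) x) :
    TangentSpace (𝓡 n) x :=
  let y := extChartAt (𝓡 n) x x
  fderiv ℝ (fun z => christoffel g x z b w) y a - fderiv ℝ (fun z => christoffel g x z a w) y b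
    + christoffel g x y a (christoffel g x y b w) - christoffel g x y b (christoffel g x y a w)

/-- The sectional curvature of the plane spanned by linearly independent `a, b ∈ T_x M`. -/
def sectionalCurvature (g : SmoothMetric n M) (x : M) (a b : TangentSpace (𝓡 n) x) : ℝ :=
  g.inner x (curvature g x a b b) a /
    (g.inner x a a * g.inner x b b - g.inner x a b ^ 2)

/-- `g` has constant sectional curvature. -/
def HasConstantSectionalCurvature (g : SmoothMetric n M) : Prop :=
  ∃ c : ℝ, ∀ (x : M) (a b : TangentSpace (𝓡 n) x),
    LinearIndependent ℝ ![a, b] → sectionalCurvature g x a b = c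

/-- The Levi-Civita connector `K : T_{(x,v)} TM → T_x M`. The tangent space of `TM` at `(x, v)` is
`ℝⁿ × ℝⁿ`, read in the chart of `TM` induced by the preferred chart of `M` around `x`; there
`K (a, b) = b + Γ_x(a, v)`. Hence `K` of the velocity of a curve `t ↦ (x(t), v(t))` in `TM` is the
covariant derivative `Dv/dt`. -/
def connector (g : SmoothMetric n M) (q : TangentBundle (𝓡 n) M)
    (ξ : TangentSpace (𝓡 n).tangent q) : TangentSpace (𝓡 n) q.proj :=
  let ab : EuclideanSpace ℝ (Fin n) × EuclideanSpace ℝ (Fin n) := ξ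
  ab.2 + christoffel g q.proj (extChartAt (𝓡 n) q.proj q.proj) ab.1 q.snd

/-- The generator `X^g` of the geodesic flow on `TM`: the vector at `(x, v)` which projects to `v`
and is killed by the connector, in the induced chart `(v, -Γ_x(v, v))`. -/
def geodesicVectorField (g : SmoothMetric n M) (q : TangentBundle (𝓡 n) M) :
    TangentSpace (𝓡 n).tangent q :=
  ((q.snd, -christoffel g q.proj (extChartAt (𝓡 n) q.proj q.proj) q.snd q.snd) :
    EuclideanSpace ℝ (Fin n) × EuclideanSpace ℝ (Fin n))

/-- The velocity lift `t ↦ (c(t), c'(t))` of a curve in `M` to `TM`. -/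
def velocityLift (c : ℝ → M) (t : ℝ) : TangentBundle (𝓡 n) M :=
  ⟨c t, mfderiv 𝓘(ℝ, ℝ) (𝓡 n) c t (1 : ℝ)⟩

/-- A curve defined for all times is a geodesic: it is smooth and `D c'/dt = 0`. -/
def IsGeodesic (g : SmoothMetric n M) (c : ℝ → M) : Prop :=
  ContMDiff 𝓘(ℝ, ℝ) (𝓡 n) ∞ c ∧
    ∀ t : ℝ, connector g (velocityLift c t)
      (mfderiv 𝓘(ℝ, ℝ) (𝓡 n).tangent (velocityLift c) t (1 : ℝ)) = 0

/-! ### Flows on the unit tangent bundle -/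

/-- The unit tangent bundle `UM`, as a subset of `TM`. -/
def unitTangentSet (g : SmoothMetric n M) : Set (TangentBundle (𝓡 n) M) :=
  {q | g.inner q.proj q.snd q.snd = 1}

/-- The unit tangent bundle `UM`, with the topology induced from `TM`. -/
abbrev UnitTangentBundle (g : SmoothMetric n M) : Type u := unitTangentSet g

/-- The map `(x, v) ↦ (x, -v)` of `UM`. -/
def UnitTangentBundle.flip {g : SmoothMetric n M} (p : UnitTangentBundle g) :
    UnitTangentBundle g :=
  ⟨⟨p.1.proj, -p.1.snd⟩, by
    have h : g.inner p.1.proj p.1.snd p.1.snd = 1 := p.2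
    simpa [unitTangentSet] using h⟩

/-- The flow is smooth, as a map `ℝ × UM → UM`. Here `UM` is a submanifold of `TM`, so a map on
`ℝ × UM` is smooth if and only if it is smooth on the subset `ℝ × UM` of `ℝ × TM`. -/
def IsSmoothFlow {g : SmoothMetric n M} (φ : Flow ℝ (UnitTangentBundle g)) : Prop :=
  ∃ Φ : ℝ × TangentBundle (𝓡 n) M → TangentBundle (𝓡 n) M,
    ContMDiffOn (𝓘(ℝ, ℝ).prod (𝓡 n).tangent) (𝓡 n).tangent ∞ Φ (univ ×ˢ unitTangentSet g) ∧
    ∀ (t : ℝ) (p : UnitTangentBundle g), Φ (t, p.1) = (φ t p).1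

/-- A function on `UM` is smooth (`UM` being a submanifold of `TM`). -/
def IsSmoothFunction {g : SmoothMetric n M} (f : UnitTangentBundle g → ℝ) : Prop :=
  ∃ F : TangentBundle (𝓡 n) M → ℝ,
    ContMDiffOn (𝓡 n).tangent 𝓘(ℝ, ℝ) ∞ F (unitTangentSet g) ∧
    ∀ p : UnitTangentBundle g, F p.1 = f p

/-- The infinitesimal generator `X(x, v) = d/dt φ^t(x, v) |_{t = 0}`, a vector in `T_{(x,v)} TM`
(note that `φ^0(x, v) = (x, v)`). -/
def generator {g : SmoothMetric n M} (φ : Flow ℝ (UnitTangentBundle g))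
    (p : UnitTangentBundle g) : TangentSpace (𝓡 n).tangent p.1 :=
  mfderiv 𝓘(ℝ, ℝ) (𝓡 n).tangent (fun t : ℝ => (φ t p).1) 0 (1 : ℝ)

/-- The horizontal component `X_H = dπ(X)` of the generator. -/
def horizontalPart {g : SmoothMetric n M} (φ : Flow ℝ (UnitTangentBundle g))
    (p : UnitTangentBundle g) : TangentSpace (𝓡 n) p.1.proj :=
  mfderiv (𝓡 n).tangent (𝓡 n) (fun q : TangentBundle (𝓡 n) M => q.proj) p.1 (generator φ p)

/-- The vertical component `X_V = K(X)` of the generator. -/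
def verticalPart {g : SmoothMetric n M} (φ : Flow ℝ (UnitTangentBundle g))
    (p : UnitTangentBundle g) : TangentSpace (𝓡 n) p.1.proj :=
  connector g p.1 (generator φ p)

/-- The flow is odd: `X_H(x, -v) = -X_H(x, v)` and `X_V(x, -v) = -X_V(x, v)`. -/
def IsOddFlow {g : SmoothMetric n M} (φ : Flow ℝ (UnitTangentBundle g)) : Prop :=
  ∀ p : UnitTangentBundle g,
    horizontalPart φ p.flip = -horizontalPart φ p ∧ verticalPart φ p.flip = -verticalPart φ p

/-- `x ∈ M` is a fixed point of the flow if for some `v ∈ U_x M` the orbit of `(x, v)` stays over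
`x`; the flow is without fixed points in `M` if there is no such `x`. -/
def HasNoFixedPoint {g : SmoothMetric n M} (φ : Flow ℝ (UnitTangentBundle g)) : Prop :=
  ¬ ∃ (x : M) (p : UnitTangentBundle g), p.1.proj = x ∧ ∀ t : ℝ, (φ t p).1.proj = x

/-- The flow is a semi-spray flow: `X_H(x, v) = v`. -/
def IsSemiSpray {g : SmoothMetric n M} (φ : Flow ℝ (UnitTangentBundle g)) : Prop :=
  ∀ p : UnitTangentBundle g, horizontalPart φ p = p.1.snd

/-- The flow is the geodesic flow: every orbit is the velocity lift of a geodesic. -/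
def IsGeodesicFlow {g : SmoothMetric n M} (φ : Flow ℝ (UnitTangentBundle g)) : Prop :=
  ∀ p : UnitTangentBundle g, IsGeodesic g (fun t : ℝ => (φ t p).1.proj) ∧
    ∀ t : ℝ, velocityLift (fun s : ℝ => (φ s p).1.proj) t = (φ t p).1

/-- The flow is a smooth time-change of the geodesic flow: its generator is `l · X^g` for a smooth
function `l` on `UM` without zeros. -/
def IsSmoothTimeChangeOfGeodesicFlow {g : SmoothMetric n M}
    (φ : Flow ℝ (UnitTangentBundle g)) : Prop :=
  ∃ l : UnitTangentBundle g → ℝ, IsSmoothFunction l ∧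
    ∀ p : UnitTangentBundle g, l p ≠ 0 ∧ generator φ p = l p • geodesicVectorField g p.1

/-! ### Totally invariant submanifolds -/

/-- The unit tangent bundle `UN`, as a subset of `UM`, of a submanifold immersed by `f : N → M` and
equipped with the induced metric: the vectors `df(u)` of length one. -/
def unitTangentOfImmersion {k : ℕ} (g : SmoothMetric n M) {N : Type} [TopologicalSpace N]
    [ChartedSpace (EuclideanSpace ℝ (Fin k)) N] (f : N → M) : Set (UnitTangentBundle g) :=
  {p | p.1 ∈ range (tangentMap (𝓡 k) (𝓡 n) f)}

/-- The submanifold immersed by `f` is totally `φ`-invariant: `UN` is a `φ^t`-invariant subset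
of `UM` for all `t ∈ ℝ`. -/
def IsTotallyInvariant {k : ℕ} {g : SmoothMetric n M} (φ : Flow ℝ (UnitTangentBundle g))
    {N : Type} [TopologicalSpace N] [ChartedSpace (EuclideanSpace ℝ (Fin k)) N]
    (f : N → M) : Prop :=
  ∀ t : ℝ, MapsTo (φ t) (unitTangentOfImmersion (k := k) g f)
    (unitTangentOfImmersion (k := k) g f)

/-- The subspace `W` of `T_x M` is the tangent space at some point of a `k`-dimensional totally
`φ`-invariant immersed submanifold `f : N → M` (`N` is Hausdorff and second countable; it is no
restriction that `N` lives in the lowest universe). -/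
def IsTangentToTotallyInvariant {g : SmoothMetric n M} (φ : Flow ℝ (UnitTangentBundle g))
    (k : ℕ) (x : M) (W : Submodule ℝ (TangentSpace (𝓡 n) x)) : Prop :=
  ∃ (N : Type) (_ : TopologicalSpace N) (_ : ChartedSpace (EuclideanSpace ℝ (Fin k)) N)
    (_ : IsManifold (𝓡 k) ∞ N) (_ : T2Space N) (_ : SecondCountableTopology N) (f : N → M),
    IsImmersion (𝓡 k) (𝓡 n) ∞ f ∧ IsTotallyInvariant (k := k) φ f ∧
    ∃ y : N,
      range (fun u : TangentSpace (𝓡 k) y => tangentMap (𝓡 k) (𝓡 n) f ⟨y, u⟩)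
        = (fun w : TangentSpace (𝓡 n) x => (⟨x, w⟩ : TangentBundle (𝓡 n) M)) '' (W : Set _)

end Riemannian

end

/-!
The hypothesis provides so many invariant submanifolds that the generator `X` is determined up to
scale, and these submanifolds are then totally geodesic.

**Tangency.** Let `f : N → M` be totally invariant. Since `f` need not be injective, the orbit of
a vector of `UN` may a priori move between different sheets of `N`, so that its velocity is not
obviously tangent to one of them. But `N` is second countable, hence the image of `TN` in a chart
is covered by countably many tangent bundles of `k`-dimensional slices `{s_i = 0}`. If the velocity
were transverse to `TN` at one vector, then the map `(t, ζ) ↦ φ^t(ζ)`, extended to all nonzero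
vectors by homogeneity, would be an immersion of a `(2k + 1)`-dimensional manifold; by Baire's
theorem an open part of it would lie in a single `2k`-dimensional slice. So the velocity is tangent
to `TN` (`tangent_of_countable_slices`, `LocalSlice.tangent_generator`): if `h` parametrizes `N`
in a chart, then at `v = h' ξ` the generator is `(h' a, h''(a, ξ) + h' b)`.

**Direction of the generator.** Thus `X_H(x, v)` lies in every `k`-plane through `v`; as
`1 < k < n`, these planes intersect in `ℝ v`, and `X_H = λ v`. Then `a = λ ξ`, and
`X_V = λ ∇dh(ξ, ξ) + h' b`, where `∇dh` is the covariant Hessian. Passing from `v` to `-v`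
changes the sign of `X_V`, but not that of `λ ∇dh(ξ, ξ)`; so both terms are tangent to the
submanifold (`LocalSlice.IsInvariant.tangential`). Hence `X_V` lies in every `k`-plane through `v`
too. It is therefore a multiple of `v`, and it is orthogonal to `v` because the flow preserves
lengths, so `X_V = 0`. A zero of `λ` would be a zero of `X`, the orbit of which is constant; this
is excluded by the absence of fixed points. Hence `X = λ X^γ` with `λ` without zeros, and `λ = 1` if
the flow is a semi-spray flow.

**Curvature.** As `λ ≠ 0`, the Hessian `∇dh` is tangent to the submanifold, which is
thus totally geodesic. So the curvature tensor preserves every `k`-plane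
(`chartCurvature_tangent`), and `R(a, b) b` lies in the intersection of the `k`-planes containing
`a` and `b`, which is the span of `a` and `b`. For `n ≥ 3` this makes the sectional curvature
constant at each point (`exists_eq_smul_of_mem_span`), and by Schur's lemma
(`IsChartMetric.fderiv_eq_zero_of_chartCurvature_eq`) it is constant.
-/

noncomputable section

set_option maxSynthPendingDepth 3
set_option synthInstance.maxHeartbeats 200000

/-! ### Metrics, connections and curvature on open subsets of a vector space -/

section LocalGeometry

variable {V : Type*} [NormedAddCommGroup V] [NormedSpace ℝ V]

/-- The covector-valued bilinear form `½ (D_a (b, w) + D_b (a, w) - D_w (a, b))` attached to the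
derivative `D` of a metric. -/
def koszulForm (D : V →L[ℝ] V →L[ℝ] V →L[ℝ] ℝ) : V →L[ℝ] V →L[ℝ] V →L[ℝ] ℝ :=
  (1 / 2 : ℝ) • (D + D.flip -
    ((ContinuousLinearMap.flipₗᵢ ℝ V V ℝ).toContinuousLinearEquiv : (V →L[ℝ] V →L[ℝ] ℝ) →L[ℝ]
      (V →L[ℝ] V →L[ℝ] ℝ)).comp D.flip)

lemma koszulForm_apply (D : V →L[ℝ] V →L[ℝ] V →L[ℝ] ℝ) (a b w : V) :
    koszulForm D a b w = 1 / 2 * (D a b w + D b a w - D w a b) := by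
  simp [koszulForm]

/-- The Christoffel symbols of a metric `G` on an open subset of a vector space, as a bilinear
map. -/
def leviCivita (G : V → V →L[ℝ] V →L[ℝ] ℝ) (y : V) : V →L[ℝ] V →L[ℝ] V :=
  (ContinuousLinearMap.compL ℝ V (V →L[ℝ] ℝ) V (G y).inverse).comp (koszulForm (fderiv ℝ G y))

lemma leviCivita_apply (G : V → V →L[ℝ] V →L[ℝ] ℝ) (y a b : V) :
    leviCivita G y a b = (G y).inverse (koszulForm (fderiv ℝ G y) a b) := rfl

/-- The curvature of the connection with Christoffel symbols `Γ`. -/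
def chartCurvature (Γ : V → V →L[ℝ] V →L[ℝ] V) (y a b w : V) : V :=
  fderiv ℝ Γ y a b w - fderiv ℝ Γ y b a w + Γ y a (Γ y b w) - Γ y b (Γ y a w)

/-- A smooth Riemannian metric on a subset `Ω` of a vector space. -/
structure IsChartMetric (G : V → V →L[ℝ] V →L[ℝ] ℝ) (Ω : Set V) : Prop where
  isOpen : IsOpen Ω
  contDiffOn : ContDiffOn ℝ ∞ G Ω
  symm : ∀ y ∈ Ω, ∀ a b, G y a b = G y b a
  pos : ∀ y ∈ Ω, ∀ a, a ≠ 0 → 0 < G y a a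

namespace IsChartMetric

variable {G : V → V →L[ℝ] V →L[ℝ] ℝ} {Ω : Set V} (hG : IsChartMetric G Ω) {y : V}
include hG

lemma contDiffAt (hy : y ∈ Ω) : ContDiffAt ℝ ∞ G y :=
  hG.contDiffOn.contDiffAt (hG.isOpen.mem_nhds hy)

lemma differentiableAt (hy : y ∈ Ω) : DifferentiableAt ℝ G y :=
  (hG.contDiffAt hy).differentiableAt (by simp)

lemma ext_of_apply (hy : y ∈ Ω) {a b : V} (h : ∀ w, G y a w = G y b w) : a = b := by
  by_contra hab
  have h1 := hG.pos y hy (a - b) (sub_ne_zero.2 hab)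
  simp [h] at h1

lemma fderiv_symm (hy : y ∈ Ω) (a b c : V) : fderiv ℝ G y a b c = fderiv ℝ G y a c b := by
  have h1 : HasFDerivAt (fun z => G z b c) _ y :=
    (((hG.differentiableAt hy).hasFDerivAt.clm_apply (hasFDerivAt_const b y)).clm_apply
      (hasFDerivAt_const c y))
  have h2 : HasFDerivAt (fun z => G z c b) _ y :=
    (((hG.differentiableAt hy).hasFDerivAt.clm_apply (hasFDerivAt_const c y)).clm_apply
      (hasFDerivAt_const b y))
  have h3 : (fun z => G z b c) =ᶠ[𝓝 y] fun z => G z c b := by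
    filter_upwards [hG.isOpen.mem_nhds hy] with z hz using hG.symm z hz b c
  have := congrArg (fun L => L a) ((h1.congr_of_eventuallyEq h3.symm).unique h2)
  simpa using this

variable [FiniteDimensional ℝ V]

lemma exists_equiv (hy : y ∈ Ω) : ∃ e : V ≃L[ℝ] (V →L[ℝ] ℝ), (e : V →L[ℝ] (V →L[ℝ] ℝ)) = G y := by
  have hinj : Function.Injective (G y : V →ₗ[ℝ] (V →L[ℝ] ℝ)) := fun a b hab =>
    hG.ext_of_apply hy fun w => congrArg (fun L : V →L[ℝ] ℝ => L w) hab
  have hf : Module.finrank ℝ V = Module.finrank ℝ (V →L[ℝ] ℝ) := by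
    rw [← (LinearMap.toContinuousLinearMap : (V →ₗ[ℝ] ℝ) ≃ₗ[ℝ] _).finrank_eq]
    exact (Subspace.dual_finrank_eq (K := ℝ) (V := V)).symm
  refine ⟨(LinearEquiv.ofInjectiveOfFinrankEq _ hinj hf).toContinuousLinearEquiv, ?_⟩
  ext; rfl

lemma apply_inverse (hy : y ∈ Ω) (l : V →L[ℝ] ℝ) : G y ((G y).inverse l) = l := by
  obtain ⟨e, he⟩ := hG.exists_equiv hy
  rw [← he, ContinuousLinearMap.inverse_equiv]; simp

lemma apply_leviCivita (hy : y ∈ Ω) (a b w : V) : G y (leviCivita G y a b) w =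
    1 / 2 * (fderiv ℝ G y a b w + fderiv ℝ G y b a w - fderiv ℝ G y w a b) := by
  rw [leviCivita_apply, hG.apply_inverse hy, koszulForm_apply]

lemma leviCivita_symm (hy : y ∈ Ω) (a b : V) : leviCivita G y a b = leviCivita G y b a := by
  refine hG.ext_of_apply hy fun w => ?_
  rw [hG.apply_leviCivita hy, hG.apply_leviCivita hy, hG.fderiv_symm hy w a b]; ring

lemma fderiv_apply (hy : y ∈ Ω) (a b c : V) : fderiv ℝ G y a b c =
    G y (leviCivita G y a b) c + G y b (leviCivita G y a c) := by
  rw [hG.symm y hy b, hG.apply_leviCivita hy, hG.apply_leviCivita hy,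
    hG.fderiv_symm hy a c b, hG.fderiv_symm hy c a b, hG.fderiv_symm hy b a c]; ring

lemma contDiffAt_leviCivita (hy : y ∈ Ω) : ContDiffAt ℝ ∞ (leviCivita G) y := by
  have h1 : ContDiffAt ℝ ∞ (fun z => (G z).inverse) y := by
    obtain ⟨e, he⟩ := hG.exists_equiv hy
    have := contDiffAt_map_inverse (𝕜 := ℝ) (n := ∞) e
    rw [he] at this
    exact this.comp y (hG.contDiffAt hy)
  have h2 : ContDiffAt ℝ ∞ (fderiv ℝ G) y := (hG.contDiffAt hy).fderiv_right (by simp)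
  have h3 : ContDiffAt ℝ ∞ (fun z => koszulForm (fderiv ℝ G z)) y := by
    unfold koszulForm
    have h4 : ContDiffAt ℝ ∞ (fun z => (fderiv ℝ G z).flip) y :=
      (ContinuousLinearMap.flipₗᵢ ℝ V V (V →L[ℝ] ℝ)).contDiff.contDiffAt.comp y h2
    exact ((h2.add h4).sub (contDiffAt_const.clm_comp h4)).const_smul _
  exact ((ContinuousLinearMap.compL ℝ V (V →L[ℝ] ℝ) V).contDiff.contDiffAt.comp y h1).clm_comp h3

lemma differentiableAt_leviCivita (hy : y ∈ Ω) : DifferentiableAt ℝ (leviCivita G) y :=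
  (hG.contDiffAt_leviCivita hy).differentiableAt (by simp)

end IsChartMetric

/-- Symmetry of second derivatives. -/
lemma ContDiffAt.fderiv_fderiv_symm {W V : Type*} [NormedAddCommGroup W] [NormedSpace ℝ W]
    [NormedAddCommGroup V] [NormedSpace ℝ V] {f : W → V} {u : W}
    (hf : ContDiffAt ℝ ∞ f u) (a b : W) :
    fderiv ℝ (fderiv ℝ f) u a b = fderiv ℝ (fderiv ℝ f) u b a :=
  (hf.isSymmSndFDerivAt (by simpa using ENat.LEInfty.out)) a b

lemma ContDiffAt.hasFDerivAt_fderiv {W V : Type*} [NormedAddCommGroup W] [NormedSpace ℝ W]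
    [NormedAddCommGroup V] [NormedSpace ℝ V] {f : W → V} {u : W}
    (hf : ContDiffAt ℝ ∞ f u) : HasFDerivAt (fderiv ℝ f) (fderiv ℝ (fderiv ℝ f) u) u :=
  ((hf.fderiv_right (m := ∞) (by simp)).differentiableAt (by simp)).hasFDerivAt

lemma ContDiffAt.hasFDerivAt_self {W V : Type*} [NormedAddCommGroup W] [NormedSpace ℝ W]
    [NormedAddCommGroup V] [NormedSpace ℝ V] {f : W → V} {u : W}
    (hf : ContDiffAt ℝ ∞ f u) : HasFDerivAt f (fderiv ℝ f u) u :=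
  (hf.differentiableAt (by simp)).hasFDerivAt

section SecondFundamental

variable {W : Type*} [NormedAddCommGroup W] [NormedSpace ℝ W]

/-- The covariant second derivative `∇dh (a, b) = h''(a, b) + Γ_{h(u)}(h' a, h' b)` of a map `h`
into a space with Christoffel symbols `Γ`. -/
def covHessian (Γ : V → V →L[ℝ] V →L[ℝ] V) (h : W → V) (u a b : W) : V :=
  fderiv ℝ (fderiv ℝ h) u a b + Γ (h u) (fderiv ℝ h u a) (fderiv ℝ h u b)

lemma hasFDerivAt_covHessian {Γ : V → V →L[ℝ] V →L[ℝ] V} {h : W → V} {u : W}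
    (hh : ContDiffAt ℝ ∞ h u) (hΓ : DifferentiableAt ℝ Γ (h u)) (b w : W) :
    ∃ L : W →L[ℝ] V, HasFDerivAt (fun z => covHessian Γ h z b w) L u ∧
      ∀ a, L a = fderiv ℝ (fderiv ℝ (fderiv ℝ h)) u a b w
        + fderiv ℝ Γ (h u) (fderiv ℝ h u a) (fderiv ℝ h u b) (fderiv ℝ h u w)
        + Γ (h u) (fderiv ℝ (fderiv ℝ h) u a b) (fderiv ℝ h u w)
        + Γ (h u) (fderiv ℝ h u b) (fderiv ℝ (fderiv ℝ h) u a w) := by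
  have h1 := hh.hasFDerivAt_fderiv
  have h2 := (hh.fderiv_right (m := ∞) (by simp)).hasFDerivAt_fderiv
  have h3 : HasFDerivAt (fun z => Γ (h z)) ((fderiv ℝ Γ (h u)).comp (fderiv ℝ h u)) u :=
    hΓ.hasFDerivAt.comp u hh.hasFDerivAt_self
  have hb := h1.clm_apply (hasFDerivAt_const b u)
  have hw := h1.clm_apply (hasFDerivAt_const w u)
  refine ⟨_, ((h2.clm_apply (hasFDerivAt_const b u)).clm_apply (hasFDerivAt_const w u)).add
    ((h3.clm_apply hb).clm_apply hw), fun a => ?_⟩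
  simp
  abel

/-- The curvature along a map `h` is the commutator of covariant derivatives, applied to the
fields `h' w`. -/
lemma chartCurvature_eq_covHessian {Γ : V → V →L[ℝ] V →L[ℝ] V} {h : W → V} {u : W}
    (hh : ContDiffAt ℝ ∞ h u) (hΓ : DifferentiableAt ℝ Γ (h u)) (a b w : W) :
    chartCurvature Γ (h u) (fderiv ℝ h u a) (fderiv ℝ h u b) (fderiv ℝ h u w) =
      (fderiv ℝ (fun z => covHessian Γ h z b w) u a
        + Γ (h u) (fderiv ℝ h u a) (covHessian Γ h u b w))
      - (fderiv ℝ (fun z => covHessian Γ h z a w) u b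
        + Γ (h u) (fderiv ℝ h u b) (covHessian Γ h u a w)) := by
  obtain ⟨L, hL, hLa⟩ := hasFDerivAt_covHessian hh hΓ b w
  obtain ⟨L', hL', hLb⟩ := hasFDerivAt_covHessian hh hΓ a w
  rw [hL.fderiv, hL'.fderiv, hLa, hLb]
  have s1 := (hh.fderiv_right (m := ∞) (by simp)).fderiv_fderiv_symm a b
  have s2 := hh.fderiv_fderiv_symm a b
  simp only [chartCurvature, covHessian, map_add, s1, s2]
  abel

/-- A map which is affine for two connections intertwines their curvatures. -/
lemma chartCurvature_map {Γ : V → V →L[ℝ] V →L[ℝ] V} {Γ' : W → W →L[ℝ] W →L[ℝ] W}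
    {h : W → V} {u : W} (hh : ContDiffAt ℝ ∞ h u) (hΓ : DifferentiableAt ℝ Γ (h u))
    (hΓ' : DifferentiableAt ℝ Γ' u)
    (haff : ∀ᶠ z in 𝓝 u, ∀ a b, covHessian Γ h z a b = fderiv ℝ h z (Γ' z a b)) (a b w : W) :
    chartCurvature Γ (h u) (fderiv ℝ h u a) (fderiv ℝ h u b) (fderiv ℝ h u w) =
      fderiv ℝ h u (chartCurvature Γ' u a b w) := by
  rw [chartCurvature_eq_covHessian hh hΓ]
  have key : ∀ b w a, fderiv ℝ (fun z => covHessian Γ h z b w) u a =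
      fderiv ℝ (fderiv ℝ h) u a (Γ' u b w) + fderiv ℝ h u (fderiv ℝ Γ' u a b w) := by
    intro b w a
    have h1 : (fun z => covHessian Γ h z b w) =ᶠ[𝓝 u] fun z => fderiv ℝ h z (Γ' z b w) := by
      filter_upwards [haff] with z hz using hz b w
    rw [h1.fderiv_eq, (hh.hasFDerivAt_fderiv.clm_apply
      ((hΓ'.hasFDerivAt.clm_apply (hasFDerivAt_const b u)).clm_apply
        (hasFDerivAt_const w u))).fderiv]
    simp
    abel
  have h0 : ∀ a b, Γ (h u) (fderiv ℝ h u a) (fderiv ℝ h u b) =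
      fderiv ℝ h u (Γ' u a b) - fderiv ℝ (fderiv ℝ h) u a b := by
    intro a b; rw [← haff.self_of_nhds a b, covHessian]; abel
  rw [key, key, haff.self_of_nhds, haff.self_of_nhds, h0, h0]
  simp only [chartCurvature, map_add, map_sub]
  abel

/-- If `h` is totally geodesic for `Γ`, in the sense that `∇dh` takes values in the range of `h'`,
which is the kernel of the differential of a function `s` vanishing on the image of `h`, then the
range of `h'` is stable under the curvature. -/
lemma chartCurvature_tangent {F : Type*} [NormedAddCommGroup F] [NormedSpace ℝ F]
    {Γ : V → V →L[ℝ] V →L[ℝ] V} {h : W → V} {s : V → F} {u : W}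
    (hh : ContDiffAt ℝ ∞ h u) (hΓ : DifferentiableAt ℝ Γ (h u)) (hs : ContDiffAt ℝ ∞ s (h u))
    (hker : ∀ᶠ z in 𝓝 u, ∀ w, fderiv ℝ s (h z) (fderiv ℝ h z w) = 0)
    (hrange : ∀ v, fderiv ℝ s (h u) v = 0 → ∃ w, fderiv ℝ h u w = v)
    (hgeod : ∀ᶠ z in 𝓝 u, ∀ a b, ∃ w, covHessian Γ h z a b = fderiv ℝ h z w) (a b w : W) :
    ∃ c, chartCurvature Γ (h u) (fderiv ℝ h u a) (fderiv ℝ h u b) (fderiv ℝ h u w) =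
      fderiv ℝ h u c := by
  have hsd : HasFDerivAt (fun z => fderiv ℝ s (h z))
      ((fderiv ℝ (fderiv ℝ s) (h u)).comp (fderiv ℝ h u)) u :=
    hs.hasFDerivAt_fderiv.comp u hh.hasFDerivAt_self
  -- Differentiating `ds (h' w) = 0` along `h`.
  have k1 : ∀ w a, fderiv ℝ (fderiv ℝ s) (h u) (fderiv ℝ h u a) (fderiv ℝ h u w) =
      - fderiv ℝ s (h u) (fderiv ℝ (fderiv ℝ h) u a w) := by
    intro w a
    have h1 : (fun z => fderiv ℝ s (h z) (fderiv ℝ h z w)) =ᶠ[𝓝 u] fun _ => 0 := by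
      filter_upwards [hker] with z hz using hz w
    have h2 := (hsd.clm_apply (hh.hasFDerivAt_fderiv.clm_apply (hasFDerivAt_const w u))).fderiv
    rw [h1.fderiv_eq] at h2
    have h3 := congrArg (fun L => L a) h2
    simp at h3
    exact eq_neg_of_add_eq_zero_right h3.symm
  have k2 : ∀ w a, fderiv ℝ (fderiv ℝ s) (h u) (fderiv ℝ h u a) (fderiv ℝ h u w) =
      fderiv ℝ s (h u) (Γ (h u) (fderiv ℝ h u a) (fderiv ℝ h u w)) := by
    intro w a
    obtain ⟨c, hc⟩ := hgeod.self_of_nhds a w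
    rw [k1, neg_eq_iff_add_eq_zero, ← map_add, ← covHessian, hc, hker.self_of_nhds]
  have k3 : ∀ a b w, fderiv ℝ s (h u) (fderiv ℝ (fun z => covHessian Γ h z b w) u a
        + Γ (h u) (fderiv ℝ h u a) (covHessian Γ h u b w)) = 0 := by
    intro a b w
    have h1 : (fun z => fderiv ℝ s (h z) (covHessian Γ h z b w)) =ᶠ[𝓝 u] fun _ => 0 := by
      filter_upwards [hker, hgeod] with z hz hz'
      obtain ⟨c, hc⟩ := hz' b w
      rw [hc, hz]
    obtain ⟨L, hL, -⟩ := hasFDerivAt_covHessian hh hΓ b w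
    have h2 := (hsd.clm_apply hL).fderiv
    rw [h1.fderiv_eq] at h2
    have h3 := congrArg (fun L => L a) h2
    simp at h3
    obtain ⟨c, hc⟩ := hgeod.self_of_nhds b w
    rw [hL.fderiv, map_add, hc, ← k2, ← hc]
    exact h3.symm
  obtain ⟨c, hc⟩ := hrange (chartCurvature Γ (h u) (fderiv ℝ h u a) (fderiv ℝ h u b)
    (fderiv ℝ h u w)) (by rw [chartCurvature_eq_covHessian hh hΓ, map_sub, k3, k3, sub_zero])
  exact ⟨c, hc.symm⟩

end SecondFundamental

end LocalGeometry

/-! ### Algebraic curvature tensors, the Bianchi identities and Schur's lemma -/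

section CurvatureAlgebra

variable {V : Type*} [NormedAddCommGroup V] [NormedSpace ℝ V]

lemma exists_ne_zero_orthogonal [FiniteDimensional ℝ V] (hV : 3 ≤ Module.finrank ℝ V)
    (B : V →L[ℝ] V →L[ℝ] ℝ) (a b : V) : ∃ c, c ≠ 0 ∧ B a c = 0 ∧ B b c = 0 := by
  have h : LinearMap.ker (((B a).prod (B b) : V →L[ℝ] ℝ × ℝ) : V →ₗ[ℝ] ℝ × ℝ) ≠ ⊥ :=
    LinearMap.ker_ne_bot_of_finrank_lt (by simp; omega)
  obtain ⟨c, hc, hc0⟩ := (Submodule.ne_bot_iff _).1 h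
  refine ⟨c, hc0, ?_⟩
  simpa using hc

/-- An algebraic curvature tensor `R` such that `R(a, b) b` always lies in the span of `a` and `b`
has constant sectional curvature. The symmetries which enter are the two skew-symmetries and
the first Bianchi identity. -/
lemma exists_eq_smul_of_mem_span [FiniteDimensional ℝ V] (hV : 3 ≤ Module.finrank ℝ V)
    (B : V →L[ℝ] V →L[ℝ] ℝ) (hsymm : ∀ a b, B a b = B b a) (hpos : ∀ a, a ≠ 0 → 0 < B a a)
    (R : V → V → V → V) (hadd₁ : ∀ a a' b w, R (a + a') b w = R a b w + R a' b w)
    (hsmul₁ : ∀ (t : ℝ) a b w, R (t • a) b w = t • R a b w)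
    (hadd₃ : ∀ a b w w', R a b (w + w') = R a b w + R a b w')
    (hanti : ∀ a b w, R a b w = -R b a w) (hskew : ∀ a b w, B (R a b w) w = 0)
    (hbianchi : ∀ a b w, R a b w + R b w a + R w a b = 0)
    (hspan : ∀ a b, ∃ s t : ℝ, R a b b = s • a + t • b) :
    ∃ κ : ℝ, ∀ a b w, R a b w = κ • (B b w • a - B a w • b) := by
  have hadd₂ : ∀ a b b' w, R a (b + b') w = R a b w + R a b' w := by
    intro a b b' w
    rw [hanti, hadd₁, hanti b a, hanti b' a]; abel
  -- On orthogonal pairs `R(·, b) b` is a multiple of the identity.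
  have hK : ∀ a b, ∃ K : ℝ, b ≠ 0 → B b a = 0 → R a b b = (K * B b b) • a := by
    intro a b
    obtain ⟨s, t, hst⟩ := hspan a b
    refine ⟨s / B b b, fun hb hab => ?_⟩
    have h1 := hskew a b b
    rw [hst] at h1
    simp only [map_add, map_smul, add_apply, smul_apply, smul_eq_mul, hsymm a b, hab] at h1
    have h2 : t = 0 := by simpa [(hpos b hb).ne'] using h1
    rw [hst, h2, div_mul_cancel₀ _ (hpos b hb).ne']; simp
  choose K hK using hK
  have hKsymm : ∀ a b, a ≠ 0 → b ≠ 0 → B b a = 0 → K a b = K b a := by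
    intro a b ha hb hab
    have h1 : B (R a b b) a = B (R b a a) b := by
      have h2 := hskew a b (a + b)
      simp only [hadd₃, map_add, add_apply, hskew, hanti b a] at h2 ⊢
      simp only [map_neg, neg_apply]
      linarith
    rw [hK a b hb hab, hK b a ha (by rw [hsymm, hab])] at h1
    simp only [map_smul, smul_apply, smul_eq_mul] at h1
    have h3 := (hpos a ha).ne'
    have h4 := (hpos b hb).ne'
    have h5 : (K a b - K b a) * (B a a * B b b) = 0 := by linear_combination h1
    simpa [h3, h4, sub_eq_zero] using h5
  have hKeq : ∀ a c b, a ≠ 0 → c ≠ 0 → b ≠ 0 → B b a = 0 → B b c = 0 → K a b = K c b := by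
    intro a c b ha hc hb hba hbc
    have hbb := (hpos b hb).ne'
    have h1 := hadd₁ a c b b
    rw [hK a b hb hba, hK c b hb hbc, hK (a + c) b hb (by simp [hba, hbc])] at h1
    have h2 : (K (a + c) b - K a b) • a = (K c b - K (a + c) b) • c := by
      have h3 : B b b • ((K (a + c) b - K a b) • a - (K c b - K (a + c) b) • c) = 0 := by
        linear_combination (norm := module) h1
      rw [smul_eq_zero_iff_right hbb, sub_eq_zero] at h3
      exact h3
    by_cases h4 : K (a + c) b - K a b = 0
    · rw [h4, zero_smul, eq_comm, smul_eq_zero_iff_left hc] at h2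
      linarith
    · -- `a` is a multiple of `c`.
      set r := (K (a + c) b - K a b)⁻¹ * (K c b - K (a + c) b) with hr
      have h5 : a = r • c := by
        rw [hr, mul_smul, ← h2, smul_smul, inv_mul_cancel₀ h4, one_smul]
      have h6 := hsmul₁ r c b b
      rw [← h5, hK a b hb hba, hK c b hb hbc, smul_comm, ← h5, ← sub_eq_zero, ← sub_smul,
        smul_eq_zero_iff_left ha] at h6
      have h7 : (K a b - K c b) * B b b = 0 := by linear_combination h6
      simpa [hbb, sub_eq_zero] using h7
  obtain ⟨e, he, -, -⟩ := exists_ne_zero_orthogonal hV B 0 0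
  obtain ⟨f, hf, hef, -⟩ := exists_ne_zero_orthogonal hV B e e
  have hconst : ∀ a b, a ≠ 0 → b ≠ 0 → B b a = 0 → K a b = K f e := by
    intro a b ha hb hab
    obtain ⟨c, hc, hbc, hec⟩ := exists_ne_zero_orthogonal hV B b e
    rw [hKeq a c b ha hc hb hab hbc, hKsymm c b hc hb hbc,
      hKeq b e c hb he hc (by rw [hsymm, hbc]) (by rw [hsymm, hec]),
      hKsymm e c he hc (by rw [hsymm, hec]), hKeq c f e hc hf he hec hef]
  set κ := K f e
  have hdiag : ∀ a b, R a b b = κ • (B b b • a - B a b • b) := by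
    intro a b
    by_cases hb : b = 0
    · subst hb
      have : R a 0 0 = 0 := by have := hadd₂ a 0 0 0; simpa using this
      simp [this]
    have hbb := (hpos b hb).ne'
    have hRbb : R b b b = 0 := by
      have h1 := hanti b b b
      have h2 : (2 : ℝ) • R b b b = 0 := by rw [two_smul]; nth_rewrite 1 [h1]; simp
      simpa using h2
    obtain ⟨a', ha', hba'⟩ : ∃ a', a = a' + (B a b / B b b) • b ∧ B b a' = 0 := by
      refine ⟨a - (B a b / B b b) • b, by abel, ?_⟩
      simp [hsymm b a, hbb]
    have h1 : R a' b b = (κ * B b b) • a' := by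
      by_cases h0 : a' = 0
      · have h2 := hsmul₁ 0 a b b
        rw [zero_smul, zero_smul] at h2
        rw [h0, h2, smul_zero]
      · rw [hK a' b hb hba', hconst a' b h0 hb hba']
    calc R a b b = R a' b b + (B a b / B b b) • R b b b := by
          conv_lhs => rw [ha']
          rw [hadd₁, hsmul₁]
      _ = κ • (B b b • (a' + (B a b / B b b) • b) - B a b • b) := by
          rw [h1, hRbb, smul_zero, add_zero, smul_add (B b b), smul_smul (B b b),
            mul_div_cancel₀ _ hbb, add_sub_cancel_right, smul_smul]
      _ = _ := by rw [← ha']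
  -- Polarize, and use the first Bianchi identity.
  have hpol : ∀ a b w, R a b w + R a w b =
      κ • (B b w • a - B a w • b) + κ • (B w b • a - B a b • w) := by
    intro a b w
    have h1 := hdiag a (b + w)
    simp only [hadd₂, hadd₃, hdiag a b, hdiag a w, map_add, add_apply] at h1
    linear_combination (norm := module) h1
  refine ⟨κ, fun a b w => ?_⟩
  have h1 := hpol a b w
  have h2 := hpol b a w
  have h3 := hbianchi a b w
  rw [hanti b a w] at h2
  rw [hanti w a b] at h3
  rw [hsymm w b] at h1
  rw [hsymm w a, hsymm b a] at h2
  have h4 : (3 : ℝ) • (R a b w - κ • (B b w • a - B a w • b)) = 0 := by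
    linear_combination (norm := module) h1 - h2 + h3
  simpa [sub_eq_zero] using h4

end CurvatureAlgebra

section Curvature

variable {V : Type*} [NormedAddCommGroup V] [NormedSpace ℝ V] [FiniteDimensional ℝ V]
  {W : Type*} [NormedAddCommGroup W] [NormedSpace ℝ W] [FiniteDimensional ℝ W]

namespace IsChartMetric

/-- An isometry is affine for the Levi-Civita connections. -/
lemma covHessian_of_isometry {G₁ : W → W →L[ℝ] W →L[ℝ] ℝ} {G₂ : V → V →L[ℝ] V →L[ℝ] ℝ}
    {Ω₁ : Set W} {Ω₂ : Set V} (hG₁ : IsChartMetric G₁ Ω₁) (hG₂ : IsChartMetric G₂ Ω₂)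
    {h : W → V} {u : W} (hh : ContDiffAt ℝ ∞ h u) (hu : u ∈ Ω₁) (hhu : h u ∈ Ω₂)
    (hsurj : Function.Surjective (fderiv ℝ h u))
    (hiso : ∀ᶠ z in 𝓝 u, ∀ a b, G₁ z a b = G₂ (h z) (fderiv ℝ h z a) (fderiv ℝ h z b))
    (a b : W) :
    covHessian (leviCivita G₂) h u a b = fderiv ℝ h u (leviCivita G₁ u a b) := by
  have hD : ∀ a b c, fderiv ℝ G₁ u a b c =
      fderiv ℝ G₂ (h u) (fderiv ℝ h u a) (fderiv ℝ h u b) (fderiv ℝ h u c)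
      + G₂ (h u) (fderiv ℝ (fderiv ℝ h) u a b) (fderiv ℝ h u c)
      + G₂ (h u) (fderiv ℝ h u b) (fderiv ℝ (fderiv ℝ h) u a c) := by
    intro a b c
    have h1 : HasFDerivAt (fun z => G₁ z b c) _ u :=
      (((hG₁.differentiableAt hu).hasFDerivAt.clm_apply (hasFDerivAt_const b u)).clm_apply
        (hasFDerivAt_const c u))
    have h2 : HasFDerivAt (fun z => G₂ (h z)) ((fderiv ℝ G₂ (h u)).comp (fderiv ℝ h u)) u :=
      (hG₂.differentiableAt hhu).hasFDerivAt.comp u hh.hasFDerivAt_self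
    have h3 : HasFDerivAt (fun z => G₂ (h z) (fderiv ℝ h z b) (fderiv ℝ h z c)) _ u :=
      (h2.clm_apply (hh.hasFDerivAt_fderiv.clm_apply (hasFDerivAt_const b u))).clm_apply
        (hh.hasFDerivAt_fderiv.clm_apply (hasFDerivAt_const c u))
    have h4 : (fun z => G₁ z b c) =ᶠ[𝓝 u]
        fun z => G₂ (h z) (fderiv ℝ h z b) (fderiv ℝ h z c) := by
      filter_upwards [hiso] with z hz using hz b c
    have h5 := congrArg (fun L => L a) ((h1.congr_of_eventuallyEq h4.symm).unique h3)
    simp at h5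
    rw [h5]; ring
  refine hG₂.ext_of_apply hhu fun w => ?_
  obtain ⟨c, rfl⟩ := hsurj w
  rw [← hiso.self_of_nhds, hG₁.apply_leviCivita hu, hD, hD, hD, covHessian, map_add,
    add_apply, hG₂.apply_leviCivita hhu, hh.fderiv_fderiv_symm b a, hh.fderiv_fderiv_symm c a,
    hh.fderiv_fderiv_symm c b, hG₂.symm _ hhu (fderiv ℝ (fderiv ℝ h) u a c)]
  ring

variable {G : V → V →L[ℝ] V →L[ℝ] ℝ} {Ω : Set V} (hG : IsChartMetric G Ω) {y : V}
include hG

lemma apply_chartCurvature_self (hy : y ∈ Ω) (a b w : V) :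
    G y (chartCurvature (leviCivita G) y a b w) w = 0 := by
  have hΓ := (hG.differentiableAt_leviCivita hy).hasFDerivAt
  have hD := (hG.contDiffAt hy).hasFDerivAt_fderiv
  have key : ∀ a b, fderiv ℝ (fderiv ℝ G) y a b w w =
      2 * (G y (leviCivita G y a (leviCivita G y b w)) w
        + G y (leviCivita G y b w) (leviCivita G y a w)
        + G y (fderiv ℝ (leviCivita G) y a b w) w) := by
    intro a b
    have h1 : HasFDerivAt (fun z => fderiv ℝ G z b w w) _ y :=
      ((hD.clm_apply (hasFDerivAt_const b y)).clm_apply (hasFDerivAt_const w y)).clm_apply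
        (hasFDerivAt_const w y)
    have h2 : HasFDerivAt (fun z => G z (leviCivita G z b w) w) _ y :=
      ((hG.differentiableAt hy).hasFDerivAt.clm_apply ((hΓ.clm_apply
        (hasFDerivAt_const b y)).clm_apply (hasFDerivAt_const w y))).clm_apply
        (hasFDerivAt_const w y)
    have h3 : (fun z => fderiv ℝ G z b w w) =ᶠ[𝓝 y]
        fun z => 2 * G z (leviCivita G z b w) w := by
      filter_upwards [hG.isOpen.mem_nhds hy] with z hz
      rw [hG.fderiv_apply hz, hG.symm z hz w]; ring
    have h5 := congrArg (fun L => L a)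
      ((h1.congr_of_eventuallyEq h3.symm).unique (h2.const_mul 2))
    simp at h5
    rw [h5, hG.fderiv_apply hy]; ring
  have h1 := key a b
  rw [(hG.contDiffAt hy).fderiv_fderiv_symm, key b a,
    hG.symm y hy (leviCivita G y b w) (leviCivita G y a w)] at h1
  simp only [chartCurvature, map_add, map_sub, add_apply, sub_apply]
  linarith

lemma fderiv_leviCivita_symm (hy : y ∈ Ω) (a b w : V) :
    fderiv ℝ (leviCivita G) y a b w = fderiv ℝ (leviCivita G) y a w b := by
  have hΓ := (hG.differentiableAt_leviCivita hy).hasFDerivAt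
  have h1 : HasFDerivAt (fun z => leviCivita G z b w) _ y :=
    (hΓ.clm_apply (hasFDerivAt_const b y)).clm_apply (hasFDerivAt_const w y)
  have h2 : HasFDerivAt (fun z => leviCivita G z w b) _ y :=
    (hΓ.clm_apply (hasFDerivAt_const w y)).clm_apply (hasFDerivAt_const b y)
  have h3 : (fun z => leviCivita G z b w) =ᶠ[𝓝 y] fun z => leviCivita G z w b := by
    filter_upwards [hG.isOpen.mem_nhds hy] with z hz using hG.leviCivita_symm hz b w
  have := congrArg (fun L => L a) ((h1.congr_of_eventuallyEq h3.symm).unique h2)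
  simpa using this

/-- The first Bianchi identity. -/
lemma chartCurvature_bianchi (hy : y ∈ Ω) (a b w : V) :
    chartCurvature (leviCivita G) y a b w + chartCurvature (leviCivita G) y b w a
      + chartCurvature (leviCivita G) y w a b = 0 := by
  simp only [chartCurvature, hG.fderiv_leviCivita_symm hy _ w, hG.leviCivita_symm hy w,
    hG.fderiv_leviCivita_symm hy _ b a, hG.leviCivita_symm hy b a]
  abel

/-- If `R(a, b) b` lies in the span of `a` and `b` at every point, then the curvature is
pointwise constant. -/
lemma exists_chartCurvature_eq (hV : 3 ≤ Module.finrank ℝ V) (hy : y ∈ Ω)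
    (hspan : ∀ a b, ∃ s t : ℝ, chartCurvature (leviCivita G) y a b b = s • a + t • b) :
    ∃ κ : ℝ, ∀ a b w, chartCurvature (leviCivita G) y a b w =
      κ • (G y b w • a - G y a w • b) := by
  refine exists_eq_smul_of_mem_span hV (G y) (hG.symm y hy) (hG.pos y hy) _ ?_ ?_ ?_ ?_
    (hG.apply_chartCurvature_self hy) (hG.chartCurvature_bianchi hy) hspan
  · intro a a' b w; simp [chartCurvature]; abel
  · intro t a b w; simp [chartCurvature]; module
  · intro a b w w'; simp [chartCurvature]; abel
  · intro a b w; simp [chartCurvature]; abel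

/-- The second Bianchi identity and Schur's lemma. -/
lemma fderiv_eq_zero_of_chartCurvature_eq (hV : 3 ≤ Module.finrank ℝ V) (hy : y ∈ Ω) {κ : V → ℝ}
    (hκ : DifferentiableAt ℝ κ y)
    (hR : ∀ᶠ z in 𝓝 y, ∀ a b w, chartCurvature (leviCivita G) z a b w =
      κ z • (G z b w • a - G z a w • b)) : fderiv ℝ κ y = 0 := by
  have hΓ := (hG.differentiableAt_leviCivita hy).hasFDerivAt
  have hDΓ := (hG.contDiffAt_leviCivita hy).hasFDerivAt_fderiv
  have hGd := (hG.differentiableAt hy).hasFDerivAt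
  -- Differentiating the formula for the curvature.
  have key : ∀ a b c w, fderiv ℝ (fderiv ℝ (leviCivita G)) y a b c w
      - fderiv ℝ (fderiv ℝ (leviCivita G)) y a c b w
      + fderiv ℝ (leviCivita G) y a b (leviCivita G y c w)
      + leviCivita G y b (fderiv ℝ (leviCivita G) y a c w)
      - fderiv ℝ (leviCivita G) y a c (leviCivita G y b w)
      - leviCivita G y c (fderiv ℝ (leviCivita G) y a b w) =
      fderiv ℝ κ y a • (G y c w • b - G y b w • c) +
        κ y • (fderiv ℝ G y a c w • b - fderiv ℝ G y a b w • c) := by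
    intro a b c w
    have hc := fun c : V => hasFDerivAt_const (𝕜 := ℝ) c y
    have h1 : HasFDerivAt (fun z => chartCurvature (leviCivita G) z b c w) _ y :=
      ((((hDΓ.clm_apply (hc b)).clm_apply (hc c)).clm_apply (hc w)).sub
        (((hDΓ.clm_apply (hc c)).clm_apply (hc b)).clm_apply (hc w))).add
        ((hΓ.clm_apply (hc b)).clm_apply ((hΓ.clm_apply (hc c)).clm_apply (hc w))) |>.sub
        ((hΓ.clm_apply (hc c)).clm_apply ((hΓ.clm_apply (hc b)).clm_apply (hc w)))
    have h2 : HasFDerivAt (fun z => κ z • (G z c w • b - G z b w • c)) _ y :=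
      hκ.hasFDerivAt.smul (((hGd.clm_apply (hc c)).clm_apply (hc w)).smul_const b |>.sub
        (((hGd.clm_apply (hc b)).clm_apply (hc w)).smul_const c))
    have h3 : (fun z => chartCurvature (leviCivita G) z b c w) =ᶠ[𝓝 y]
        fun z => κ z • (G z c w • b - G z b w • c) := by
      filter_upwards [hR] with z hz using hz b c w
    have h5 := congrArg (fun L => L a) ((h1.congr_of_eventuallyEq h3.symm).unique h2)
    simp at h5
    linear_combination (norm := module) h5
  have hR₀ := hR.self_of_nhds
  -- The second Bianchi identity, in which all terms but the derivatives of `κ` cancel.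
  have hsum : ∀ a b c w, fderiv ℝ κ y a • (G y c w • b - G y b w • c)
      + fderiv ℝ κ y b • (G y a w • c - G y c w • a)
      + fderiv ℝ κ y c • (G y b w • a - G y a w • b) = 0 := by
    intro a b c w
    have e1 := key a b c w
    have e2 := key b c a w
    have e3 := key c a b w
    have f1 := hR₀ b c (leviCivita G y a w)
    have f2 := hR₀ c a (leviCivita G y b w)
    have f3 := hR₀ a b (leviCivita G y c w)
    have g1 := congrArg (leviCivita G y a) (hR₀ b c w)
    have g2 := congrArg (leviCivita G y b) (hR₀ c a w)
    have g3 := congrArg (leviCivita G y c) (hR₀ a b w)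
    have s := fun a b => (hG.contDiffAt_leviCivita hy).fderiv_fderiv_symm a b
    rw [s b a] at e2
    rw [s c a, s c b] at e3
    simp only [hG.fderiv_apply hy, hG.leviCivita_symm hy b a, hG.leviCivita_symm hy c a,
      hG.leviCivita_symm hy c b] at e1 e2 e3
    simp only [chartCurvature, map_add, map_sub, map_smul, hG.leviCivita_symm hy b a,
      hG.leviCivita_symm hy c a,
      hG.leviCivita_symm hy c b] at f1 f2 f3 g1 g2 g3
    linear_combination (norm := module) f1 + f2 + f3 - e1 - e2 - e3 - g1 - g2 - g3
  -- Evaluating it on mutually orthogonal `a`, `b`, `c` requires dimension at least three.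
  ext a
  rw [zero_apply]
  obtain ⟨c, hc, hac, -⟩ := exists_ne_zero_orthogonal hV (G y) a a
  obtain ⟨b, hb, hab, hcb⟩ := exists_ne_zero_orthogonal hV (G y) a c
  have h1 := congrArg (G y b) (hsum a b c c)
  simp only [map_add, map_sub, map_smul, smul_eq_mul, hac, hG.symm y hy b c, hcb,
    hG.symm y hy b a, hab, map_zero] at h1
  have h2 : fderiv ℝ κ y a * (G y c c * G y b b) = 0 := by linear_combination h1
  simpa [(hG.pos y hy c hc).ne', (hG.pos y hy b hb).ne'] using h2

end IsChartMetric

end Curvature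

/-! ### Flows preserving countable unions of tangent bundles -/

section Tangency

lemma eventually_injective {U V : Type*} [NormedAddCommGroup U] [NormedSpace ℝ U]
    [FiniteDimensional ℝ U] [NormedAddCommGroup V] [NormedSpace ℝ V] [FiniteDimensional ℝ V]
    {L₀ : U →L[ℝ] V} (h : Function.Injective L₀) :
    ∀ᶠ L : U →L[ℝ] V in 𝓝 L₀, Function.Injective L := by
  have : CompleteSpace U := FiniteDimensional.complete ℝ U
  obtain ⟨g, hg⟩ := LinearMap.exists_leftInverse_of_injective (L₀ : U →ₗ[ℝ] V)
    (LinearMap.ker_eq_bot.2 h)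
  have hc : Continuous fun L : U →L[ℝ] V => (LinearMap.toContinuousLinearMap g).comp L :=
    continuous_const.clm_comp continuous_id
  have h1 : IsUnit ((LinearMap.toContinuousLinearMap g).comp L₀) := by
    have : (LinearMap.toContinuousLinearMap g).comp L₀ = 1 := by
      ext x; exact LinearMap.congr_fun hg x
    rw [this]; exact isUnit_one
  filter_upwards [hc.continuousAt.preimage_mem_nhds (Units.isOpen.mem_nhds h1)] with L hL
  obtain ⟨e, he⟩ := hL
  intro a b hab
  have h2 : ((e⁻¹ : (U →L[ℝ] U)ˣ) : U →L[ℝ] U) * ((e : U →L[ℝ] U)) = 1 := e.inv_mul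
  have h3 : ∀ a, ((e⁻¹ : (U →L[ℝ] U)ˣ) : U →L[ℝ] U) (g (L a)) = a := fun a => by
    have := congrArg (fun L : U →L[ℝ] U => L a) h2
    rw [he] at this
    exact this
  rw [← h3 a, hab, h3]

/-- If the injective map `(D₁, D₂)` takes values in the pairs `(α, β)` with `L α = 0` and
`S α + L β = 0`, then its domain has dimension at most `2 dim ker L`. -/
lemma finrank_le_of_injective {U V F : Type*} [AddCommGroup U] [Module ℝ U]
    [FiniteDimensional ℝ U] [AddCommGroup V] [Module ℝ V] [FiniteDimensional ℝ V]
    [AddCommGroup F] [Module ℝ F] (L S : V →ₗ[ℝ] F) (D₁ D₂ : U →ₗ[ℝ] V)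
    (hinj : ∀ w, D₁ w = 0 → D₂ w = 0 → w = 0) (h₁ : ∀ w, L (D₁ w) = 0)
    (h₂ : ∀ w, S (D₁ w) + L (D₂ w) = 0) :
    Module.finrank ℝ U ≤ 2 * Module.finrank ℝ (LinearMap.ker L) := by
  have e1 := D₁.finrank_range_add_finrank_ker
  have e2 : Module.finrank ℝ (LinearMap.range D₁) ≤ Module.finrank ℝ (LinearMap.ker L) := by
    apply Submodule.finrank_mono
    rintro _ ⟨w, rfl⟩
    exact h₁ w
  have e3 : Module.finrank ℝ (LinearMap.ker D₁) ≤ Module.finrank ℝ (LinearMap.ker L) := by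
    let f : LinearMap.ker D₁ →ₗ[ℝ] LinearMap.ker L :=
      LinearMap.codRestrict _ (D₂.comp (LinearMap.ker D₁).subtype) (fun w => by
        have := h₂ w
        rw [LinearMap.mem_ker.1 w.2] at this
        simpa using this)
    refine LinearMap.finrank_le_finrank_of_injective (f := f) ?_
    rw [← LinearMap.ker_eq_bot, LinearMap.ker_eq_bot']
    intro w hw
    have h3 : D₂ w = 0 := congrArg Subtype.val hw
    exact Subtype.ext (hinj w w.2 h3)
  omega

/-- Baire category: an open set covered by countably many sets, each of which is relatively closed
in an open set, contains a nonempty open subset of one of them. -/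
lemma exists_open_subset_of_countable_cover {X ι : Type*} [TopologicalSpace X] [BaireSpace X]
    [Countable ι] {A : Set X} (hA : IsOpen A) (hne : A.Nonempty) (O P : ι → Set X)
    (hO : ∀ i, IsOpen (O i)) (hP : ∀ i, closure (P i) ∩ O i ∩ A ⊆ P i) (hPO : ∀ i, P i ⊆ O i)
    (hcov : A ⊆ ⋃ i, P i) : ∃ i B, IsOpen B ∧ B.Nonempty ∧ B ⊆ A ∧ B ⊆ P i := by
  have hd := dense_iUnion_interior_of_closed
    (f := fun j : Option ι => j.elim Aᶜ fun i => closure (P i))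
    (by rintro (_ | i); exacts [hA.isClosed_compl, isClosed_closure])
    (by
      refine eq_univ_of_forall fun x => ?_
      by_cases hx : x ∈ A
      · obtain ⟨i, hi⟩ := mem_iUnion.1 (hcov hx)
        exact mem_iUnion.2 ⟨some i, subset_closure hi⟩
      · exact mem_iUnion.2 ⟨none, hx⟩)
  obtain ⟨x, hxA, hx⟩ := hd.inter_open_nonempty A hA hne
  obtain ⟨j, hj⟩ := mem_iUnion.1 hx
  rcases j with _ | i
  · exact absurd hxA (interior_subset hj)
  · have hop : IsOpen (A ∩ interior (closure (P i))) := hA.inter isOpen_interior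
    obtain ⟨p, ⟨hpA, hpi⟩, hpP⟩ := mem_closure_iff.1 (interior_subset hj) _ hop ⟨hxA, hj⟩
    exact ⟨i, A ∩ interior (closure (P i)) ∩ O i, hop.inter (hO i), ⟨p, ⟨hpA, hpi⟩, hPO i hpP⟩,
      fun z hz => hz.1.1, fun z hz => hP i ⟨⟨interior_subset hz.1.2, hz.2⟩, hz.1.1⟩⟩

/-- A map into `V × V` whose values lie in a countable union of the tangent bundles of
`k`-dimensional slices `{s_i = 0}` has rank at most `2 k`. -/
lemma not_injective_of_countable_slices {ι U V F : Type*} [Countable ι]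
    [NormedAddCommGroup U] [NormedSpace ℝ U] [FiniteDimensional ℝ U]
    [NormedAddCommGroup V] [NormedSpace ℝ V] [FiniteDimensional ℝ V]
    [NormedAddCommGroup F] [NormedSpace ℝ F] {k : ℕ} (hdim : 2 * k < Module.finrank ℝ U)
    (O : ι → Set V) (hO : ∀ i, IsOpen (O i)) (s : ι → V → F)
    (hs : ∀ i, ∀ y ∈ O i, ContDiffAt ℝ ∞ (s i) y)
    (hk : ∀ i, ∀ y ∈ O i, Module.finrank ℝ (LinearMap.ker (fderiv ℝ (s i) y : V →ₗ[ℝ] F)) ≤ k)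
    {F₁ F₂ : U → V} {a₀ : U} (h₁ : ContDiffAt ℝ 1 F₁ a₀) (h₂ : ContDiffAt ℝ 1 F₂ a₀)
    (hcov : ∀ᶠ a in 𝓝 a₀, ∃ i, F₁ a ∈ O i ∧ s i (F₁ a) = 0 ∧ fderiv ℝ (s i) (F₁ a) (F₂ a) = 0) :
    ∃ w, w ≠ 0 ∧ fderiv ℝ F₁ a₀ w = 0 ∧ fderiv ℝ F₂ a₀ w = 0 := by
  have : CompleteSpace U := FiniteDimensional.complete ℝ U
  by_contra! hcon
  have hinj₀ : Function.Injective ((fderiv ℝ F₁ a₀).prod (fderiv ℝ F₂ a₀)) := by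
    rw [injective_iff_map_eq_zero]
    intro w hw
    by_contra hw0
    simp only [ContinuousLinearMap.prod_apply, Prod.mk_eq_zero] at hw
    exact hcon w hw0 hw.1 hw.2
  have hcont : ContinuousAt (fun a => (fderiv ℝ F₁ a).prod (fderiv ℝ F₂ a)) a₀ := by
    have c1 : ContinuousAt (fderiv ℝ F₁) a₀ := (h₁.fderiv_right (m := 0) (by simp)).continuousAt
    have c2 : ContinuousAt (fderiv ℝ F₂) a₀ := (h₂.fderiv_right (m := 0) (by simp)).continuousAt
    exact ContinuousAt.comp (g := fun L : (U →L[ℝ] V) × (U →L[ℝ] V) => L.1.prod L.2)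
      (ContinuousLinearMap.prodₗᵢ ℝ).continuous.continuousAt (c1.prodMk c2)
  have hinj := hcont.eventually (eventually_injective hinj₀)
  obtain ⟨A, hA, hAo, haA⟩ := eventually_nhds_iff.1
    ((h₁.eventually (by simp)).and ((h₂.eventually (by simp)).and (hcov.and hinj)))
  let P : ι → Set U := fun i =>
    {a | a ∈ A ∧ F₁ a ∈ O i ∧ s i (F₁ a) = 0 ∧ fderiv ℝ (s i) (F₁ a) (F₂ a) = 0}
  have hd₁ : ∀ a ∈ A, ∀ i, F₁ a ∈ O i → HasFDerivAt (fun a => s i (F₁ a))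
      ((fderiv ℝ (s i) (F₁ a)).comp (fderiv ℝ F₁ a)) a := fun a ha i hi =>
    (hs i _ hi).hasFDerivAt_self.comp a ((hA a ha).1.differentiableAt (by simp)).hasFDerivAt
  have hd₂ := fun a (ha : a ∈ A) i (hi : F₁ a ∈ O i) =>
    HasFDerivAt.clm_apply ((hs i _ hi).hasFDerivAt_fderiv.comp a
      ((hA a ha).1.differentiableAt (by simp)).hasFDerivAt)
      ((hA a ha).2.1.differentiableAt (by simp)).hasFDerivAt
  have hF₁ : ContinuousOn F₁ A := fun a ha => (hA a ha).1.continuousAt.continuousWithinAt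
  obtain ⟨i, B, hBo, ⟨b, hb⟩, hBA, hBP⟩ := exists_open_subset_of_countable_cover hAo ⟨a₀, haA⟩
    (fun i => A ∩ F₁ ⁻¹' (O i)) P (fun i => hF₁.isOpen_inter_preimage hAo (hO i))
    (by
      rintro i a ⟨⟨ha, haO⟩, haA⟩
      have hfr := mem_closure_iff_frequently.1 ha
      refine ⟨haA, haO.2, ?_, ?_⟩
      · by_contra hne
        have := (hd₁ a haA i haO.2).continuousAt.eventually_ne hne
        obtain ⟨z, hz, hz'⟩ := (hfr.and_eventually this).exists
        exact hz' hz.2.2.1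
      · by_contra hne
        have := (hd₂ a haA i haO.2).continuousAt.eventually_ne hne
        obtain ⟨z, hz, hz'⟩ := (hfr.and_eventually this).exists
        exact hz' hz.2.2.2)
    (fun i a ha => ⟨ha.1, ha.2.1⟩)
    (fun a ha => by
      obtain ⟨i, hi⟩ := (hA a ha).2.2.1
      exact mem_iUnion.2 ⟨i, ha, hi⟩)
  have hbA := hBA hb
  have hbO := (hBP hb).2.1
  have z₁ : (fun a => s i (F₁ a)) =ᶠ[𝓝 b] fun _ => 0 := by
    filter_upwards [hBo.mem_nhds hb] with a ha using (hBP ha).2.2.1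
  have z₂ : (fun a => fderiv ℝ (s i) (F₁ a) (F₂ a)) =ᶠ[𝓝 b] fun _ => 0 := by
    filter_upwards [hBo.mem_nhds hb] with a ha using (hBP ha).2.2.2
  have e₁ := (hd₁ b hbA i hbO).fderiv
  have e₂ := (hd₂ b hbA i hbO).fderiv
  rw [z₁.fderiv_eq] at e₁
  change fderiv ℝ (fun a => fderiv ℝ (s i) (F₁ a) (F₂ a)) b = _ at e₂
  rw [z₂.fderiv_eq] at e₂
  have hle := finrank_le_of_injective (fderiv ℝ (s i) (F₁ b) : V →ₗ[ℝ] F)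
    ((fderiv ℝ (fderiv ℝ (s i)) (F₁ b)).flip (F₂ b) : V →ₗ[ℝ] F)
    (fderiv ℝ F₁ b : U →ₗ[ℝ] V) (fderiv ℝ F₂ b : U →ₗ[ℝ] V)
    (fun w hw₁ hw₂ => (hA b hbA).2.2.2 (by
      rw [ContinuousLinearMap.prod_apply, map_zero]
      exact Prod.ext hw₁ hw₂))
    (fun w => by have := congrArg (fun L => L w) e₁; simpa using this.symm)
    (fun w => by
      have := congrArg (fun L => L w) e₂
      simp at this
      rw [add_comm] at this
      exact this.symm)
  have := hk i _ hbO
  omega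

/-- Suppose that the points of the tangent bundle of a parametrized `k`-dimensional submanifold `h`
stay in countably many tangent bundles of `k`-dimensional slices under the local flow `Ψ`. Then the
generator of `Ψ` is tangent to the tangent bundle of `h`. -/
lemma tangent_of_countable_slices {ι W V F : Type*} [Countable ι]
    [NormedAddCommGroup W] [NormedSpace ℝ W] [FiniteDimensional ℝ W]
    [NormedAddCommGroup V] [NormedSpace ℝ V] [FiniteDimensional ℝ V]
    [NormedAddCommGroup F] [NormedSpace ℝ F]
    (O : ι → Set V) (hO : ∀ i, IsOpen (O i)) (s : ι → V → F)
    (hs : ∀ i, ∀ y ∈ O i, ContDiffAt ℝ ∞ (s i) y)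
    (hk : ∀ i, ∀ y ∈ O i, Module.finrank ℝ (LinearMap.ker (fderiv ℝ (s i) y : V →ₗ[ℝ] F)) ≤
      Module.finrank ℝ W)
    {h : W → V} {u ξ : W} (hh : ContDiffAt ℝ ∞ h u) (hinj : Function.Injective (fderiv ℝ h u))
    {Ψ : ℝ × V × V → V × V} (hΨ : ContDiffAt ℝ ∞ Ψ (0, h u, fderiv ℝ h u ξ))
    (hΨ₀ : ∀ᶠ q in 𝓝 (h u, fderiv ℝ h u ξ), Ψ (0, q) = q)
    (hcov : ∀ᶠ a : ℝ × W × W in 𝓝 (0, u, ξ), ∃ i,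
      (Ψ (a.1, h a.2.1, fderiv ℝ h a.2.1 a.2.2)).1 ∈ O i ∧
      s i (Ψ (a.1, h a.2.1, fderiv ℝ h a.2.1 a.2.2)).1 = 0 ∧
      fderiv ℝ (s i) (Ψ (a.1, h a.2.1, fderiv ℝ h a.2.1 a.2.2)).1
        (Ψ (a.1, h a.2.1, fderiv ℝ h a.2.1 a.2.2)).2 = 0) :
    ∃ a b, fderiv ℝ Ψ (0, h u, fderiv ℝ h u ξ) (1, 0) =
      (fderiv ℝ h u a, fderiv ℝ (fderiv ℝ h) u a ξ + fderiv ℝ h u b) := by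
  set Q : ℝ × W × W → ℝ × V × V := fun a => (a.1, h a.2.1, fderiv ℝ h a.2.1 a.2.2) with hQ
  have hu : ContDiffAt ℝ ∞ (fun a : ℝ × W × W => h a.2.1) (0, u, ξ) :=
    ContDiffAt.comp (f := fun a : ℝ × W × W => a.2.1) (0, u, ξ) hh (by fun_prop)
  have hu' : ContDiffAt ℝ ∞ (fun a : ℝ × W × W => fderiv ℝ h a.2.1) (0, u, ξ) :=
    ContDiffAt.comp (f := fun a : ℝ × W × W => a.2.1) (0, u, ξ)
      (hh.fderiv_right (m := ∞) (by simp)) (by fun_prop)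
  have hQs : ContDiffAt ℝ ∞ Q (0, u, ξ) :=
    contDiffAt_fst.prodMk (hu.prodMk (hu'.clm_apply (by fun_prop)))
  have hF : ContDiffAt ℝ ∞ (fun a => Ψ (Q a)) (0, u, ξ) := ContDiffAt.comp _ hΨ hQs
  have hQd : ∀ w : ℝ × W × W, fderiv ℝ Q (0, u, ξ) w = (w.1, fderiv ℝ h u w.2.1,
      fderiv ℝ (fderiv ℝ h) u w.2.1 ξ + fderiv ℝ h u w.2.2) := by
    intro w
    have d1 : HasFDerivAt (fun a : ℝ × W × W => a.2.1)
      ((ContinuousLinearMap.fst ℝ W W).comp (ContinuousLinearMap.snd ℝ ℝ (W × W))) (0, u, ξ) :=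
      ((ContinuousLinearMap.fst ℝ W W).comp (ContinuousLinearMap.snd ℝ ℝ (W × W))).hasFDerivAt
    have d2 : HasFDerivAt (fun a : ℝ × W × W => a.2.2)
      ((ContinuousLinearMap.snd ℝ W W).comp (ContinuousLinearMap.snd ℝ ℝ (W × W))) (0, u, ξ) :=
      ((ContinuousLinearMap.snd ℝ W W).comp (ContinuousLinearMap.snd ℝ ℝ (W × W))).hasFDerivAt
    have d3 : HasFDerivAt (fun a : ℝ × W × W => h a.2.1) _ (0, u, ξ) :=
      HasFDerivAt.comp (f := fun a : ℝ × W × W => a.2.1) (0, u, ξ) hh.hasFDerivAt_self d1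
    have d4 : HasFDerivAt (fun a : ℝ × W × W => fderiv ℝ h a.2.1) _ (0, u, ξ) :=
      HasFDerivAt.comp (f := fun a : ℝ × W × W => a.2.1) (0, u, ξ) hh.hasFDerivAt_fderiv d1
    have d5 : HasFDerivAt Q _ (0, u, ξ) :=
      (hasFDerivAt_fst (𝕜 := ℝ) (p := ((0, u, ξ) : ℝ × W × W))).prodMk (d3.prodMk (d4.clm_apply d2))
    rw [d5.fderiv]
    simp [add_comm]
  have hcomp : HasFDerivAt (fun a => Ψ (Q a))
      ((fderiv ℝ Ψ (0, h u, fderiv ℝ h u ξ)).comp (fderiv ℝ Q (0, u, ξ))) (0, u, ξ) :=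
    HasFDerivAt.comp (f := Q) (0, u, ξ) hΨ.hasFDerivAt_self hQs.hasFDerivAt_self
  have hid : ∀ q : V × V, fderiv ℝ Ψ (0, h u, fderiv ℝ h u ξ) (0, q) = q := by
    intro q
    have h1 : HasFDerivAt (fun q : V × V => Ψ (0, q)) _ (h u, fderiv ℝ h u ξ) :=
      HasFDerivAt.comp (f := fun q : V × V => ((0 : ℝ), q)) _ hΨ.hasFDerivAt_self
        ((hasFDerivAt_const (0 : ℝ) _).prodMk (hasFDerivAt_id _))
    have h2 := h1.unique ((hasFDerivAt_id _).congr_of_eventuallyEq hΨ₀)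
    simpa using congrArg (fun L => L q) h2
  have hdF : ∀ w : ℝ × W × W, fderiv ℝ (fun a => Ψ (Q a)) (0, u, ξ) w =
      w.1 • fderiv ℝ Ψ (0, h u, fderiv ℝ h u ξ) (1, 0) + (fderiv ℝ h u w.2.1,
        fderiv ℝ (fderiv ℝ h) u w.2.1 ξ + fderiv ℝ h u w.2.2) := by
    intro w
    rw [hcomp.fderiv, ContinuousLinearMap.comp_apply, hQd]
    conv_lhs => rw [show ∀ q : V × V, (w.1, q) = w.1 • ((1 : ℝ), (0 : V × V)) + (0, q) by
      intro q; simp, map_add, map_smul, hid]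
  have hd1 : HasFDerivAt (fun a => (Ψ (Q a)).1) _ (0, u, ξ) := hF.hasFDerivAt_self.fst
  have hd2 : HasFDerivAt (fun a => (Ψ (Q a)).2) _ (0, u, ξ) := hF.hasFDerivAt_self.snd
  obtain ⟨w, hw0, hw₁, hw₂⟩ := not_injective_of_countable_slices (k := Module.finrank ℝ W)
    (U := ℝ × W × W) (by simp; omega) O hO s hs hk
    ((contDiffAt_fst.comp _ hF).of_le (by simp) : ContDiffAt ℝ 1 (fun a => (Ψ (Q a)).1) (0, u, ξ))
    ((contDiffAt_snd.comp _ hF).of_le (by simp) : ContDiffAt ℝ 1 (fun a => (Ψ (Q a)).2) (0, u, ξ))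
    hcov
  change fderiv ℝ (fun a => (Ψ (Q a)).1) (0, u, ξ) w = 0 at hw₁
  change fderiv ℝ (fun a => (Ψ (Q a)).2) (0, u, ξ) w = 0 at hw₂
  rw [hd1.fderiv] at hw₁
  rw [hd2.fderiv] at hw₂
  have hw : fderiv ℝ (fun a => Ψ (Q a)) (0, u, ξ) w = 0 := Prod.ext hw₁ hw₂
  rw [hdF] at hw
  have ht : w.1 ≠ 0 := by
    intro ht
    rw [ht, zero_smul, zero_add, Prod.mk_eq_zero] at hw
    have h1 : w.2.1 = 0 := hinj (by rw [hw.1, map_zero])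
    have h2 : w.2.2 = 0 := hinj (by simpa [h1] using hw.2)
    exact hw0 (Prod.ext ht (Prod.ext h1 h2))
  refine ⟨-w.1⁻¹ • w.2.1, -w.1⁻¹ • w.2.2, ?_⟩
  have h3 : fderiv ℝ Ψ (0, h u, fderiv ℝ h u ξ) (1, 0) = -w.1⁻¹ • (fderiv ℝ h u w.2.1,
        fderiv ℝ (fderiv ℝ h) u w.2.1 ξ + fderiv ℝ h u w.2.2) := by
    rw [eq_neg_of_add_eq_zero_right hw, smul_neg, neg_smul, neg_neg, smul_smul, inv_mul_cancel₀ ht,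
      one_smul]
  rw [h3]
  simp only [map_smul, smul_apply, Prod.smul_mk, smul_add]

end Tangency

/-! ### Charts of the tangent bundle -/

section Charts

variable {n : ℕ} {M : Type u} [TopologicalSpace M]
  [ChartedSpace (EuclideanSpace ℝ (Fin n)) M] [IsManifold (𝓡 n) ∞ M]

/-- The chart of `TM` induced by the preferred chart of `M` around `x₀`. -/
def tangentChart (x₀ : M) : PartialEquiv (TangentBundle (𝓡 n) M)
    (EuclideanSpace ℝ (Fin n) × EuclideanSpace ℝ (Fin n)) :=
  extChartAt (𝓡 n).tangent (⟨x₀, 0⟩ : TangentBundle (𝓡 n) M)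

lemma mem_tangentChart_source {x₀ : M} {q : TangentBundle (𝓡 n) M} :
    q ∈ (tangentChart x₀).source ↔ q.proj ∈ (extChartAt (𝓡 n) x₀).source := by
  simp [tangentChart]

lemma tangentChart_apply (x₀ : M) (q : TangentBundle (𝓡 n) M) :
    tangentChart x₀ q = (extChartAt (𝓡 n) x₀ q.proj,
      tangentCoordChange (𝓡 n) q.proj x₀ q.proj q.snd) := rfl

/-- The vector of `T_x M` with coordinates `v` in the preferred chart around `x₀`. -/
def ofChart (x₀ x : M) (v : EuclideanSpace ℝ (Fin n)) : TangentBundle (𝓡 n) M :=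
  ⟨x, tangentCoordChange (𝓡 n) x₀ x x v⟩

lemma tangentChart_ofChart {x₀ x : M} (hx : x ∈ (extChartAt (𝓡 n) x₀).source)
    (v : EuclideanSpace ℝ (Fin n)) :
    tangentChart x₀ (ofChart x₀ x v) = (extChartAt (𝓡 n) x₀ x, v) := by
  refine Prod.ext rfl ?_
  change tangentCoordChange (𝓡 n) x x₀ x (tangentCoordChange (𝓡 n) x₀ x x v) = v
  rw [tangentCoordChange_comp ⟨⟨hx, mem_extChartAt_source x⟩, hx⟩, tangentCoordChange_self hx]

lemma mem_tangentChart_target {x₀ : M} {p : EuclideanSpace ℝ (Fin n) × EuclideanSpace ℝ (Fin n)} :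
    p ∈ (tangentChart x₀).target ↔ p.1 ∈ (extChartAt (𝓡 n) x₀).target := by
  constructor
  · intro hp
    have h1 := mem_tangentChart_source.1 ((tangentChart x₀).map_target hp)
    have h2 := (extChartAt (𝓡 n) x₀).map_source h1
    have h3 : (tangentChart x₀ ((tangentChart x₀).symm p)).1 = p.1 := by
      rw [(tangentChart x₀).right_inv hp]
    rw [← h3]
    exact h2
  · intro hp
    have h1 : (extChartAt (𝓡 n) x₀).symm p.1 ∈ _ := (extChartAt (𝓡 n) x₀).map_target hp
    have h2 := tangentChart_ofChart h1 p.2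
    rw [(extChartAt (𝓡 n) x₀).right_inv hp] at h2
    have h3 := (tangentChart x₀).map_source
      (mem_tangentChart_source.2 h1 :
      ofChart x₀ ((extChartAt (𝓡 n) x₀).symm p.1) p.2 ∈ (tangentChart x₀).source)
    rw [h2] at h3
    exact h3

lemma tangentChart_symm_apply {x₀ : M} {p : EuclideanSpace ℝ (Fin n) × EuclideanSpace ℝ (Fin n)}
    (hp : p.1 ∈ (extChartAt (𝓡 n) x₀).target) :
    (tangentChart x₀).symm p = ofChart x₀ ((extChartAt (𝓡 n) x₀).symm p.1) p.2 := by
  have h1 : (extChartAt (𝓡 n) x₀).symm p.1 ∈ _ := (extChartAt (𝓡 n) x₀).map_target hp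
  have h2 := tangentChart_ofChart h1 p.2
  rw [(extChartAt (𝓡 n) x₀).right_inv hp] at h2
  rw [← (tangentChart x₀).left_inv
    (mem_tangentChart_source.2 h1 :
      ofChart x₀ ((extChartAt (𝓡 n) x₀).symm p.1) p.2 ∈ (tangentChart x₀).source), h2]

lemma tangentCoordChange_eq_fderiv (x y z : M) : tangentCoordChange (𝓡 n) x y z =
    fderiv ℝ (extChartAt (𝓡 n) y ∘ (extChartAt (𝓡 n) x).symm) (extChartAt (𝓡 n) x z) := by
  rw [tangentCoordChange_def]; simp

lemma mfderiv_extChartAt_symm_eq {x₀ : M} {y : EuclideanSpace ℝ (Fin n)}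
    (hy : y ∈ (extChartAt (𝓡 n) x₀).target) :
    @Eq (EuclideanSpace ℝ (Fin n) →L[ℝ] EuclideanSpace ℝ (Fin n))
      (mfderiv (𝓡 n) (𝓡 n) (extChartAt (𝓡 n) x₀).symm y)
      (tangentCoordChange (𝓡 n) x₀ ((extChartAt (𝓡 n) x₀).symm y)
        ((extChartAt (𝓡 n) x₀).symm y)) := by
  have h0 : MDifferentiableAt (𝓡 n) (𝓡 n) (extChartAt (𝓡 n) x₀).symm y := by
    have := mdifferentiableWithinAt_extChartAt_symm (I := 𝓡 n) hy
    rw [ModelWithCorners.range_eq_univ] at this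
    exact mdifferentiableWithinAt_univ.1 this
  refine h0.mfderiv.trans ?_
  rw [tangentCoordChange_eq_fderiv, (extChartAt (𝓡 n) x₀).right_inv hy]
  change fderivWithin ℝ (extChartAt (𝓡 n) ((extChartAt (𝓡 n) x₀).symm y) ∘
    (extChartAt (𝓡 n) x₀).symm) (range (𝓡 n)) y = _
  rw [ModelWithCorners.range_eq_univ, fderivWithin_univ]

/-- The metric at `x`, as a bilinear form on the model space. -/
def metricAt (g : SmoothMetric n M) (x : M) :
    EuclideanSpace ℝ (Fin n) →L[ℝ] EuclideanSpace ℝ (Fin n) →L[ℝ] ℝ := g.inner x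

lemma metricAt_symm (g : SmoothMetric n M) (x : M) (a b : EuclideanSpace ℝ (Fin n)) :
    metricAt g x a b = metricAt g x b a := g.symm x a b

lemma metricAt_pos (g : SmoothMetric n M) (x : M) {a : EuclideanSpace ℝ (Fin n)} (ha : a ≠ 0) :
    0 < metricAt g x a a := g.pos x a ha

lemma chartMetric_apply (g : SmoothMetric n M) {x₀ : M} {y : EuclideanSpace ℝ (Fin n)}
    (hy : y ∈ (extChartAt (𝓡 n) x₀).target) (a b : EuclideanSpace ℝ (Fin n)) :
    chartMetric g x₀ y a b = metricAt g ((extChartAt (𝓡 n) x₀).symm y)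
      (tangentCoordChange (𝓡 n) x₀ ((extChartAt (𝓡 n) x₀).symm y)
        ((extChartAt (𝓡 n) x₀).symm y) a)
      (tangentCoordChange (𝓡 n) x₀ ((extChartAt (𝓡 n) x₀).symm y)
        ((extChartAt (𝓡 n) x₀).symm y) b) := by
  rw [← mfderiv_extChartAt_symm_eq hy]
  rfl

lemma contMDiffOn_tangentChart_symm (x₀ : M) :
    ContMDiffOn 𝓘(ℝ, EuclideanSpace ℝ (Fin n) × EuclideanSpace ℝ (Fin n)) (𝓡 n).tangent ∞
      (tangentChart (n := n) x₀).symm (tangentChart x₀).target :=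
  contMDiffOn_extChartAt_symm (⟨x₀, 0⟩ : TangentBundle (𝓡 n) M)

lemma contMDiffOn_tangentChart (x₀ : M) :
    ContMDiffOn (𝓡 n).tangent 𝓘(ℝ, EuclideanSpace ℝ (Fin n) × EuclideanSpace ℝ (Fin n)) ∞
      (tangentChart (n := n) x₀) (tangentChart x₀).source := by
  have := contMDiffOn_extChartAt (n := ∞) (I := (𝓡 n).tangent)
    (x := (⟨x₀, 0⟩ : TangentBundle (𝓡 n) M))
  rwa [← extChartAt_source (𝓡 n).tangent] at this

lemma contDiffOn_chartMetric_apply (g : SmoothMetric n M) (x₀ : M)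
    (a b : EuclideanSpace ℝ (Fin n)) :
    ContDiffOn ℝ ∞ (fun y => chartMetric g x₀ y a b) (extChartAt (𝓡 n) x₀).target := by
  let : RiemannianBundle (fun x : M => TangentSpace (𝓡 n) x) := ⟨g.toRiemannianMetric⟩
  have hs : ∀ a : EuclideanSpace ℝ (Fin n), ContMDiffOn (𝓡 n) (𝓡 n).tangent ∞
      (fun y => (tangentChart x₀).symm (y, a)) (extChartAt (𝓡 n) x₀).target := fun a =>
    (contMDiffOn_tangentChart_symm x₀).comp
      (contDiff_id.prodMk contDiff_const).contMDiff.contMDiffOn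
      (fun y hy => mem_tangentChart_target.2 hy)
  have h := ContMDiffOn.inner_bundle (b := (extChartAt (𝓡 n) x₀).symm)
    (v := fun y => ((tangentChart x₀).symm (y, a)).snd)
    (w := fun y => ((tangentChart x₀).symm (y, b)).snd) (hs a) (hs b)
  refine (contMDiffOn_iff_contDiffOn.1 h).congr fun y hy => ?_
  rw [chartMetric_apply g hy]
  change _ = metricAt g _ ((tangentChart x₀).symm (y, a)).snd ((tangentChart x₀).symm (y, b)).snd
  rw [tangentChart_symm_apply (p := (y, a)) hy, tangentChart_symm_apply (p := (y, b)) hy]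
  rfl

lemma isChartMetric (g : SmoothMetric n M) (x₀ : M) :
    IsChartMetric (chartMetric g x₀) (extChartAt (𝓡 n) x₀).target where
  isOpen := isOpen_extChartAt_target x₀
  contDiffOn := contDiffOn_clm_apply.2 fun a => contDiffOn_clm_apply.2 fun b =>
    contDiffOn_chartMetric_apply g x₀ a b
  symm y hy a b := by
    rw [chartMetric_apply g hy, chartMetric_apply g hy, metricAt_symm]
  pos y hy a ha := by
    rw [chartMetric_apply g hy]
    have h1 := (extChartAt (𝓡 n) x₀).map_target hy
    refine metricAt_pos g _ fun h => ha ?_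
    rw [← tangentCoordChange_self (v := a) h1, ← tangentCoordChange_comp
      ⟨⟨h1, mem_extChartAt_source _⟩, h1⟩, h, map_zero]

end Charts

/-! ### Changes of charts -/

section Transition

variable {n : ℕ} {M : Type u} [TopologicalSpace M]
  [ChartedSpace (EuclideanSpace ℝ (Fin n)) M] [IsManifold (𝓡 n) ∞ M]

lemma christoffel_eq_leviCivita (g : SmoothMetric n M) (x₀ : M)
    (y a b : EuclideanSpace ℝ (Fin n)) :
    christoffel g x₀ y a b = leviCivita (chartMetric g x₀) y a b := by
  rw [christoffel, leviCivita_apply]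
  rfl

lemma curvature_eq_chartCurvature (g : SmoothMetric n M) (x : M)
    (a b w : EuclideanSpace ℝ (Fin n)) :
    @Eq (EuclideanSpace ℝ (Fin n)) (curvature g x a b w)
      (chartCurvature (leviCivita (chartMetric g x)) (extChartAt (𝓡 n) x x) a b w) := by
  have hd := ((isChartMetric g x).differentiableAt_leviCivita (mem_extChartAt_target x)).hasFDerivAt
  have h1 : ∀ a b w, fderiv ℝ (fun z => christoffel g x z b w) (extChartAt (𝓡 n) x x) a =
      fderiv ℝ (leviCivita (chartMetric g x)) (extChartAt (𝓡 n) x x) a b w := by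
    intro a b w
    simp only [christoffel_eq_leviCivita]
    rw [((hd.clm_apply (hasFDerivAt_const b _)).clm_apply (hasFDerivAt_const w _)).fderiv]
    simp
  have h2 : @Eq (EuclideanSpace ℝ (Fin n)) (curvature g x a b w)
    (fderiv ℝ (fun z => christoffel g x z b w) (extChartAt (𝓡 n) x x) a
    - fderiv ℝ (fun z => christoffel g x z a w) (extChartAt (𝓡 n) x x) b
    + christoffel g x (extChartAt (𝓡 n) x x) a (christoffel g x (extChartAt (𝓡 n) x x) b w)
    - christoffel g x (extChartAt (𝓡 n) x x) b (christoffel g x (extChartAt (𝓡 n) x x) a w)) := rfl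
  rw [h2, h1, h1, chartCurvature]
  simp only [christoffel_eq_leviCivita]

lemma connector_eq (g : SmoothMetric n M) (q : TangentBundle (𝓡 n) M)
    (ξ : EuclideanSpace ℝ (Fin n) × EuclideanSpace ℝ (Fin n)) :
    @Eq (EuclideanSpace ℝ (Fin n)) (connector g q ξ)
      (ξ.2 + leviCivita (chartMetric g q.proj) (extChartAt (𝓡 n) q.proj q.proj) ξ.1 q.snd) := by
  exact congrArg (ξ.2 + ·) (christoffel_eq_leviCivita g q.proj _ ξ.1 q.snd)

/-- The change of coordinates from the preferred chart around `x₀` to the one around `x`. -/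
def chartTransition (x₀ x : M) : EuclideanSpace ℝ (Fin n) → EuclideanSpace ℝ (Fin n) :=
  extChartAt (𝓡 n) x ∘ (extChartAt (𝓡 n) x₀).symm

lemma fderiv_chartTransition (x₀ x : M) {z : M} :
    fderiv ℝ (chartTransition x₀ x) (extChartAt (𝓡 n) x₀ z) = tangentCoordChange (𝓡 n) x₀ x z :=
  (tangentCoordChange_eq_fderiv x₀ x z).symm

lemma contDiffAt_chartTransition {x₀ x z : M} (hz₀ : z ∈ (extChartAt (𝓡 n) x₀).source)
    (hz : z ∈ (extChartAt (𝓡 n) x).source) :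
    ContDiffAt ℝ ∞ (chartTransition x₀ x) (extChartAt (𝓡 n) x₀ z) := by
  have h : extChartAt (𝓡 n) x₀ z ∈ ((extChartAt (𝓡 n) x₀).symm ≫ extChartAt (𝓡 n) x).source := by
    rw [PartialEquiv.trans_source'', PartialEquiv.symm_symm, PartialEquiv.symm_target]
    exact mem_image_of_mem _ ⟨hz₀, hz⟩
  have := contDiffWithinAt_ext_coord_change (I := 𝓡 n) (n := ∞) x x₀ h
  rwa [ModelWithCorners.range_eq_univ, contDiffWithinAt_univ] at this

omit [IsManifold (𝓡 n) ∞ M] in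
lemma chartTransition_apply {x₀ x z : M} (hz₀ : z ∈ (extChartAt (𝓡 n) x₀).source) :
    chartTransition x₀ x (extChartAt (𝓡 n) x₀ z) = extChartAt (𝓡 n) x z := by
  rw [chartTransition, Function.comp_apply, (extChartAt (𝓡 n) x₀).left_inv hz₀]

lemma tangentCoordChange_inverse {x₀ x z : M} (hz₀ : z ∈ (extChartAt (𝓡 n) x₀).source)
    (hz : z ∈ (extChartAt (𝓡 n) x).source) (v : EuclideanSpace ℝ (Fin n)) :
    tangentCoordChange (𝓡 n) x x₀ z (tangentCoordChange (𝓡 n) x₀ x z v) = v := by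
  rw [tangentCoordChange_comp ⟨⟨hz₀, hz⟩, hz₀⟩, tangentCoordChange_self hz₀]

omit [IsManifold (𝓡 n) ∞ M] in
lemma eventually_chart_source {x₀ x z : M} (hz₀ : z ∈ (extChartAt (𝓡 n) x₀).source)
    (hz : z ∈ (extChartAt (𝓡 n) x).source) :
    ∀ᶠ y in 𝓝 (extChartAt (𝓡 n) x₀ z), y ∈ (extChartAt (𝓡 n) x₀).target ∧
      (extChartAt (𝓡 n) x₀).symm y ∈ (extChartAt (𝓡 n) x).source := by
  have h1 := (extChartAt (𝓡 n) x₀).map_source hz₀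
  have h2 : ContinuousAt (extChartAt (𝓡 n) x₀).symm (extChartAt (𝓡 n) x₀ z) :=
    continuousAt_extChartAt_symm'' h1
  have h3 : (extChartAt (𝓡 n) x).source ∈
      𝓝 ((extChartAt (𝓡 n) x₀).symm (extChartAt (𝓡 n) x₀ z)) := by
    rw [(extChartAt (𝓡 n) x₀).left_inv hz₀]
    exact (isOpen_extChartAt_source x).mem_nhds hz
  filter_upwards [(isOpen_extChartAt_target x₀).mem_nhds h1, h2.preimage_mem_nhds h3] with y a b
  exact ⟨a, b⟩

lemma chartMetric_chartTransition (g : SmoothMetric n M) {x₀ x z : M}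
    (hz₀ : z ∈ (extChartAt (𝓡 n) x₀).source) (hz : z ∈ (extChartAt (𝓡 n) x).source)
    (a b : EuclideanSpace ℝ (Fin n)) :
    chartMetric g x₀ (extChartAt (𝓡 n) x₀ z) a b =
      chartMetric g x (extChartAt (𝓡 n) x z) (tangentCoordChange (𝓡 n) x₀ x z a)
        (tangentCoordChange (𝓡 n) x₀ x z b) := by
  rw [chartMetric_apply g ((extChartAt (𝓡 n) x₀).map_source hz₀),
    chartMetric_apply g ((extChartAt (𝓡 n) x).map_source hz),
    (extChartAt (𝓡 n) x₀).left_inv hz₀, (extChartAt (𝓡 n) x).left_inv hz,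
    tangentCoordChange_comp ⟨⟨hz₀, hz⟩, mem_extChartAt_source z⟩,
    tangentCoordChange_comp ⟨⟨hz₀, hz⟩, mem_extChartAt_source z⟩]

/-- The transformation law of the Christoffel symbols. -/
lemma covHessian_chartTransition (g : SmoothMetric n M) {x₀ x z : M}
    (hz₀ : z ∈ (extChartAt (𝓡 n) x₀).source) (hz : z ∈ (extChartAt (𝓡 n) x).source)
    (a b : EuclideanSpace ℝ (Fin n)) :
    covHessian (leviCivita (chartMetric g x)) (chartTransition x₀ x) (extChartAt (𝓡 n) x₀ z) a b =
      fderiv ℝ (chartTransition x₀ x) (extChartAt (𝓡 n) x₀ z)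
        (leviCivita (chartMetric g x₀) (extChartAt (𝓡 n) x₀ z) a b) := by
  refine (isChartMetric g x₀).covHessian_of_isometry (isChartMetric g x)
    (contDiffAt_chartTransition hz₀ hz) ((extChartAt (𝓡 n) x₀).map_source hz₀)
    (by rw [chartTransition_apply hz₀]; exact (extChartAt (𝓡 n) x).map_source hz) ?_ ?_ a b
  · intro v
    refine ⟨tangentCoordChange (𝓡 n) x x₀ z v, ?_⟩
    rw [fderiv_chartTransition, tangentCoordChange_inverse hz hz₀]
  · filter_upwards [eventually_chart_source hz₀ hz] with y ⟨hy₀, hy⟩ a b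
    have h1 := (extChartAt (𝓡 n) x₀).right_inv hy₀
    have h2 := (extChartAt (𝓡 n) x₀).map_target hy₀
    have h3 := chartMetric_chartTransition g h2 hy a b
    rw [h1, ← fderiv_chartTransition, h1, ← chartTransition_apply h2, h1] at h3
    exact h3

lemma chartCurvature_chartTransition (g : SmoothMetric n M) {x₀ x : M}
    (hx : x ∈ (extChartAt (𝓡 n) x₀).source) (a b w : EuclideanSpace ℝ (Fin n)) :
    chartCurvature (leviCivita (chartMetric g x)) (extChartAt (𝓡 n) x x)
      (tangentCoordChange (𝓡 n) x₀ x x a) (tangentCoordChange (𝓡 n) x₀ x x b)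
      (tangentCoordChange (𝓡 n) x₀ x x w) =
    tangentCoordChange (𝓡 n) x₀ x x
      (chartCurvature (leviCivita (chartMetric g x₀)) (extChartAt (𝓡 n) x₀ x) a b w) := by
  have hxx := mem_extChartAt_source (I := 𝓡 n) x
  have h := chartCurvature_map (Γ := leviCivita (chartMetric g x))
    (Γ' := leviCivita (chartMetric g x₀)) (contDiffAt_chartTransition hx hxx)
    (by
      rw [chartTransition_apply hx]
      exact (isChartMetric g x).differentiableAt_leviCivita (mem_extChartAt_target x))
    ((isChartMetric g x₀).differentiableAt_leviCivita ((extChartAt (𝓡 n) x₀).map_source hx))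
    (by
      filter_upwards [eventually_chart_source hx hxx] with y ⟨hy₀, hy⟩ a b
      have := covHessian_chartTransition g ((extChartAt (𝓡 n) x₀).map_target hy₀) hy a b
      rwa [(extChartAt (𝓡 n) x₀).right_inv hy₀] at this) a b w
  rwa [fderiv_chartTransition, chartTransition_apply hx] at h

lemma tangentChart_chartTransition {x₀ x : M} {q : TangentBundle (𝓡 n) M}
    (h₀ : q.proj ∈ (extChartAt (𝓡 n) x₀).source) (h : q.proj ∈ (extChartAt (𝓡 n) x).source) :
    tangentChart x q = (chartTransition x₀ x (tangentChart x₀ q).1,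
      fderiv ℝ (chartTransition x₀ x) (tangentChart x₀ q).1 (tangentChart x₀ q).2) := by
  simp only [tangentChart_apply]
  rw [chartTransition_apply h₀, fderiv_chartTransition]
  exact Prod.ext rfl (tangentCoordChange_comp ⟨⟨mem_extChartAt_source _, h₀⟩, h⟩).symm

lemma hasDerivAt_tangentChart {γ : ℝ → TangentBundle (𝓡 n) M} {t : ℝ}
    (hγ : MDifferentiableAt 𝓘(ℝ, ℝ) (𝓡 n).tangent γ t) :
    HasDerivAt (fun s => tangentChart (γ t).proj (γ s))
      (mfderiv 𝓘(ℝ, ℝ) (𝓡 n).tangent γ t (1 : ℝ) :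
        EuclideanSpace ℝ (Fin n) × EuclideanSpace ℝ (Fin n)) t := by
  have h := hγ.hasMFDerivAt.2
  rw [ModelWithCorners.range_eq_univ] at h
  let L : ℝ →L[ℝ] EuclideanSpace ℝ (Fin n) × EuclideanSpace ℝ (Fin n) :=
    mfderiv 𝓘(ℝ, ℝ) (𝓡 n).tangent γ t
  have h' : HasFDerivWithinAt (fun s => tangentChart (γ t).proj (γ s)) L univ t := h
  exact (hasFDerivWithinAt_univ.1 h').hasDerivAt

/-- The velocity of a curve in `TM`, in the induced chart around its base point, in terms of its
velocity in another induced chart. -/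
lemma mfderiv_curve_eq {γ : ℝ → TangentBundle (𝓡 n) M} {t : ℝ} {x₀ : M}
    (hγ : MDifferentiableAt 𝓘(ℝ, ℝ) (𝓡 n).tangent γ t)
    (hx : (γ t).proj ∈ (extChartAt (𝓡 n) x₀).source)
    {ζ : EuclideanSpace ℝ (Fin n) × EuclideanSpace ℝ (Fin n)}
    (hζ : HasDerivAt (fun s => tangentChart x₀ (γ s)) ζ t) :
    @Eq (EuclideanSpace ℝ (Fin n) × EuclideanSpace ℝ (Fin n))
      (mfderiv 𝓘(ℝ, ℝ) (𝓡 n).tangent γ t (1 : ℝ))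
      (fderiv ℝ (chartTransition x₀ (γ t).proj) (extChartAt (𝓡 n) x₀ (γ t).proj) ζ.1,
        fderiv ℝ (fderiv ℝ (chartTransition x₀ (γ t).proj)) (extChartAt (𝓡 n) x₀ (γ t).proj) ζ.1
          (tangentChart x₀ (γ t)).2 +
        fderiv ℝ (chartTransition x₀ (γ t).proj) (extChartAt (𝓡 n) x₀ (γ t).proj) ζ.2) := by
  set x := (γ t).proj with hxdef
  have hxx := mem_extChartAt_source (I := 𝓡 n) x
  have hT := contDiffAt_chartTransition hx hxx
  refine (hasDerivAt_tangentChart hγ).unique ?_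
  have hproj : ContinuousAt (fun s => (γ s).proj) t :=
    (FiberBundle.continuous_proj (EuclideanSpace ℝ (Fin n))
      (TangentSpace (𝓡 n) : M → Type _)).continuousAt.comp hγ.continuousAt
  have hev : (fun s => tangentChart x (γ s)) =ᶠ[𝓝 t] fun s =>
      (chartTransition x₀ x (tangentChart x₀ (γ s)).1,
        fderiv ℝ (chartTransition x₀ x) (tangentChart x₀ (γ s)).1 (tangentChart x₀ (γ s)).2) := by
    filter_upwards [hproj.preimage_mem_nhds ((isOpen_extChartAt_source x₀).mem_nhds hx),
      hproj.preimage_mem_nhds ((isOpen_extChartAt_source x).mem_nhds hxx)] with s h1 h2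
    exact tangentChart_chartTransition h1 h2
  refine HasDerivAt.congr_of_eventuallyEq ?_ hev
  have h1 : HasDerivAt (fun s => (tangentChart x₀ (γ s)).1) ζ.1 t := hζ.fst
  have h2 : HasDerivAt (fun s => (tangentChart x₀ (γ s)).2) ζ.2 t := hζ.snd
  have h3 := HasFDerivAt.comp_hasDerivAt (f := fun s => (tangentChart x₀ (γ s)).1) t
    hT.hasFDerivAt_self h1
  have h4 := HasFDerivAt.comp_hasDerivAt (f := fun s => (tangentChart x₀ (γ s)).1) t
    hT.hasFDerivAt_fderiv h1
  exact h3.prodMk (h4.clm_apply h2)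

lemma mfderiv_proj_eq (q : TangentBundle (𝓡 n) M)
    (ξ : EuclideanSpace ℝ (Fin n) × EuclideanSpace ℝ (Fin n)) :
    @Eq (EuclideanSpace ℝ (Fin n)) (mfderiv (𝓡 n).tangent (𝓡 n)
      (fun q : TangentBundle (𝓡 n) M => q.proj) q ξ) ξ.1 := by
  have h0 : MDifferentiableAt (𝓡 n).tangent (𝓡 n) (fun q : TangentBundle (𝓡 n) M => q.proj) q :=
    (contMDiff_proj (TangentSpace (𝓡 n) : M → Type _) (n := ∞)).mdifferentiableAt (by simp)
  have h1 := h0.hasMFDerivAt.2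
  rw [ModelWithCorners.range_eq_univ] at h1
  let L : EuclideanSpace ℝ (Fin n) × EuclideanSpace ℝ (Fin n) →L[ℝ] EuclideanSpace ℝ (Fin n) :=
    mfderiv (𝓡 n).tangent (𝓡 n) (fun q : TangentBundle (𝓡 n) M => q.proj) q
  have h1' : HasFDerivWithinAt (writtenInExtChartAt (𝓡 n).tangent (𝓡 n) q
    (fun q : TangentBundle (𝓡 n) M => q.proj)) L univ (tangentChart q.proj q) := h1
  have hq : (tangentChart q.proj q).1 ∈ (extChartAt (𝓡 n) q.proj).target :=
    mem_extChartAt_target q.proj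
  have hev : writtenInExtChartAt (𝓡 n).tangent (𝓡 n) q
      (fun q : TangentBundle (𝓡 n) M => q.proj) =ᶠ[𝓝 (tangentChart q.proj q)] Prod.fst := by
    filter_upwards [continuousAt_fst.preimage_mem_nhds
      ((isOpen_extChartAt_target q.proj).mem_nhds hq)] with p hp
    exact (extChartAt (𝓡 n) q.proj).right_inv hp
  have h2 := (hasFDerivWithinAt_univ.1 h1').unique (hasFDerivAt_fst.congr_of_eventuallyEq hev)
  exact congrArg (fun L : EuclideanSpace ℝ (Fin n) × EuclideanSpace ℝ (Fin n) →L[ℝ]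
    EuclideanSpace ℝ (Fin n) => L ξ) h2

/-- The covariant derivative of a curve in `TM`, computed in an arbitrary chart. -/
lemma connector_curve_eq (g : SmoothMetric n M) {γ : ℝ → TangentBundle (𝓡 n) M} {t : ℝ} {x₀ : M}
    (hγ : MDifferentiableAt 𝓘(ℝ, ℝ) (𝓡 n).tangent γ t)
    (hx : (γ t).proj ∈ (extChartAt (𝓡 n) x₀).source)
    {ζ : EuclideanSpace ℝ (Fin n) × EuclideanSpace ℝ (Fin n)}
    (hζ : HasDerivAt (fun s => tangentChart x₀ (γ s)) ζ t) :
    @Eq (EuclideanSpace ℝ (Fin n))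
      (connector g (γ t) (mfderiv 𝓘(ℝ, ℝ) (𝓡 n).tangent γ t (1 : ℝ)))
      (tangentCoordChange (𝓡 n) x₀ (γ t).proj (γ t).proj
        (ζ.2 + leviCivita (chartMetric g x₀) (tangentChart x₀ (γ t)).1 ζ.1
          (tangentChart x₀ (γ t)).2)) := by
  have h1 := mfderiv_curve_eq hγ hx hζ
  have hxx := mem_extChartAt_source (I := 𝓡 n) (γ t).proj
  refine (congrArg (connector g (γ t)) h1).trans ((connector_eq g _ _).trans ?_)
  have h2 := covHessian_chartTransition g hx hxx ζ.1 (tangentChart x₀ (γ t)).2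
  have h3 : fderiv ℝ (chartTransition x₀ (γ t).proj) (extChartAt (𝓡 n) x₀ (γ t).proj)
      (tangentChart x₀ (γ t)).2 = (γ t).snd := by
    rw [fderiv_chartTransition]
    exact tangentCoordChange_inverse (v := (γ t).snd) hxx hx
  rw [covHessian, h3, chartTransition_apply hx] at h2
  rw [map_add, ← fderiv_chartTransition, tangentChart_apply x₀ (γ t)]
  simp only
  rw [tangentChart_apply x₀ (γ t)] at h2
  simp only at h2
  rw [← h2]
  abel

end Transition

/-! ### Local slices of immersed submanifolds -/

section Slices

variable {n : ℕ} {M : Type u} [TopologicalSpace M]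
  [ChartedSpace (EuclideanSpace ℝ (Fin n)) M] [IsManifold (𝓡 n) ∞ M]
  {N : Type} [TopologicalSpace N]

lemma mfderiv_extChartAt_eq {x₀ x : M} (hx : x ∈ (extChartAt (𝓡 n) x₀).source) :
    @Eq (EuclideanSpace ℝ (Fin n) →L[ℝ] EuclideanSpace ℝ (Fin n))
      (mfderiv (𝓡 n) (𝓡 n) (extChartAt (𝓡 n) x₀) x) (tangentCoordChange (𝓡 n) x x₀ x) := by
  rw [extChartAt_source] at hx
  rw [← TangentBundle.continuousLinearMapAt_trivializationAt hx]
  exact TangentBundle.continuousLinearMapAt_trivializationAt_eq_core hx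

/-- An immersed submanifold `f : N → M` near `z : N`, read in the preferred chart of `M` around
`x₀`: it is parametrized by `h`, and its image is contained in the slice `{s = 0}`. The tangent
vectors of the submanifold near `z` are those of the form `(h u', h'_{u'} ξ)` with `u' ∈ U`
(`exists_tangentMap`, `tangentMap_eq`). The parametrization may cover more than the neighbourhood of
`z` in `tangentMap_eq`. -/
structure LocalSlice (n k : ℕ) [ChartedSpace (EuclideanSpace ℝ (Fin n)) M]
    [IsManifold (𝓡 n) ∞ M] [ChartedSpace (EuclideanSpace ℝ (Fin k)) N]
    (F : Type*) [NormedAddCommGroup F] [NormedSpace ℝ F]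
    (f : N → M) (x₀ : M) (z : N) where
  /-- The domain of the parametrization. -/
  U : Set (EuclideanSpace ℝ (Fin k))
  /-- The parameter of the point `z`. -/
  u : EuclideanSpace ℝ (Fin k)
  /-- The parametrization. -/
  h : EuclideanSpace ℝ (Fin k) → EuclideanSpace ℝ (Fin n)
  /-- The domain of the function defining the slice. -/
  O : Set (EuclideanSpace ℝ (Fin n))
  /-- The function defining the slice. -/
  s : EuclideanSpace ℝ (Fin n) → F
  isOpen_U : IsOpen U
  mem_U : u ∈ U
  contDiffAt_h : ∀ u' ∈ U, ContDiffAt ℝ ∞ h u'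
  injective : ∀ u' ∈ U, Function.Injective (fderiv ℝ h u')
  isOpen_O : IsOpen O
  contDiffAt_s : ∀ y ∈ O, ContDiffAt ℝ ∞ s y
  finrank_ker : ∀ y ∈ O, Module.finrank ℝ (LinearMap.ker
    (fderiv ℝ s y : EuclideanSpace ℝ (Fin n) →ₗ[ℝ] F)) ≤ k
  mem_O : ∀ u' ∈ U, h u' ∈ O
  O_subset : O ⊆ (extChartAt (𝓡 n) x₀).target
  s_h : ∀ u' ∈ U, s (h u') = 0
  exists_tangentMap : ∀ u' ∈ U, ∀ ξ, ∃ ζ : TangentBundle (𝓡 k) N,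
    tangentMap (𝓡 k) (𝓡 n) f ζ = (tangentChart x₀).symm (h u', fderiv ℝ h u' ξ)
  tangentMap_eq : ∀ᶠ z' in 𝓝 z, ∃ u' ∈ U, ∀ η : TangentSpace (𝓡 k) z', ∃ ξ,
    tangentChart x₀ (tangentMap (𝓡 k) (𝓡 n) f ⟨z', η⟩) = (h u', fderiv ℝ h u' ξ)
  h_u : h u = extChartAt (𝓡 n) x₀ (f z)
  exists_tangentMap_u : ∀ ξ, ∃ η : TangentSpace (𝓡 k) z,
    tangentMap (𝓡 k) (𝓡 n) f ⟨z, η⟩ = (tangentChart x₀).symm (h u, fderiv ℝ h u ξ)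
  tangentMap_u : ∀ η : TangentSpace (𝓡 k) z, ∃ ξ,
    tangentChart x₀ (tangentMap (𝓡 k) (𝓡 n) f ⟨z, η⟩) = (h u, fderiv ℝ h u ξ)

variable {k : ℕ} [ChartedSpace (EuclideanSpace ℝ (Fin k)) N]

namespace LocalSlice

variable {F : Type*} [NormedAddCommGroup F] [NormedSpace ℝ F] {f : N → M} {x₀ : M} {z : N}
  (S : LocalSlice n k F f x₀ z)
include S

lemma fderiv_s_h {u' : EuclideanSpace ℝ (Fin k)} (hu' : u' ∈ S.U) (ξ : EuclideanSpace ℝ (Fin k)) :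
    fderiv ℝ S.s (S.h u') (fderiv ℝ S.h u' ξ) = 0 := by
  have h1 := ((S.contDiffAt_s _ (S.mem_O u' hu')).hasFDerivAt_self.comp u'
    (S.contDiffAt_h u' hu').hasFDerivAt_self).fderiv
  have h2 : S.s ∘ S.h =ᶠ[𝓝 u'] fun _ => 0 := by
    filter_upwards [S.isOpen_U.mem_nhds hu'] with v hv using S.s_h v hv
  rw [h2.fderiv_eq] at h1
  simpa using (congrArg (fun L => L ξ) h1).symm

lemma exists_of_fderiv_s_eq_zero {u' : EuclideanSpace ℝ (Fin k)} (hu' : u' ∈ S.U)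
    {v : EuclideanSpace ℝ (Fin n)} (hv : fderiv ℝ S.s (S.h u') v = 0) :
    ∃ ξ, fderiv ℝ S.h u' ξ = v := by
  have hle : LinearMap.range (fderiv ℝ S.h u' : EuclideanSpace ℝ (Fin k) →ₗ[ℝ] _) ≤
      LinearMap.ker (fderiv ℝ S.s (S.h u') : EuclideanSpace ℝ (Fin n) →ₗ[ℝ] F) := by
    rintro _ ⟨ξ, rfl⟩
    exact S.fderiv_s_h hu' ξ
  have heq := Submodule.eq_of_le_of_finrank_le hle (by
    rw [LinearMap.finrank_range_of_inj (S.injective u' hu')]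
    simpa using S.finrank_ker _ (S.mem_O u' hu'))
  have : v ∈ LinearMap.ker (fderiv ℝ S.s (S.h u') : EuclideanSpace ℝ (Fin n) →ₗ[ℝ] F) := hv
  rw [← heq] at this
  exact this

end LocalSlice


/-- An immersion has local slices: in adapted charts it is an inclusion `u ↦ (u, 0)`, and `s` is the
second component. -/
lemma exists_localSlice {F : Type*} [NormedAddCommGroup F] [NormedSpace ℝ F] {f : N → M}
    (hf : IsImmersionOfComplement F (𝓡 k) (𝓡 n) ∞ f) {x₀ : M} {z : N}
    (hz : f z ∈ (extChartAt (𝓡 n) x₀).source) : Nonempty (LocalSlice n k F f x₀ z) := by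
  have hfz := hf z
  have hfs : ContMDiff (𝓡 k) (𝓡 n) ∞ f := hf.contMDiff
  set D := hfz.domChart with hD
  set χ := hfz.codChart with hχ
  set e := hfz.equiv with he
  have hDm := hfz.domChart_mem_maximalAtlas
  have hχm := hfz.codChart_mem_maximalAtlas
  have hzD := hfz.mem_domChart_source
  have hw : ∀ u ∈ D.target, χ (f (D.symm u)) = e (u, 0) := fun u hu => by
    have h1 := hfz.writtenInCharts
    have h2 : u ∈ (D.extend (𝓡 k)).target := by simpa [OpenPartialHomeomorph.extend] using hu
    simpa [OpenPartialHomeomorph.extend] using h1 h2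
  have hDχ : ∀ z' ∈ D.source, f z' ∈ χ.source := fun z' hz' =>
    hfz.source_subset_preimage_source hz'
  set ψ := extChartAt (𝓡 n) x₀ with hψ
  let U : Set (EuclideanSpace ℝ (Fin k)) := D.target ∩ D.symm ⁻¹' (f ⁻¹' ψ.source)
  let h : EuclideanSpace ℝ (Fin k) → EuclideanSpace ℝ (Fin n) := fun u => ψ (f (D.symm u))
  let O : Set (EuclideanSpace ℝ (Fin n)) := ψ.target ∩ ψ.symm ⁻¹' χ.source
  let θ : EuclideanSpace ℝ (Fin n) → EuclideanSpace ℝ (Fin k) × F := fun y => e.symm (χ (ψ.symm y))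
  let τ : EuclideanSpace ℝ (Fin k) × F → EuclideanSpace ℝ (Fin n) := fun p => ψ (χ.symm (e p))
  -- The diffeomorphism `θ` of `O` straightens the submanifold: `θ (h u) = (u, 0)`.
  have hUo : IsOpen U := D.continuousOn_symm.isOpen_inter_preimage D.open_target
    ((isOpen_extChartAt_source x₀).preimage hfs.continuous)
  have hOo : IsOpen O := (continuousOn_extChartAt_symm x₀).isOpen_inter_preimage
    (isOpen_extChartAt_target x₀) χ.open_source
  have hψs : ContMDiffOn (𝓡 n) (𝓡 n) ∞ ψ ψ.source := by
    have := contMDiffOn_extChartAt (I := 𝓡 n) (n := ∞) (x := x₀)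
    rwa [← extChartAt_source (𝓡 n)] at this
  have hhs : ∀ u ∈ U, ContDiffAt ℝ ∞ h u := by
    have h1 : ContMDiffOn (𝓡 k) (𝓡 n) ∞ h U :=
      hψs.comp (hfs.comp_contMDiffOn ((contMDiffOn_symm_of_mem_maximalAtlas hDm).mono
        inter_subset_left)) fun u hu => hu.2
    exact fun u hu => (contMDiffOn_iff_contDiffOn.1 h1).contDiffAt (hUo.mem_nhds hu)
  have hθs : ∀ y ∈ O, ContDiffAt ℝ ∞ θ y := by
    have h1 : ContMDiffOn (𝓡 n) (𝓡 n) ∞ (fun y => χ (ψ.symm y)) O :=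
      (contMDiffOn_of_mem_maximalAtlas hχm).comp
        ((contMDiffOn_extChartAt_symm x₀).mono inter_subset_left) fun u hu => hu.2
    exact fun y hy => e.symm.contDiff.contDiffAt.comp y
      ((contMDiffOn_iff_contDiffOn.1 h1).contDiffAt (hOo.mem_nhds hy))
  have hUO : ∀ u ∈ U, h u ∈ O := fun u hu => by
    refine ⟨ψ.map_source hu.2, ?_⟩
    change ψ.symm (ψ (f (D.symm u))) ∈ χ.source
    rw [ψ.left_inv hu.2]
    exact hDχ _ (D.map_target hu.1)
  have hθh : ∀ u ∈ U, θ (h u) = (u, 0) := fun u hu => by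
    change e.symm (χ (ψ.symm (ψ (f (D.symm u))))) = _
    rw [ψ.left_inv hu.2, hw u hu.1, e.symm_apply_apply]
  have hτθ : ∀ y ∈ O, τ (θ y) = y := fun y hy => by
    change ψ (χ.symm (e (e.symm (χ (ψ.symm y))))) = y
    rw [e.apply_symm_apply, χ.left_inv hy.2, ψ.right_inv hy.1]
  have hτs : ∀ y ∈ O, DifferentiableAt ℝ τ (θ y) := fun y hy => by
    have hχ' : χ (ψ.symm y) ∈ χ.target ∩ χ.symm ⁻¹' ψ.source :=
      ⟨χ.map_source hy.2, by
        rw [mem_preimage, χ.left_inv hy.2]; exact ψ.map_target hy.1⟩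
    have ho : IsOpen (χ.target ∩ χ.symm ⁻¹' ψ.source) :=
      χ.continuousOn_symm.isOpen_inter_preimage χ.open_target (isOpen_extChartAt_source x₀)
    have h1 : ContMDiffOn (𝓡 n) (𝓡 n) ∞ (fun y => ψ (χ.symm y)) (χ.target ∩ χ.symm ⁻¹' ψ.source) :=
      hψs.comp ((contMDiffOn_symm_of_mem_maximalAtlas hχm).mono inter_subset_left) fun u hu => hu.2
    have h2 := ((contMDiffOn_iff_contDiffOn.1 h1).contDiffAt (ho.mem_nhds hχ')).differentiableAt
      (by simp)
    have h3 : e (θ y) = χ (ψ.symm y) := e.apply_symm_apply _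
    rw [← h3] at h2
    exact h2.comp (θ y) e.differentiableAt
  have hzU : D z ∈ U := ⟨D.map_source hzD, by
    rw [mem_preimage, D.left_inv hzD]; exact hz⟩
  -- The differential of `f` in the charts.
  have key : ∀ z' ∈ D.source, f z' ∈ ψ.source → ∀ η : TangentSpace (𝓡 k) z',
      tangentChart x₀ (tangentMap (𝓡 k) (𝓡 n) f ⟨z', η⟩) =
        (h (D z'), fderiv ℝ h (D z') (mfderiv (𝓡 k) (𝓡 k) D z' η)) := by
    intro z' hz' hfz' η
    have hu' : D z' ∈ U := ⟨D.map_source hz', by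
      rw [mem_preimage, D.left_inv hz']; exact hfz'⟩
    have h0 : h (D z') = ψ (f z') := by
      change ψ (f (D.symm (D z'))) = _
      rw [D.left_inv hz']
    rw [h0]
    refine Prod.ext rfl ?_
    have H1 : HasMFDerivAt (𝓡 k) (𝓡 n) (ψ ∘ f) z' ((mfderiv (𝓡 n) (𝓡 n) ψ (f z')).comp
        (mfderiv (𝓡 k) (𝓡 n) f z')) :=
      HasMFDerivAt.comp z' (mdifferentiableAt_extChartAt
        (by rwa [extChartAt_source] at hfz')).hasMFDerivAt
        (hfs.mdifferentiableAt (by simp)).hasMFDerivAt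
    have H2 : HasMFDerivAt (𝓡 k) (𝓡 n) (h ∘ D) z' ((fderiv ℝ h (D z')).comp
        (mfderiv (𝓡 k) (𝓡 k) D z')) :=
      HasMFDerivAt.comp z' (hhs _ hu').hasFDerivAt_self.hasMFDerivAt
        ((contMDiffAt_of_mem_maximalAtlas hDm hz').mdifferentiableAt (by simp)).hasMFDerivAt
    have hev : ψ ∘ f =ᶠ[𝓝 z'] h ∘ D := by
      filter_upwards [D.open_source.mem_nhds hz'] with w hw'
      change ψ (f w) = ψ (f (D.symm (D w)))
      rw [D.left_inv hw']
    have H3 := hasMFDerivAt_unique H1 (H2.congr_of_eventuallyEq hev)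
    have H4 := congrArg (fun L : EuclideanSpace ℝ (Fin k) →L[ℝ] EuclideanSpace ℝ (Fin n) => L η) H3
    refine Eq.trans ?_ H4
    exact congrArg (fun L : EuclideanSpace ℝ (Fin n) →L[ℝ] EuclideanSpace ℝ (Fin n) =>
      L (mfderiv (𝓡 k) (𝓡 n) f z' η)) (mfderiv_extChartAt_eq hfz').symm
  have hDd : D.MDifferentiable (𝓡 k) (𝓡 k) :=
    ⟨(contMDiffOn_of_mem_maximalAtlas hDm).mdifferentiableOn (by simp),
      (contMDiffOn_symm_of_mem_maximalAtlas hDm).mdifferentiableOn (by simp)⟩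
  have key' : ∀ z' ∈ D.source, f z' ∈ ψ.source → ∀ ξ, ∃ η : TangentSpace (𝓡 k) z',
      tangentMap (𝓡 k) (𝓡 n) f ⟨z', η⟩ =
        (tangentChart x₀).symm (h (D z'), fderiv ℝ h (D z') ξ) := by
    intro z' hz' hfz' ξ
    obtain ⟨η, hη⟩ := hDd.mfderiv_surjective hz' ξ
    refine ⟨η, ?_⟩
    have h1 := key z' hz' hfz' η
    have h2 : tangentMap (𝓡 k) (𝓡 n) f ⟨z', η⟩ ∈ (tangentChart x₀).source :=
      mem_tangentChart_source.2 hfz'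
    rw [← (tangentChart x₀).left_inv h2, h1]
    exact congrArg (fun w => (tangentChart x₀).symm (h (D z'), fderiv ℝ h (D z') w)) hη
  refine ⟨{
    U := U
    u := D z
    h := h
    O := O
    s := fun y => (θ y).2
    isOpen_U := hUo
    mem_U := hzU
    contDiffAt_h := hhs
    injective := ?_
    isOpen_O := hOo
    contDiffAt_s := fun y hy => contDiffAt_snd.comp y (hθs y hy)
    finrank_ker := ?_
    mem_O := hUO
    O_subset := inter_subset_left
    s_h := fun u hu => by rw [hθh u hu]
    exists_tangentMap := ?_
    tangentMap_eq := ?_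
    h_u := ?_
    exists_tangentMap_u := key' z hzD hz
    tangentMap_u := fun η => ⟨_, key z hzD hz η⟩ }⟩
  · intro u hu
    have h1 := (hθs _ (hUO u hu)).hasFDerivAt_self.comp u (hhs u hu).hasFDerivAt_self
    have h2 : HasFDerivAt (fun u : EuclideanSpace ℝ (Fin k) => (u, (0 : F)))
      ((ContinuousLinearMap.id ℝ _).prod 0) u := (hasFDerivAt_id u).prodMk (hasFDerivAt_const _ _)
    have h3 : θ ∘ h =ᶠ[𝓝 u] fun u => (u, 0) := by
      filter_upwards [hUo.mem_nhds hu] with v hv using hθh v hv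
    have h4 := h1.unique (h2.congr_of_eventuallyEq h3)
    intro a b hab
    have h5 := congrArg (fun L => (L a).1) h4
    have h6 := congrArg (fun L => (L b).1) h4
    simp at h5 h6
    rw [← h5, ← h6, hab]
  · intro y hy
    have hθd := (hθs y hy).hasFDerivAt_self
    have h1 := (hτs y hy).hasFDerivAt.comp y hθd
    have h2 : τ ∘ θ =ᶠ[𝓝 y] id := by
      filter_upwards [hOo.mem_nhds hy] with v hv using hτθ v hv
    have h3 := h1.unique ((hasFDerivAt_id y).congr_of_eventuallyEq h2)
    have hinj : Function.Injective (fderiv ℝ θ y) := fun a b hab => by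
      have h5 := congrArg (fun L => L a) h3
      have h6 := congrArg (fun L => L b) h3
      simp at h5 h6
      rw [← h5, ← h6, hab]
    have h4 : HasFDerivAt (fun y => (θ y).2) _ y := hθd.snd
    rw [h4.fderiv]
    let g : LinearMap.ker (((ContinuousLinearMap.snd ℝ (EuclideanSpace ℝ (Fin k)) F).comp
        (fderiv ℝ θ y) : EuclideanSpace ℝ (Fin n) →L[ℝ] F) : EuclideanSpace ℝ (Fin n) →ₗ[ℝ] F)
        →ₗ[ℝ] EuclideanSpace ℝ (Fin k) :=
      (LinearMap.fst ℝ _ F).comp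
        ((fderiv ℝ θ y : EuclideanSpace ℝ (Fin n) →ₗ[ℝ] _).comp (Submodule.subtype _))
    have hg : Function.Injective g := fun a b hab => by
      refine Subtype.ext (hinj (Prod.ext hab ?_))
      have ha : (fderiv ℝ θ y a).2 = 0 := a.2
      have hb : (fderiv ℝ θ y b).2 = 0 := b.2
      rw [ha, hb]
    simpa using LinearMap.finrank_le_finrank_of_injective hg
  · intro u hu ξ
    obtain ⟨η, hη⟩ := key' (D.symm u) (D.map_target hu.1) hu.2 ξ
    rw [D.right_inv hu.1] at hη
    exact ⟨_, hη⟩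
  · filter_upwards [D.open_source.mem_nhds hzD, hfs.continuous.continuousAt.preimage_mem_nhds
      ((isOpen_extChartAt_source x₀).mem_nhds hz)] with z' h1 h2
    exact ⟨D z', ⟨D.map_source h1, by rw [mem_preimage, D.left_inv h1]; exact h2⟩,
      fun η => ⟨_, key z' h1 h2 η⟩⟩
  · change ψ (f (D.symm (D z))) = _
    rw [D.left_inv hzD]

end Slices

/-! ### The generator of the flow in charts -/

section FlowInCharts

variable {n : ℕ} {M : Type u} [TopologicalSpace M]
  [ChartedSpace (EuclideanSpace ℝ (Fin n)) M] [IsManifold (𝓡 n) ∞ M]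

lemma chartMetric_tangentChart (g : SmoothMetric n M) {x₀ : M} {q : TangentBundle (𝓡 n) M}
    (hq : q.proj ∈ (extChartAt (𝓡 n) x₀).source) :
    chartMetric g x₀ (tangentChart x₀ q).1 (tangentChart x₀ q).2 (tangentChart x₀ q).2 =
      metricAt g q.proj q.snd q.snd := by
  have hxx := mem_extChartAt_source (I := 𝓡 n) q.proj
  rw [tangentChart_apply, chartMetric_apply g ((extChartAt (𝓡 n) x₀).map_source hq),
    (extChartAt (𝓡 n) x₀).left_inv hq]
  exact congrArg₂ (fun a b => metricAt g q.proj a b)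
    (tangentCoordChange_inverse (v := q.snd) hxx hq) (tangentCoordChange_inverse (v := q.snd) hxx hq)

lemma mem_unitTangentSet_iff (g : SmoothMetric n M) {x₀ : M} {q : TangentBundle (𝓡 n) M}
    (hq : q.proj ∈ (extChartAt (𝓡 n) x₀).source) :
    q ∈ unitTangentSet g ↔
      chartMetric g x₀ (tangentChart x₀ q).1 (tangentChart x₀ q).2 (tangentChart x₀ q).2 = 1 := by
  rw [chartMetric_tangentChart g hq]; rfl

lemma proj_tangentChart_symm {x₀ : M} {y v : EuclideanSpace ℝ (Fin n)}
    (hy : y ∈ (extChartAt (𝓡 n) x₀).target) :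
    ((tangentChart x₀).symm (y, v)).proj = (extChartAt (𝓡 n) x₀).symm y := by
  rw [tangentChart_symm_apply (p := (y, v)) hy]; rfl

lemma tangentChart_right_inv {x₀ : M} {y : EuclideanSpace ℝ (Fin n)}
    (hy : y ∈ (extChartAt (𝓡 n) x₀).target) (v : EuclideanSpace ℝ (Fin n)) :
    tangentChart x₀ ((tangentChart x₀).symm (y, v)) = (y, v) :=
  (tangentChart x₀).right_inv (mem_tangentChart_target.2 hy)

lemma symm_mem_unitTangentSet_iff (g : SmoothMetric n M) {x₀ : M} {y v : EuclideanSpace ℝ (Fin n)}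
    (hy : y ∈ (extChartAt (𝓡 n) x₀).target) :
    (tangentChart x₀).symm (y, v) ∈ unitTangentSet g ↔ chartMetric g x₀ y v v = 1 := by
  have h : ((tangentChart x₀).symm (y, v)).proj ∈ (extChartAt (𝓡 n) x₀).source := by
    rw [proj_tangentChart_symm hy]; exact (extChartAt (𝓡 n) x₀).map_target hy
  rw [mem_unitTangentSet_iff g h, tangentChart_right_inv hy]

/-- The unit tangent vector with coordinates `(y, v)` in the preferred chart around `x₀`. -/
def unitVector (g : SmoothMetric n M) {x₀ : M} {y v : EuclideanSpace ℝ (Fin n)}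
    (hy : y ∈ (extChartAt (𝓡 n) x₀).target) (hv : chartMetric g x₀ y v v = 1) :
    UnitTangentBundle g :=
  ⟨(tangentChart x₀).symm (y, v), (symm_mem_unitTangentSet_iff g hy).2 hv⟩

lemma unitVector_proj_mem (g : SmoothMetric n M) {x₀ : M} {y v : EuclideanSpace ℝ (Fin n)}
    (hy : y ∈ (extChartAt (𝓡 n) x₀).target) (hv : chartMetric g x₀ y v v = 1) :
    (unitVector g hy hv).1.proj ∈ (extChartAt (𝓡 n) x₀).source := by
  change ((tangentChart x₀).symm (y, v)).proj ∈ _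
  rw [proj_tangentChart_symm hy]; exact (extChartAt (𝓡 n) x₀).map_target hy

lemma tangentChart_unitVector (g : SmoothMetric n M) {x₀ : M} {y v : EuclideanSpace ℝ (Fin n)}
    (hy : y ∈ (extChartAt (𝓡 n) x₀).target) (hv : chartMetric g x₀ y v v = 1) :
    tangentChart x₀ (unitVector g hy hv).1 = (y, v) := tangentChart_right_inv hy v

lemma tangentChart_flip {g : SmoothMetric n M} (x₀ : M) (p : UnitTangentBundle g) :
    tangentChart x₀ p.flip.1 = ((tangentChart x₀ p.1).1, -(tangentChart x₀ p.1).2) := by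
  refine Prod.ext rfl ?_
  exact map_neg (tangentCoordChange (𝓡 n) p.1.proj x₀ p.1.proj) p.1.snd

variable {g : SmoothMetric n M} {φ : Flow ℝ (UnitTangentBundle g)}

lemma IsSmoothFlow.contMDiff_orbit (hφ : IsSmoothFlow φ) (p : UnitTangentBundle g) :
    ContMDiff 𝓘(ℝ, ℝ) (𝓡 n).tangent ∞ fun t : ℝ => (φ t p).1 := by
  obtain ⟨Φ, hΦ, hΦφ⟩ := hφ
  have h1 : ContMDiff 𝓘(ℝ, ℝ) (𝓘(ℝ, ℝ).prod (𝓡 n).tangent) ∞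
      fun t : ℝ => (t, p.1) := contMDiff_id.prodMk contMDiff_const
  have h2 := hΦ.comp_contMDiff h1 fun t => ⟨mem_univ t, p.2⟩
  exact h2.congr fun t => (hΦφ t p).symm

lemma IsSmoothFlow.mdifferentiableAt_orbit (hφ : IsSmoothFlow φ) (p : UnitTangentBundle g) (t : ℝ) :
    MDifferentiableAt 𝓘(ℝ, ℝ) (𝓡 n).tangent (fun t : ℝ => (φ t p).1) t :=
  (hφ.contMDiff_orbit p).mdifferentiableAt (by simp)

/-- The generator of the flow in the chart of `TM` induced by the preferred chart around `x₀`. -/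
def chartGenerator (φ : Flow ℝ (UnitTangentBundle g)) (x₀ : M) (p : UnitTangentBundle g) :
    EuclideanSpace ℝ (Fin n) × EuclideanSpace ℝ (Fin n) :=
  deriv (fun t => tangentChart x₀ (φ t p).1) 0

lemma IsSmoothFlow.contDiffAt_tangentChart (hφ : IsSmoothFlow φ) {x₀ : M}
    {p : UnitTangentBundle g} {t : ℝ} (hp : (φ t p).1.proj ∈ (extChartAt (𝓡 n) x₀).source) :
    ContDiffAt ℝ ∞ (fun t => tangentChart x₀ (φ t p).1) t := by
  have h0 : IsOpen (tangentChart (n := n) x₀).source := isOpen_extChartAt_source _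
  have h1 : ContMDiffAt (𝓡 n).tangent 𝓘(ℝ, EuclideanSpace ℝ (Fin n) × EuclideanSpace ℝ (Fin n)) ∞
      (tangentChart x₀) (φ t p).1 :=
    (contMDiffOn_tangentChart x₀).contMDiffAt (h0.mem_nhds (mem_tangentChart_source.2 hp))
  exact contMDiffAt_iff_contDiffAt.1
    (h1.comp t ((hφ.contMDiff_orbit p).contMDiffAt))

lemma IsSmoothFlow.hasDerivAt_tangentChart (hφ : IsSmoothFlow φ) {x₀ : M}
    {p : UnitTangentBundle g} (hp : p.1.proj ∈ (extChartAt (𝓡 n) x₀).source) :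
    HasDerivAt (fun t => tangentChart x₀ (φ t p).1) (chartGenerator φ x₀ p) 0 :=
  ((hφ.contDiffAt_tangentChart (t := 0) (by rwa [φ.map_zero_apply])).differentiableAt
    (by simp)).hasDerivAt

/-- The generator along an orbit is the velocity of the orbit. -/
lemma IsSmoothFlow.generator_eq (hφ : IsSmoothFlow φ) (p : UnitTangentBundle g) (t : ℝ) :
    @Eq (EuclideanSpace ℝ (Fin n) × EuclideanSpace ℝ (Fin n)) (generator φ (φ t p))
      (mfderiv 𝓘(ℝ, ℝ) (𝓡 n).tangent (fun t : ℝ => (φ t p).1) t (1 : ℝ)) := by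
  obtain ⟨ζ, hζ⟩ : ∃ ζ : EuclideanSpace ℝ (Fin n) × EuclideanSpace ℝ (Fin n),
    ζ = mfderiv 𝓘(ℝ, ℝ) (𝓡 n).tangent (fun t : ℝ => (φ t p).1) t (1 : ℝ) := ⟨_, rfl⟩
  have h1 := _root_.hasDerivAt_tangentChart (hφ.mdifferentiableAt_orbit p t)
  refine Eq.trans ?_ hζ
  replace h1 : HasDerivAt (fun s => tangentChart (φ t p).1.proj (φ s p).1) ζ t := hζ ▸ h1
  have h2 := _root_.hasDerivAt_tangentChart (hφ.mdifferentiableAt_orbit (φ t p) 0)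
  rw [φ.map_zero_apply] at h2
  have h3 : HasDerivAt (fun s : ℝ => s + t) 1 0 := (hasDerivAt_id (0 : ℝ)).add_const t
  have h4 := HasDerivAt.scomp (0 : ℝ) (by simpa using h1) h3
  rw [one_smul] at h4
  refine h2.unique (h4.congr_of_eventuallyEq (Filter.Eventually.of_forall fun s => ?_))
  change _ = tangentChart _ (φ (s + t) p).1
  rw [φ.map_add]

lemma IsSmoothFlow.generator_eq_chart (hφ : IsSmoothFlow φ) {x₀ : M}
    {p : UnitTangentBundle g} (hp : p.1.proj ∈ (extChartAt (𝓡 n) x₀).source) :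
    @Eq (EuclideanSpace ℝ (Fin n) × EuclideanSpace ℝ (Fin n)) (generator φ p)
      (fderiv ℝ (chartTransition x₀ p.1.proj) (extChartAt (𝓡 n) x₀ p.1.proj)
        (chartGenerator φ x₀ p).1,
        fderiv ℝ (fderiv ℝ (chartTransition x₀ p.1.proj)) (extChartAt (𝓡 n) x₀ p.1.proj)
          (chartGenerator φ x₀ p).1 (tangentChart x₀ p.1).2 +
        fderiv ℝ (chartTransition x₀ p.1.proj) (extChartAt (𝓡 n) x₀ p.1.proj)
          (chartGenerator φ x₀ p).2) := by
  have h := mfderiv_curve_eq (hφ.mdifferentiableAt_orbit p 0) (x₀ := x₀)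
    (by rwa [φ.map_zero_apply]) (hφ.hasDerivAt_tangentChart hp)
  rw [φ.map_zero_apply] at h
  exact h

lemma IsSmoothFlow.horizontalPart_eq (hφ : IsSmoothFlow φ) {x₀ : M}
    {p : UnitTangentBundle g} (hp : p.1.proj ∈ (extChartAt (𝓡 n) x₀).source) :
    @Eq (EuclideanSpace ℝ (Fin n)) (horizontalPart φ p)
      (tangentCoordChange (𝓡 n) x₀ p.1.proj p.1.proj (chartGenerator φ x₀ p).1) := by
  refine (mfderiv_proj_eq _ _).trans ?_
  rw [← fderiv_chartTransition]
  exact congrArg (fun z : EuclideanSpace ℝ (Fin n) × EuclideanSpace ℝ (Fin n) => z.1)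
    (hφ.generator_eq_chart hp)

/-- The vertical component of the generator in the preferred chart around `x₀`. -/
def chartVertical (φ : Flow ℝ (UnitTangentBundle g)) (x₀ : M) (p : UnitTangentBundle g) :
    EuclideanSpace ℝ (Fin n) :=
  (chartGenerator φ x₀ p).2 + leviCivita (chartMetric g x₀) (tangentChart x₀ p.1).1
    (chartGenerator φ x₀ p).1 (tangentChart x₀ p.1).2

lemma IsSmoothFlow.verticalPart_eq (hφ : IsSmoothFlow φ) {x₀ : M}
    {p : UnitTangentBundle g} (hp : p.1.proj ∈ (extChartAt (𝓡 n) x₀).source) :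
    @Eq (EuclideanSpace ℝ (Fin n)) (verticalPart φ p)
      (tangentCoordChange (𝓡 n) x₀ p.1.proj p.1.proj (chartVertical φ x₀ p)) := by
  have h := connector_curve_eq g (hφ.mdifferentiableAt_orbit p 0) (x₀ := x₀)
    (by rwa [φ.map_zero_apply]) (hφ.hasDerivAt_tangentChart hp)
  have h1 : @Eq (EuclideanSpace ℝ (Fin n)) (connector g (φ 0 p).1
      (mfderiv 𝓘(ℝ, ℝ) (𝓡 n).tangent (fun t : ℝ => (φ t p).1) 0 (1 : ℝ))) (verticalPart φ p) := by
    have : ∀ (q : UnitTangentBundle g), q = p → @Eq (EuclideanSpace ℝ (Fin n)) (connector g q.1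
      (mfderiv 𝓘(ℝ, ℝ) (𝓡 n).tangent (fun t : ℝ => (φ t p).1) 0 (1 : ℝ) :
        EuclideanSpace ℝ (Fin n) × EuclideanSpace ℝ (Fin n))) (verticalPart φ p) := by
      rintro q rfl; rfl
    exact this _ (φ.map_zero_apply p)
  rw [h1, φ.map_zero_apply] at h
  exact h

lemma IsSmoothFlow.chartGenerator_flip (hφ : IsSmoothFlow φ) (hodd : IsOddFlow φ) {x₀ : M}
    {p : UnitTangentBundle g} (hp : p.1.proj ∈ (extChartAt (𝓡 n) x₀).source) :
    (chartGenerator φ x₀ p.flip).1 = -(chartGenerator φ x₀ p).1 ∧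
      chartVertical φ x₀ p.flip = -chartVertical φ x₀ p := by
  have hxx := mem_extChartAt_source (I := 𝓡 n) p.1.proj
  have hinj : Function.Injective (tangentCoordChange (𝓡 n) x₀ p.1.proj p.1.proj) :=
    Function.LeftInverse.injective fun v => tangentCoordChange_inverse hp hxx v
  obtain ⟨h1, h2⟩ := hodd p
  have hp' : p.flip.1.proj ∈ (extChartAt (𝓡 n) x₀).source := hp
  constructor
  · apply hinj
    refine (hφ.horizontalPart_eq hp').symm.trans (h1.trans ?_)
    rw [map_neg]
    exact congrArg (fun v : EuclideanSpace ℝ (Fin n) => -v) (hφ.horizontalPart_eq hp)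
  · apply hinj
    refine (hφ.verticalPart_eq hp').symm.trans (h2.trans ?_)
    rw [map_neg]
    exact congrArg (fun v : EuclideanSpace ℝ (Fin n) => -v) (hφ.verticalPart_eq hp)

/-- The vertical component of the generator of a flow on unit vectors is orthogonal to the vector
itself. -/
lemma IsSmoothFlow.chartVertical_orthogonal (hφ : IsSmoothFlow φ) {x₀ : M}
    {p : UnitTangentBundle g} (hp : p.1.proj ∈ (extChartAt (𝓡 n) x₀).source) :
    chartMetric g x₀ (tangentChart x₀ p.1).1 (chartVertical φ x₀ p) (tangentChart x₀ p.1).2 = 0 := by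
  have hd := hφ.hasDerivAt_tangentChart hp
  have hy := (extChartAt (𝓡 n) x₀).map_source hp
  have hy' : (tangentChart x₀ p.1).1 ∈ (extChartAt (𝓡 n) x₀).target := hy
  have hG := (isChartMetric g x₀).differentiableAt hy'
  have h0 : tangentChart x₀ (φ 0 p).1 = tangentChart x₀ p.1 := by rw [φ.map_zero_apply]
  have h1 : HasDerivAt (fun t => (tangentChart x₀ (φ t p).1).1) (chartGenerator φ x₀ p).1 0 :=
    hd.fst
  have h2 : HasDerivAt (fun t => (tangentChart x₀ (φ t p).1).2) (chartGenerator φ x₀ p).2 0 :=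
    hd.snd
  have h3 := HasFDerivAt.comp_hasDerivAt (f := fun t => (tangentChart x₀ (φ t p).1).1) (0 : ℝ)
    (by rw [h0]; exact hG.hasFDerivAt) h1
  have h4 := (h3.clm_apply h2).clm_apply h2
  have hev : (fun t => chartMetric g x₀ (tangentChart x₀ (φ t p).1).1 (tangentChart x₀ (φ t p).1).2
      (tangentChart x₀ (φ t p).1).2) =ᶠ[𝓝 0] fun _ => (1 : ℝ) := by
    have hc : ContinuousAt (fun t => (φ t p).1.proj) 0 :=
      ((FiberBundle.continuous_proj (EuclideanSpace ℝ (Fin n))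
        (TangentSpace (𝓡 n) : M → Type _)).comp (hφ.contMDiff_orbit p).continuous).continuousAt
    filter_upwards [hc.preimage_mem_nhds ((isOpen_extChartAt_source x₀).mem_nhds
      (by rwa [φ.map_zero_apply]))] with t ht
    exact (mem_unitTangentSet_iff g ht).1 (φ t p).2
  have h5 := h4.unique ((hasDerivAt_const (0 : ℝ) (1 : ℝ)).congr_of_eventuallyEq hev)
  simp only [Function.comp_apply, h0, add_apply] at h5
  rw [(isChartMetric g x₀).fderiv_apply hy'] at h5
  have hs := (isChartMetric g x₀).symm _ hy'
  simp only [chartVertical, map_add, add_apply]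
  rw [hs (tangentChart x₀ p.1).2 _, hs (tangentChart x₀ p.1).2 (chartGenerator φ x₀ p).2] at h5
  linarith

end FlowInCharts

/-! ### Tangency of the generator to totally invariant submanifolds -/

section FlowTangency

variable {n : ℕ} {M : Type u} [TopologicalSpace M]
  [ChartedSpace (EuclideanSpace ℝ (Fin n)) M] [IsManifold (𝓡 n) ∞ M]

/-- The vector of `TM` with coordinates `(y, v)` in the chart around `x₀`, scaled to unit length. -/
def unitize (g : SmoothMetric n M) (x₀ : M)
    (q : EuclideanSpace ℝ (Fin n) × EuclideanSpace ℝ (Fin n)) : TangentBundle (𝓡 n) M :=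
  (tangentChart x₀).symm (q.1, (√(chartMetric g x₀ q.1 q.2 q.2))⁻¹ • q.2)

/-- A flow on unit vectors, extended to all nonzero vectors by homogeneity of degree one and
read in the chart of `TM` around `x₀`. -/
def flowChart (g : SmoothMetric n M) (Φ : ℝ × TangentBundle (𝓡 n) M → TangentBundle (𝓡 n) M)
    (x₀ : M) (q : ℝ × EuclideanSpace ℝ (Fin n) × EuclideanSpace ℝ (Fin n)) :
    EuclideanSpace ℝ (Fin n) × EuclideanSpace ℝ (Fin n) :=
  ((tangentChart x₀ (Φ (q.1, unitize g x₀ q.2))).1,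
    √(chartMetric g x₀ q.2.1 q.2.2 q.2.2) • (tangentChart x₀ (Φ (q.1, unitize g x₀ q.2))).2)

lemma chartMetric_unitize (g : SmoothMetric n M) {x₀ : M} {y v : EuclideanSpace ℝ (Fin n)}
    (hy : y ∈ (extChartAt (𝓡 n) x₀).target) (hv : v ≠ 0) :
    chartMetric g x₀ y ((√(chartMetric g x₀ y v v))⁻¹ • v) ((√(chartMetric g x₀ y v v))⁻¹ • v) = 1 := by
  have h := (isChartMetric g x₀).pos y hy v hv
  have h1 := Real.sqrt_pos.2 h
  have h2 := Real.mul_self_sqrt h.le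
  simp only [map_smul, smul_apply, smul_eq_mul]
  field_simp
  nlinarith

lemma unitize_mem (g : SmoothMetric n M) {x₀ : M} {y v : EuclideanSpace ℝ (Fin n)}
    (hy : y ∈ (extChartAt (𝓡 n) x₀).target) (hv : v ≠ 0) : unitize g x₀ (y, v) ∈ unitTangentSet g :=
  (symm_mem_unitTangentSet_iff g hy).2 (chartMetric_unitize g hy hv)

lemma unitize_of_unit (g : SmoothMetric n M) {x₀ : M} {y v : EuclideanSpace ℝ (Fin n)}
    (hv : chartMetric g x₀ y v v = 1) : unitize g x₀ (y, v) = (tangentChart x₀).symm (y, v) := by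
  simp [unitize, hv]

omit [IsManifold (𝓡 n) ∞ M] in
lemma isOpen_target_prod_ne_zero (x₀ : M) :
    IsOpen {q : EuclideanSpace ℝ (Fin n) × EuclideanSpace ℝ (Fin n) |
      q.1 ∈ (extChartAt (𝓡 n) x₀).target ∧ q.2 ≠ 0} :=
  ((isOpen_extChartAt_target x₀).preimage continuous_fst).inter
    (isOpen_ne.preimage continuous_snd)

lemma contDiffAt_chartNorm (g : SmoothMetric n M) {x₀ : M} {y v : EuclideanSpace ℝ (Fin n)}
    (hy : y ∈ (extChartAt (𝓡 n) x₀).target) (hv : v ≠ 0) :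
    ContDiffAt ℝ ∞ (fun q : EuclideanSpace ℝ (Fin n) × EuclideanSpace ℝ (Fin n) =>
      √(chartMetric g x₀ q.1 q.2 q.2)) (y, v) := by
  have h1 : ContDiffAt ℝ ∞ (fun q : EuclideanSpace ℝ (Fin n) × EuclideanSpace ℝ (Fin n) =>
      chartMetric g x₀ q.1) (y, v) :=
    ContDiffAt.comp (y, v) ((isChartMetric g x₀).contDiffAt hy) contDiffAt_fst
  exact ((h1.clm_apply contDiffAt_snd).clm_apply contDiffAt_snd).sqrt
    ((isChartMetric g x₀).pos y hy v hv).ne'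

lemma contMDiffOn_unitize (g : SmoothMetric n M) (x₀ : M) :
    ContMDiffOn 𝓘(ℝ, EuclideanSpace ℝ (Fin n) × EuclideanSpace ℝ (Fin n)) (𝓡 n).tangent ∞
      (unitize g x₀) {q | q.1 ∈ (extChartAt (𝓡 n) x₀).target ∧ q.2 ≠ 0} := by
  refine (contMDiffOn_tangentChart_symm x₀).comp (ContDiffOn.contMDiffOn fun q hq => ?_)
    fun q hq => mem_tangentChart_target.2 hq.1
  have h := contDiffAt_chartNorm g hq.1 hq.2
  have h0 : √(chartMetric g x₀ q.1 q.2 q.2) ≠ 0 :=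
    (Real.sqrt_pos.2 ((isChartMetric g x₀).pos _ hq.1 _ hq.2)).ne'
  exact (contDiffAt_fst.prodMk ((h.inv h0).smul contDiffAt_snd)).contDiffWithinAt

variable {g : SmoothMetric n M} {φ : Flow ℝ (UnitTangentBundle g)}
  {Φ : ℝ × TangentBundle (𝓡 n) M → TangentBundle (𝓡 n) M}

lemma contMDiffAt_flow_unitize
    (hΦ : ContMDiffOn (𝓘(ℝ, ℝ).prod (𝓡 n).tangent) (𝓡 n).tangent ∞ Φ (univ ×ˢ unitTangentSet g))
    {x₀ : M} {t : ℝ} {y v : EuclideanSpace ℝ (Fin n)}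
    (hy : y ∈ (extChartAt (𝓡 n) x₀).target) (hv : v ≠ 0) :
    ContMDiffAt 𝓘(ℝ, ℝ × EuclideanSpace ℝ (Fin n) × EuclideanSpace ℝ (Fin n)) (𝓡 n).tangent ∞
      (fun q : ℝ × EuclideanSpace ℝ (Fin n) × EuclideanSpace ℝ (Fin n) =>
        Φ (q.1, unitize g x₀ q.2)) (t, y, v) := by
  set D : Set (EuclideanSpace ℝ (Fin n) × EuclideanSpace ℝ (Fin n)) :=
    {q | q.1 ∈ (extChartAt (𝓡 n) x₀).target ∧ q.2 ≠ 0} with hD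
  have h1 : ContMDiffOn 𝓘(ℝ, ℝ × EuclideanSpace ℝ (Fin n) × EuclideanSpace ℝ (Fin n))
      (𝓡 n).tangent ∞ (fun q : ℝ × EuclideanSpace ℝ (Fin n) × EuclideanSpace ℝ (Fin n) =>
        unitize g x₀ q.2) (Prod.snd ⁻¹' D) :=
    (contMDiffOn_unitize g x₀).comp contDiff_snd.contMDiff.contMDiffOn fun q hq => hq
  have h2 : ContMDiffOn 𝓘(ℝ, ℝ × EuclideanSpace ℝ (Fin n) × EuclideanSpace ℝ (Fin n))
      𝓘(ℝ, ℝ) ∞ (fun q : ℝ × EuclideanSpace ℝ (Fin n) × EuclideanSpace ℝ (Fin n) => q.1)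
      (Prod.snd ⁻¹' D) := contDiff_fst.contMDiff.contMDiffOn
  have h3 := hΦ.comp (h2.prodMk h1) fun q hq => ⟨mem_univ _, unitize_mem g hq.1 hq.2⟩
  exact h3.contMDiffAt (((isOpen_target_prod_ne_zero x₀).preimage continuous_snd).mem_nhds ⟨hy, hv⟩)

lemma contDiffAt_flowChart
    (hΦ : ContMDiffOn (𝓘(ℝ, ℝ).prod (𝓡 n).tangent) (𝓡 n).tangent ∞ Φ (univ ×ˢ unitTangentSet g))
    {x₀ : M} {t : ℝ} {y v : EuclideanSpace ℝ (Fin n)}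
    (hy : y ∈ (extChartAt (𝓡 n) x₀).target) (hv : v ≠ 0)
    (ht : (Φ (t, unitize g x₀ (y, v))).proj ∈ (extChartAt (𝓡 n) x₀).source) :
    ContDiffAt ℝ ∞ (flowChart g Φ x₀) (t, y, v) := by
  have h0 : IsOpen (tangentChart (n := n) x₀).source := isOpen_extChartAt_source _
  have h1 : ContMDiffAt (𝓡 n).tangent 𝓘(ℝ, EuclideanSpace ℝ (Fin n) × EuclideanSpace ℝ (Fin n)) ∞
      (tangentChart x₀) (Φ (t, unitize g x₀ (y, v))) :=
    (contMDiffOn_tangentChart x₀).contMDiffAt (h0.mem_nhds (mem_tangentChart_source.2 ht))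
  have h2 : ContDiffAt ℝ ∞ (fun q : ℝ × EuclideanSpace ℝ (Fin n) × EuclideanSpace ℝ (Fin n) =>
      tangentChart x₀ (Φ (q.1, unitize g x₀ q.2))) (t, y, v) :=
    contMDiffAt_iff_contDiffAt.1 (ContMDiffAt.comp (t, y, v) h1
      (contMDiffAt_flow_unitize hΦ hy hv))
  have h3 : ContDiffAt ℝ ∞ (fun q : ℝ × EuclideanSpace ℝ (Fin n) × EuclideanSpace ℝ (Fin n) =>
      √(chartMetric g x₀ q.2.1 q.2.2 q.2.2)) (t, y, v) :=
    ContDiffAt.comp (g := fun q : EuclideanSpace ℝ (Fin n) × EuclideanSpace ℝ (Fin n) =>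
      √(chartMetric g x₀ q.1 q.2 q.2)) (t, y, v) (contDiffAt_chartNorm g hy hv) contDiffAt_snd
  exact h2.fst.prodMk (h3.smul h2.snd)

lemma flowChart_zero (hΦφ : ∀ (t : ℝ) (p : UnitTangentBundle g), Φ (t, p.1) = (φ t p).1)
    {x₀ : M} {y v : EuclideanSpace ℝ (Fin n)}
    (hy : y ∈ (extChartAt (𝓡 n) x₀).target) (hv : v ≠ 0) :
    flowChart g Φ x₀ (0, y, v) = (y, v) := by
  have h1 : Φ (0, unitize g x₀ (y, v)) = unitize g x₀ (y, v) := by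
    have := hΦφ 0 ⟨_, unitize_mem g hy hv⟩
    rwa [φ.map_zero_apply] at this
  have h0 : √(chartMetric g x₀ y v v) ≠ 0 :=
    (Real.sqrt_pos.2 ((isChartMetric g x₀).pos _ hy _ hv)).ne'
  simp only [flowChart, h1]
  rw [unitize, tangentChart_right_inv hy]
  simp only [smul_smul, mul_inv_cancel₀ h0, one_smul]

/-- At unit vectors the time derivative of the extended flow is the generator. -/
lemma fderiv_flowChart
    (hΦ : ContMDiffOn (𝓘(ℝ, ℝ).prod (𝓡 n).tangent) (𝓡 n).tangent ∞ Φ (univ ×ˢ unitTangentSet g))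
    (hΦφ : ∀ (t : ℝ) (p : UnitTangentBundle g), Φ (t, p.1) = (φ t p).1)
    {x₀ : M} {y v : EuclideanSpace ℝ (Fin n)}
    (hy : y ∈ (extChartAt (𝓡 n) x₀).target) (hv : chartMetric g x₀ y v v = 1) :
    fderiv ℝ (flowChart g Φ x₀) (0, y, v) (1, 0) = chartGenerator φ x₀ (unitVector g hy hv) := by
  have hv0 : v ≠ 0 := by rintro rfl; simp at hv
  have hφ : IsSmoothFlow φ := ⟨Φ, hΦ, hΦφ⟩
  have hu := unitize_of_unit g hv
  have hp := unitVector_proj_mem g hy hv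
  have h0 : Φ (0, unitize g x₀ (y, v)) = (unitVector g hy hv).1 := by
    rw [hu]
    refine (hΦφ 0 (unitVector g hy hv)).trans ?_
    rw [φ.map_zero_apply]
  have h1 := (contDiffAt_flowChart hΦ (t := 0) hy hv0 (by rw [h0]; exact hp)).hasFDerivAt_self
  have h2 : HasDerivAt (fun t : ℝ => (t, y, v)) (1, 0) 0 :=
    (hasDerivAt_id _).prodMk (hasDerivAt_const _ _)
  have h3 := h1.comp_hasDerivAt (0 : ℝ) h2
  refine h3.unique ((hφ.hasDerivAt_tangentChart hp).congr_of_eventuallyEq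
    (Filter.Eventually.of_forall fun t => ?_))
  have h4 : Φ (t, unitize g x₀ (y, v)) = (φ t (unitVector g hy hv)).1 := by
    rw [hu]; exact hΦφ t (unitVector g hy hv)
  simp [flowChart, h4, hv]

/-- The generator of the flow is tangent to (the unit tangent bundle of) a totally invariant
submanifold. -/
lemma LocalSlice.tangent_generator
    (hΦ : ContMDiffOn (𝓘(ℝ, ℝ).prod (𝓡 n).tangent) (𝓡 n).tangent ∞ Φ (univ ×ˢ unitTangentSet g))
    (hΦφ : ∀ (t : ℝ) (p : UnitTangentBundle g), Φ (t, p.1) = (φ t p).1)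
    {k : ℕ} {N : Type} [TopologicalSpace N] [SecondCountableTopology N]
    [ChartedSpace (EuclideanSpace ℝ (Fin k)) N]
    [IsManifold (𝓡 k) ∞ N] {F : Type*} [NormedAddCommGroup F] [NormedSpace ℝ F] {f : N → M}
    (hf : IsImmersionOfComplement F (𝓡 k) (𝓡 n) ∞ f)
    (hinv : IsTotallyInvariant (k := k) φ f) {x₀ : M} {z : N} (S : LocalSlice n k F f x₀ z)
    {u ξ : EuclideanSpace ℝ (Fin k)} (hu : u ∈ S.U) (hy : S.h u ∈ (extChartAt (𝓡 n) x₀).target)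
    (hξ : chartMetric g x₀ (S.h u) (fderiv ℝ S.h u ξ) (fderiv ℝ S.h u ξ) = 1) :
    ∃ a b, chartGenerator φ x₀ (unitVector g hy hξ) =
      (fderiv ℝ S.h u a, fderiv ℝ (fderiv ℝ S.h) u a ξ + fderiv ℝ S.h u b) := by
  have hv0 : fderiv ℝ S.h u ξ ≠ 0 := by intro h; rw [h] at hξ; simp at hξ
  have hξ0 : ξ ≠ 0 := by rintro rfl; simp at hv0
  have hfs : ContMDiff (𝓡 k) (𝓡 n) ∞ f := hf.contMDiff
  have hp := unitVector_proj_mem g hy hξ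
  have h0 : Φ (0, unitize g x₀ (S.h u, fderiv ℝ S.h u ξ)) = (unitVector g hy hξ).1 := by
    rw [unitize_of_unit g hξ]
    refine (hΦφ 0 (unitVector g hy hξ)).trans ?_
    rw [φ.map_zero_apply]
  have h0' : (Φ (0, unitize g x₀ (S.h u, fderiv ℝ S.h u ξ))).proj ∈
    (extChartAt (𝓡 n) x₀).source := by rw [h0]; exact hp
  -- Cover the part of `N` over the chart by countably many slices.
  set P : Set N := f ⁻¹' (extChartAt (𝓡 n) x₀).source with hP
  have hPo : IsOpen P := (isOpen_extChartAt_source x₀).preimage hfs.continuous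
  let T : ∀ z' : P, LocalSlice n k F f x₀ z'.1 := fun z' => (exists_localSlice hf z'.2).some
  obtain ⟨C, hC, hCu⟩ := TopologicalSpace.countable_cover_nhds (α := P)
    (f := fun z' => Subtype.val ⁻¹' {z'' : N | ∃ u' ∈ (T z').U, ∀ η : TangentSpace (𝓡 k) z'', ∃ ξ',
      tangentChart x₀ (tangentMap (𝓡 k) (𝓡 n) f ⟨z'', η⟩) = ((T z').h u', fderiv ℝ (T z').h u' ξ')})
    fun z' => continuous_subtype_val.continuousAt.preimage_mem_nhds (T z').tangentMap_eq
  have : Countable C := hC.to_subtype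
  have hCs := contMDiffAt_flow_unitize hΦ (t := 0) hy hv0
  obtain ⟨a, b, hab⟩ := tangent_of_countable_slices (ι := C) (fun i => (T i).O)
    (fun i => (T i).isOpen_O) (fun i => (T i).s) (fun i => (T i).contDiffAt_s)
    (fun i y hy => by simpa using (T i).finrank_ker y hy) (S.contDiffAt_h u hu) (S.injective u hu)
    (contDiffAt_flowChart hΦ hy hv0 h0')
    (by
      filter_upwards [(isOpen_target_prod_ne_zero x₀).mem_nhds
        (show (S.h u, fderiv ℝ S.h u ξ) ∈ {q : EuclideanSpace ℝ (Fin n) × EuclideanSpace ℝ (Fin n) |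
          q.1 ∈ (extChartAt (𝓡 n) x₀).target ∧ q.2 ≠ 0} from ⟨hy, hv0⟩)] with q hq
      exact flowChart_zero hΦφ hq.1 hq.2)
    (by
      have hQ : ContinuousAt (fun a : ℝ × EuclideanSpace ℝ (Fin k) × EuclideanSpace ℝ (Fin k) =>
          (a.1, S.h a.2.1, fderiv ℝ S.h a.2.1 a.2.2)) (0, u, ξ) := by
        have h1 : ContinuousAt (fun a : ℝ × EuclideanSpace ℝ (Fin k) × EuclideanSpace ℝ (Fin k) =>
          S.h a.2.1) (0, u, ξ) := ContinuousAt.comp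
            (f := fun a : ℝ × EuclideanSpace ℝ (Fin k) × EuclideanSpace ℝ (Fin k) => a.2.1)
            (x := (0, u, ξ)) (S.contDiffAt_h u hu).continuousAt (by fun_prop)
        have h2 : ContinuousAt (fun a : ℝ × EuclideanSpace ℝ (Fin k) × EuclideanSpace ℝ (Fin k) =>
          fderiv ℝ S.h a.2.1) (0, u, ξ) := ContinuousAt.comp
            (f := fun a : ℝ × EuclideanSpace ℝ (Fin k) × EuclideanSpace ℝ (Fin k) => a.2.1)
            (x := (0, u, ξ)) ((S.contDiffAt_h u hu).fderiv_right (m := ∞) (by simp)).continuousAt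
            (by fun_prop)
        exact continuousAt_fst.prodMk (h1.prodMk (h2.clm_apply (by fun_prop)))
      have hproj : ContinuousAt
          (fun q : ℝ × EuclideanSpace ℝ (Fin n) × EuclideanSpace ℝ (Fin n) =>
          (Φ (q.1, unitize g x₀ q.2)).proj) (0, S.h u, fderiv ℝ S.h u ξ) :=
        (FiberBundle.continuous_proj (EuclideanSpace ℝ (Fin n))
          (TangentSpace (𝓡 n) : M → Type _)).continuousAt.comp hCs.continuousAt
      have hev := (hproj.comp (f := fun a : ℝ × EuclideanSpace ℝ (Fin k) ×
        EuclideanSpace ℝ (Fin k) => (a.1, S.h a.2.1, fderiv ℝ S.h a.2.1 a.2.2))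
        (x := (0, u, ξ)) hQ).preimage_mem_nhds ((isOpen_extChartAt_source x₀).mem_nhds h0')
      have hU : ∀ᶠ a : ℝ × EuclideanSpace ℝ (Fin k) × EuclideanSpace ℝ (Fin k) in 𝓝 (0, u, ξ),
          a.2.1 ∈ S.U ∧ a.2.2 ≠ 0 :=
        ((S.isOpen_U.preimage (by fun_prop)).inter (isOpen_ne.preimage (by fun_prop))).mem_nhds
          ⟨hu, hξ0⟩
      filter_upwards [hev, hU] with a ha1 ⟨ha2, ha3⟩
      -- The normalized vector stays in `UN`, and scaling back does not leave the slices.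
      obtain ⟨t, u', ξ'⟩ := a
      have hy' := S.O_subset (S.mem_O u' ha2)
      have hv' : fderiv ℝ S.h u' ξ' ≠ 0 := fun h =>
        ha3 (S.injective u' ha2 (h.trans (map_zero _).symm))
      obtain ⟨ζ, hζ⟩ := S.exists_tangentMap u' ha2
        ((√(chartMetric g x₀ (S.h u') (fderiv ℝ S.h u' ξ') (fderiv ℝ S.h u' ξ')))⁻¹ • ξ')
      rw [map_smul] at hζ
      obtain ⟨ζ', hζ'⟩ := hinv t (x := ⟨_, unitize_mem g hy' hv'⟩) ⟨ζ, hζ⟩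
      have hΦt : Φ (t, unitize g x₀ (S.h u', fderiv ℝ S.h u' ξ')) =
          tangentMap (𝓡 k) (𝓡 n) f ζ' := by
        rw [hζ']; exact hΦφ t ⟨_, unitize_mem g hy' hv'⟩
      have hzP : ζ'.proj ∈ P := by
        have h1 : (Φ (t, unitize g x₀ (S.h u', fderiv ℝ S.h u' ξ'))).proj ∈
          (extChartAt (𝓡 n) x₀).source := ha1
        rw [hΦt] at h1
        exact h1
      have hzC := hCu.symm ▸ mem_univ (⟨ζ'.proj, hzP⟩ : P)
      simp only [mem_iUnion] at hzC
      obtain ⟨i, hi, u₁, hu₁, hη⟩ := hzC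
      obtain ⟨ξ₁, hξ₁⟩ := hη ζ'.snd
      have hΦt' : tangentChart x₀ (Φ (t, unitize g x₀ (S.h u', fderiv ℝ S.h u' ξ'))) =
          ((T i).h u₁, fderiv ℝ (T i).h u₁ ξ₁) := by rw [hΦt]; exact hξ₁
      refine ⟨⟨i, hi⟩, ?_⟩
      simp only [flowChart, hΦt']
      refine ⟨(T i).mem_O u₁ hu₁, (T i).s_h u₁ hu₁, ?_⟩
      rw [map_smul, (T i).fderiv_s_h hu₁, smul_zero])
  exact ⟨a, b, (fderiv_flowChart hΦ hΦφ hy hξ).symm.trans hab⟩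

end FlowTangency

/-! ### The direction of the generator -/

section Subspaces

/-- A vector outside a subspace `S` of dimension at most `k` can be avoided by a `k`-dimensional
subspace which contains `S`. -/
lemma exists_finrank_eq_notMem {V : Type*} [AddCommGroup V] [Module ℝ V] [FiniteDimensional ℝ V]
    {k : ℕ} (hk : k < Module.finrank ℝ V) (S : Submodule ℝ V) (hS : Module.finrank ℝ S ≤ k)
    {z : V} (hz : z ∉ S) : ∃ W : Submodule ℝ V, Module.finrank ℝ W = k ∧ S ≤ W ∧ z ∉ W := by
  obtain ⟨d, hd⟩ := Nat.exists_eq_add_of_le hS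
  induction d generalizing S with
  | zero => exact ⟨S, hd.symm, le_rfl, hz⟩
  | succ d ih =>
    have h1 : Module.finrank ℝ (S ⊔ ℝ ∙ z : Submodule ℝ V) < Module.finrank ℝ V := by
      have h2 := Submodule.finrank_add_le_finrank_add_finrank S (ℝ ∙ z)
      have h3 := (finrank_span_le_card (R := ℝ) {z}).trans_eq (by simp : _ = 1)
      omega
    obtain ⟨w, hw⟩ : ∃ w, w ∉ S ⊔ ℝ ∙ z := by
      by_contra! h
      rw [(Submodule.eq_top_iff').2 h, finrank_top] at h1
      exact lt_irrefl _ h1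
    have hwS : w ∉ S := fun h => hw (Submodule.mem_sup_left h)
    have h4 : Module.finrank ℝ (S ⊔ ℝ ∙ w : Submodule ℝ V) = Module.finrank ℝ S + 1 :=
      Submodule.finrank_sup_span_singleton hwS
    obtain ⟨W, hW1, hW2, hW3⟩ := ih (S ⊔ ℝ ∙ w) (by omega) (by
      intro h
      obtain ⟨s, hs, t, ht, rfl⟩ := Submodule.mem_sup.1 h
      obtain ⟨c, rfl⟩ := Submodule.mem_span_singleton.1 ht
      have hc : c ≠ 0 := by rintro rfl; exact hz (by simpa using hs)
      -- Solve `z = s + c w` for `w`.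
      apply hw
      refine Submodule.mem_sup.2 ⟨-(c⁻¹ • s), S.neg_mem (S.smul_mem _ hs), c⁻¹ • (s + c • w),
        Submodule.smul_mem _ _ (Submodule.mem_span_singleton_self _), ?_⟩
      rw [smul_add, smul_smul, inv_mul_cancel₀ hc]
      module) (by omega)
    exact ⟨W, hW1, le_sup_left.trans hW2, hW3⟩

lemma mem_of_forall_finrank_eq {V : Type*} [AddCommGroup V] [Module ℝ V] [FiniteDimensional ℝ V]
    {k : ℕ} (hk : k < Module.finrank ℝ V) (S : Submodule ℝ V) (hS : Module.finrank ℝ S ≤ k)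
    {z : V} (hz : ∀ W : Submodule ℝ V, Module.finrank ℝ W = k → S ≤ W → z ∈ W) : z ∈ S := by
  by_contra h
  obtain ⟨W, h1, h2, h3⟩ := exists_finrank_eq_notMem hk S hS h
  exact h3 (hz W h1 h2)

end Subspaces

section GeneratorDirection

variable {n k : ℕ} {M : Type u} [TopologicalSpace M]
  [ChartedSpace (EuclideanSpace ℝ (Fin n)) M] [IsManifold (𝓡 n) ∞ M]
  {g : SmoothMetric n M} {φ : Flow ℝ (UnitTangentBundle g)}

/-- `S` is a slice of a submanifold to whose unit tangent bundle the generator is tangent. -/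
def LocalSlice.IsInvariant {N : Type} [TopologicalSpace N] [ChartedSpace (EuclideanSpace ℝ (Fin k)) N]
    {F : Type*} [NormedAddCommGroup F] [NormedSpace ℝ F] {f : N → M} {x₀ : M} {z : N}
    (φ : Flow ℝ (UnitTangentBundle g)) (S : LocalSlice n k F f x₀ z) : Prop :=
  ∀ u ∈ S.U, ∀ ξ, ∀ (hy : S.h u ∈ (extChartAt (𝓡 n) x₀).target)
    (hξ : chartMetric g x₀ (S.h u) (fderiv ℝ S.h u ξ) (fderiv ℝ S.h u ξ) = 1),
    ∃ a b, chartGenerator φ x₀ (unitVector g hy hξ) =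
      (fderiv ℝ S.h u a, fderiv ℝ (fderiv ℝ S.h) u a ξ + fderiv ℝ S.h u b)

/-- Every `k`-plane in every tangent space is tangent to a totally invariant submanifold. -/
def HasTotallyInvariantPlanes (φ : Flow ℝ (UnitTangentBundle g)) (k : ℕ) : Prop :=
  ∀ (x : M) (W : Submodule ℝ (TangentSpace (𝓡 n) x)),
    Module.finrank ℝ W = k → IsTangentToTotallyInvariant φ k x W

/-- Every `k`-plane is tangent to an invariant slice. -/
lemma IsSmoothFlow.exists_isInvariant_localSlice (hφ : IsSmoothFlow φ)
    (hplanes : HasTotallyInvariantPlanes φ k) {x₀ : M}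
    {y : EuclideanSpace ℝ (Fin n)} (hy : y ∈ (extChartAt (𝓡 n) x₀).target)
    (W : Submodule ℝ (EuclideanSpace ℝ (Fin n))) (hW : Module.finrank ℝ W = k) :
    ∃ (N : Type) (_ : TopologicalSpace N) (_ : ChartedSpace (EuclideanSpace ℝ (Fin k)) N)
      (F : Type) (_ : NormedAddCommGroup F) (_ : NormedSpace ℝ F) (f : N → M) (z : N)
      (S : LocalSlice n k F f x₀ z), S.IsInvariant φ ∧ S.h S.u = y ∧
        ∀ w, w ∈ W ↔ ∃ ξ, fderiv ℝ S.h S.u ξ = w := by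
  obtain ⟨Φ, hΦ, hΦφ⟩ := hφ
  set x : M := (extChartAt (𝓡 n) x₀).symm y with hx
  have hxs : x ∈ (extChartAt (𝓡 n) x₀).source := (extChartAt (𝓡 n) x₀).map_target hy
  have hxy : extChartAt (𝓡 n) x₀ x = y := (extChartAt (𝓡 n) x₀).right_inv hy
  set A : EuclideanSpace ℝ (Fin n) →L[ℝ] EuclideanSpace ℝ (Fin n) :=
    tangentCoordChange (𝓡 n) x₀ x x with hA
  have hAi : Function.Injective A :=
    Function.LeftInverse.injective fun v => tangentCoordChange_inverse hxs (mem_extChartAt_source x) v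
  let W' : Submodule ℝ (EuclideanSpace ℝ (Fin n)) :=
    W.map (A : EuclideanSpace ℝ (Fin n) →ₗ[ℝ] EuclideanSpace ℝ (Fin n))
  have hW' : Module.finrank ℝ W' = k := by
    rw [← hW]
    exact (Submodule.equivMapOfInjective
      (A : EuclideanSpace ℝ (Fin n) →ₗ[ℝ] EuclideanSpace ℝ (Fin n)) hAi W).symm.finrank_eq
  obtain ⟨N, _, _, _, _, _, f, ⟨F, _, _, hf⟩, hinv, z, hz⟩ := hplanes x W' hW'
  have hmem : ∀ η : TangentSpace (𝓡 k) z, ∃ w : EuclideanSpace ℝ (Fin n), w ∈ W ∧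
      tangentMap (𝓡 k) (𝓡 n) f ⟨z, η⟩ = ofChart x₀ x w := by
    intro η
    obtain ⟨w', hw', h⟩ := hz ▸ mem_range_self (f := fun u : TangentSpace (𝓡 k) z =>
      tangentMap (𝓡 k) (𝓡 n) f ⟨z, u⟩) η
    obtain ⟨w, hw, rfl⟩ := hw'
    exact ⟨w, hw, h.symm⟩
  have hfz : f z = x := by
    obtain ⟨w, -, hw⟩ := hmem 0
    exact congrArg (fun q : TangentBundle (𝓡 n) M => q.proj) hw
  obtain ⟨S⟩ := exists_localSlice hf (x₀ := x₀) (z := z) (by rw [hfz]; exact hxs)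
  have hSu : S.h S.u = y := by rw [S.h_u, hfz, hxy]
  refine ⟨N, _, _, F, _, _, f, z, S, fun u hu ξ hy hξ =>
    S.tangent_generator hΦ hΦφ hf hinv hu hy hξ, hSu, fun w => ⟨fun hw => ?_, ?_⟩⟩
  · have h1 : ofChart x₀ x w ∈ range (fun u : TangentSpace (𝓡 k) z =>
        tangentMap (𝓡 k) (𝓡 n) f ⟨z, u⟩) := by
      rw [hz]
      exact ⟨A w, ⟨w, hw, rfl⟩, rfl⟩
    obtain ⟨η, hη⟩ := h1
    obtain ⟨ξ, hξ⟩ := S.tangentMap_u η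
    refine ⟨ξ, ?_⟩
    have h2 : tangentChart x₀ (tangentMap (𝓡 k) (𝓡 n) f ⟨z, η⟩) = (y, w) := by
      rw [← hxy, ← tangentChart_ofChart hxs]
      exact congrArg (tangentChart x₀) hη
    rw [h2] at hξ
    exact (congrArg Prod.snd hξ).symm
  · rintro ⟨ξ, rfl⟩
    obtain ⟨η, hη⟩ := S.exists_tangentMap_u ξ
    obtain ⟨w, hw, h⟩ := hmem η
    have h2 := congrArg (tangentChart x₀) (hη.symm.trans h)
    rw [tangentChart_ofChart hxs, hSu, tangentChart_right_inv hy] at h2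
    rw [show fderiv ℝ S.h S.u ξ = w from congrArg Prod.snd h2]
    exact hw

lemma unitVector_flip (g : SmoothMetric n M) {x₀ : M} {y v : EuclideanSpace ℝ (Fin n)}
    (hy : y ∈ (extChartAt (𝓡 n) x₀).target) (hv : chartMetric g x₀ y v v = 1)
    (hv' : chartMetric g x₀ y (-v) (-v) = 1) :
    unitVector g hy hv' = (unitVector g hy hv).flip := by
  refine Subtype.ext ?_
  have h1 : (unitVector g hy hv').1 ∈ (tangentChart x₀).source :=
    mem_tangentChart_source.2 (unitVector_proj_mem g hy hv')
  have h2 : (unitVector g hy hv).flip.1 ∈ (tangentChart x₀).source :=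
    mem_tangentChart_source.2 (unitVector_proj_mem g hy hv)
  refine (tangentChart x₀).injOn h1 h2 ?_
  rw [tangentChart_flip, tangentChart_unitVector, tangentChart_unitVector]

/-- If the horizontal part of the generator at `h' ξ` is `c • h' ξ`, then both `c • ∇dh(ξ, ξ)` and
the vertical part of the generator are tangent to an invariant slice `h`. Tangency of the generator
only gives this for their difference; the two are separated by the oddness of the flow, since the
Hessian is even in `ξ`. -/
lemma LocalSlice.IsInvariant.tangential {N : Type} [TopologicalSpace N]
    [ChartedSpace (EuclideanSpace ℝ (Fin k)) N]
    {F : Type*} [NormedAddCommGroup F] [NormedSpace ℝ F] {f : N → M} {x₀ : M} {z : N}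
    {S : LocalSlice n k F f x₀ z} (hS : S.IsInvariant φ) (hφ : IsSmoothFlow φ)
    (hodd : IsOddFlow φ) {u ξ : EuclideanSpace ℝ (Fin k)} (hu : u ∈ S.U)
    (hy : S.h u ∈ (extChartAt (𝓡 n) x₀).target)
    (hξ : chartMetric g x₀ (S.h u) (fderiv ℝ S.h u ξ) (fderiv ℝ S.h u ξ) = 1) {c : ℝ}
    (hc : (chartGenerator φ x₀ (unitVector g hy hξ)).1 = c • fderiv ℝ S.h u ξ) :
    (∃ w, c • covHessian (leviCivita (chartMetric g x₀)) S.h u ξ ξ = fderiv ℝ S.h u w) ∧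
      ∃ w, chartVertical φ x₀ (unitVector g hy hξ) = fderiv ℝ S.h u w := by
  have hinj := S.injective u hu
  obtain ⟨a, b, hab⟩ := hS u hu ξ hy hξ
  have hξ' : chartMetric g x₀ (S.h u) (fderiv ℝ S.h u (-ξ)) (fderiv ℝ S.h u (-ξ)) = 1 := by
    simpa using hξ
  obtain ⟨a', b', hab'⟩ := hS u hu (-ξ) hy hξ'
  have hflip : unitVector g hy hξ' = (unitVector g hy hξ).flip := by
    have h1 : chartMetric g x₀ (S.h u) (-fderiv ℝ S.h u ξ) (-fderiv ℝ S.h u ξ) = 1 := by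
      simpa using hξ
    rw [← unitVector_flip g hy hξ h1]
    congr 1
    exact map_neg _ _
  obtain ⟨h1, h2⟩ := hφ.chartGenerator_flip hodd (unitVector_proj_mem g hy hξ)
  rw [← hflip] at h1 h2
  have ha : a = c • ξ := hinj (by rw [map_smul, ← hc, hab])
  have ha' : a' = -(c • ξ) := hinj (by
    have : fderiv ℝ S.h u a' = (chartGenerator φ x₀ (unitVector g hy hξ')).1 := by rw [hab']
    rw [this, h1, hc, map_neg, map_smul])
  have h3 : chartVertical φ x₀ (unitVector g hy hξ) =
      c • covHessian (leviCivita (chartMetric g x₀)) S.h u ξ ξ + fderiv ℝ S.h u b := by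
    rw [chartVertical, tangentChart_unitVector, hab, ha, covHessian]
    simp only [map_smul, smul_apply]
    module
  have h4 : chartVertical φ x₀ (unitVector g hy hξ') =
      c • covHessian (leviCivita (chartMetric g x₀)) S.h u ξ ξ + fderiv ℝ S.h u b' := by
    rw [chartVertical, tangentChart_unitVector, hab', ha', covHessian]
    simp only [map_smul, smul_apply, map_neg, neg_apply]
    module
  rw [h4, h3] at h2
  have h5 : c • covHessian (leviCivita (chartMetric g x₀)) S.h u ξ ξ =
      fderiv ℝ S.h u (-(1 / 2 : ℝ) • (b + b')) := by
    rw [map_smul, map_add]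
    linear_combination (norm := module) (1 / 2 : ℝ) • h2
  exact ⟨⟨_, h5⟩, -(1 / 2 : ℝ) • (b + b') + b, by rw [h3, h5, map_add]⟩

/-- The horizontal part of the generator at `v` is a multiple of `v`: it lies in all `k`-planes
through `v`. -/
lemma IsSmoothFlow.exists_chartGenerator_fst (hφ : IsSmoothFlow φ)
    (hk₁ : 1 < k) (hkn : k < n) (hplanes : HasTotallyInvariantPlanes φ k) {x₀ : M}
    {y v : EuclideanSpace ℝ (Fin n)} (hy : y ∈ (extChartAt (𝓡 n) x₀).target)
    (hv : chartMetric g x₀ y v v = 1) :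
    ∃ c : ℝ, (chartGenerator φ x₀ (unitVector g hy hv)).1 = c • v := by
  have h := mem_of_forall_finrank_eq (k := k) (by simpa using hkn) (ℝ ∙ v)
    (((finrank_span_le_card (R := ℝ) {v}).trans_eq (by simp : _ = 1)).trans hk₁.le)
    (z := (chartGenerator φ x₀ (unitVector g hy hv)).1) fun W hW hvW => by
      obtain ⟨N, _, _, F, _, _, f, z, S, hS, rfl, hSW⟩ :=
        hφ.exists_isInvariant_localSlice hplanes hy W hW
      obtain ⟨ξ, rfl⟩ := (hSW v).1 (hvW (Submodule.mem_span_singleton_self v))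
      obtain ⟨a, b, hab⟩ := hS S.u S.mem_U ξ hy hv
      exact (hSW _).2 ⟨a, by rw [hab]⟩
  obtain ⟨c, hc⟩ := Submodule.mem_span_singleton.1 h
  exact ⟨c, hc.symm⟩

/-- The vertical part of the generator vanishes: it is a multiple of `v`, and orthogonal to `v`. -/
lemma IsSmoothFlow.chartVertical_eq_zero (hφ : IsSmoothFlow φ) (hodd : IsOddFlow φ)
    (hk₁ : 1 < k) (hkn : k < n) (hplanes : HasTotallyInvariantPlanes φ k) {x₀ : M}
    {y v : EuclideanSpace ℝ (Fin n)} (hy : y ∈ (extChartAt (𝓡 n) x₀).target)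
    (hv : chartMetric g x₀ y v v = 1) :
    chartVertical φ x₀ (unitVector g hy hv) = 0 := by
  obtain ⟨c, hc⟩ := hφ.exists_chartGenerator_fst hk₁ hkn hplanes hy hv
  have h := mem_of_forall_finrank_eq (k := k) (by simpa using hkn) (ℝ ∙ v)
    (((finrank_span_le_card (R := ℝ) {v}).trans_eq (by simp : _ = 1)).trans hk₁.le)
    (z := chartVertical φ x₀ (unitVector g hy hv)) fun W hW hvW => by
      obtain ⟨N, _, _, F, _, _, f, z, S, hS, rfl, hSW⟩ :=
        hφ.exists_isInvariant_localSlice hplanes hy W hW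
      obtain ⟨ξ, rfl⟩ := (hSW v).1 (hvW (Submodule.mem_span_singleton_self v))
      obtain ⟨w, hw⟩ := (hS.tangential hφ hodd S.mem_U hy hv hc).2
      exact (hSW _).2 ⟨w, hw.symm⟩
  obtain ⟨d, hd⟩ := Submodule.mem_span_singleton.1 h
  have h1 := hφ.chartVertical_orthogonal (unitVector_proj_mem g hy hv)
  rw [tangentChart_unitVector, ← hd] at h1
  simp only [map_smul, smul_apply, smul_eq_mul, hv, mul_one] at h1
  rw [← hd, h1, zero_smul]

end GeneratorDirection

/-! ### Totally geodesic slices -/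

section GeneratorZeros

variable {n k : ℕ} {M : Type u} [TopologicalSpace M]
  [ChartedSpace (EuclideanSpace ℝ (Fin n)) M] [IsManifold (𝓡 n) ∞ M]
  {g : SmoothMetric n M} {φ : Flow ℝ (UnitTangentBundle g)}

lemma IsSmoothFlow.eventually_orbit_mem (hφ : IsSmoothFlow φ) {p : UnitTangentBundle g} {t : ℝ}
    {x₁ : M} (ht : (φ t p).1.proj ∈ (extChartAt (𝓡 n) x₁).source) :
    ∀ᶠ s in 𝓝 t, (φ s p).1.proj ∈ (extChartAt (𝓡 n) x₁).source :=
  ((FiberBundle.continuous_proj (EuclideanSpace ℝ (Fin n))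
    (TangentSpace (𝓡 n) : M → Type _)).comp (hφ.contMDiff_orbit p).continuous).continuousAt
    |>.preimage_mem_nhds ((isOpen_extChartAt_source x₁).mem_nhds ht)

/-- Zeros of the generator are rest points: the velocity at time `t` is the image of the velocity
at time `0` under the differential of the time-`t` map. -/
lemma IsSmoothFlow.hasDerivAt_zero_of_chartGenerator_eq_zero (hφ : IsSmoothFlow φ) {x₀ : M}
    {p : UnitTangentBundle g} (hp : p.1.proj ∈ (extChartAt (𝓡 n) x₀).source)
    (h0 : chartGenerator φ x₀ p = 0) {t : ℝ} {x₁ : M}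
    (ht : (φ t p).1.proj ∈ (extChartAt (𝓡 n) x₁).source) :
    HasDerivAt (fun s => tangentChart x₁ (φ s p).1) 0 t := by
  obtain ⟨Φ, hΦ, hΦφ⟩ := id hφ
  have hunit : ∀ q : UnitTangentBundle g, q.1.proj ∈ (extChartAt (𝓡 n) x₀).source →
      unitize g x₀ (tangentChart x₀ q.1) = q.1 := fun q hq => by
    have h1 := unitize_of_unit g ((mem_unitTangentSet_iff g hq).1 q.2)
    exact h1.trans ((tangentChart x₀).left_inv (mem_tangentChart_source.2 hq))
  have hy : (tangentChart x₀ p.1).1 ∈ (extChartAt (𝓡 n) x₀).target :=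
    (extChartAt (𝓡 n) x₀).map_source hp
  have hv : (tangentChart x₀ p.1).2 ≠ 0 := by
    intro h
    have h1 := (mem_unitTangentSet_iff g hp).1 p.2
    rw [h] at h1
    simp at h1
  have hΦp : Φ (t, unitize g x₀ ((tangentChart x₀ p.1).1, (tangentChart x₀ p.1).2)) =
      (φ t p).1 := by
    rw [Prod.mk.eta, hunit p hp, hΦφ]
  have ho : IsOpen (tangentChart (n := n) x₁).source := isOpen_extChartAt_source _
  have h1 : ContMDiffAt (𝓡 n).tangent 𝓘(ℝ, EuclideanSpace ℝ (Fin n) × EuclideanSpace ℝ (Fin n)) ∞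
      (tangentChart x₁)
      (Φ (t, unitize g x₀ ((tangentChart x₀ p.1).1, (tangentChart x₀ p.1).2))) := by
    rw [hΦp]
    exact (contMDiffOn_tangentChart x₁).contMDiffAt (ho.mem_nhds (mem_tangentChart_source.2 ht))
  have h2 : ContDiffAt ℝ ∞ (fun q : ℝ × EuclideanSpace ℝ (Fin n) × EuclideanSpace ℝ (Fin n) =>
      tangentChart x₁ (Φ (q.1, unitize g x₀ q.2)))
      (t, (tangentChart x₀ p.1).1, (tangentChart x₀ p.1).2) :=
    contMDiffAt_iff_contDiffAt.1 (ContMDiffAt.comp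
      (t, (tangentChart x₀ p.1).1, (tangentChart x₀ p.1).2) h1 (contMDiffAt_flow_unitize hΦ hy hv))
  have h3 : HasDerivAt (fun s : ℝ => (t, tangentChart x₀ (φ s p).1)) (0, 0) 0 :=
    (hasDerivAt_const _ _).prodMk (h0 ▸ hφ.hasDerivAt_tangentChart hp)
  have h4 := HasFDerivAt.comp_hasDerivAt (0 : ℝ)
    (by rw [φ.map_zero_apply]; exact h2.hasFDerivAt_self) h3
  have h5 : HasDerivAt (fun s => tangentChart x₁ (φ (t + s) p).1) 0 0 := by
    rw [← Prod.zero_eq_mk, map_zero] at h4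
    refine h4.congr_of_eventuallyEq ?_
    filter_upwards [hφ.eventually_orbit_mem (p := p) (t := 0) (x₁ := x₀)
      (by rwa [φ.map_zero_apply])] with s hs
    simp only [Function.comp_apply]
    rw [hunit _ hs, hΦφ, φ.map_add]
  have h6 := HasDerivAt.comp_sub_const (f := fun s => tangentChart x₁ (φ (t + s) p).1) t t
    (by simpa using h5)
  simpa using h6

lemma IsSmoothFlow.proj_eq_of_chartGenerator_eq_zero (hφ : IsSmoothFlow φ) {x₀ : M}
    {p : UnitTangentBundle g} (hp : p.1.proj ∈ (extChartAt (𝓡 n) x₀).source)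
    (h0 : chartGenerator φ x₀ p = 0) (t : ℝ) : (φ t p).1.proj = p.1.proj := by
  have hloc : IsLocallyConstant fun s : ℝ => (φ s p).1.proj := by
    refine (IsLocallyConstant.iff_eventually_eq _).2 fun t => ?_
    have ht := mem_extChartAt_source (I := 𝓡 n) (φ t p).1.proj
    obtain ⟨ε, hε, hball⟩ := Metric.eventually_nhds_iff_ball.1 (hφ.eventually_orbit_mem ht)
    filter_upwards [Metric.ball_mem_nhds t hε] with s hs
    have hd : ∀ s ∈ Metric.ball t ε, HasDerivAt
        (fun s => tangentChart (φ t p).1.proj (φ s p).1) 0 s := fun s hs =>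
      hφ.hasDerivAt_zero_of_chartGenerator_eq_zero hp h0 (hball s hs)
    have h1 := Metric.isOpen_ball.is_const_of_deriv_eq_zero (convex_ball t ε).isPreconnected
      (fun s hs => (hd s hs).differentiableAt.differentiableWithinAt)
      (fun s hs => (hd s hs).deriv) hs (Metric.mem_ball_self hε)
    exact (extChartAt (𝓡 n) _).injOn (hball s hs) ht (congrArg Prod.fst h1)
  have h1 := hloc.apply_eq_of_preconnectedSpace t 0
  rwa [φ.map_zero_apply] at h1

/-- The horizontal part of the generator does not vanish. -/
lemma IsSmoothFlow.ne_zero_of_chartGenerator_fst (hφ : IsSmoothFlow φ) (hodd : IsOddFlow φ)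
    (hfix : HasNoFixedPoint φ) (hk₁ : 1 < k) (hkn : k < n)
    (hplanes : HasTotallyInvariantPlanes φ k) {x₀ : M}
    {y v : EuclideanSpace ℝ (Fin n)} (hy : y ∈ (extChartAt (𝓡 n) x₀).target)
    (hv : chartMetric g x₀ y v v = 1) {c : ℝ}
    (hc : (chartGenerator φ x₀ (unitVector g hy hv)).1 = c • v) : c ≠ 0 := by
  rintro rfl
  have h1 := hφ.chartVertical_eq_zero hodd hk₁ hkn hplanes hy hv
  rw [zero_smul] at hc
  rw [chartVertical, hc, map_zero, zero_apply, add_zero] at h1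
  exact hfix ⟨_, unitVector g hy hv, rfl, fun t => hφ.proj_eq_of_chartGenerator_eq_zero
    (unitVector_proj_mem g hy hv) (Prod.ext hc h1) t⟩

/-- Invariant slices are totally geodesic. -/
lemma LocalSlice.IsInvariant.exists_covHessian_eq {N : Type} [TopologicalSpace N]
    [ChartedSpace (EuclideanSpace ℝ (Fin k)) N]
    {F : Type*} [NormedAddCommGroup F] [NormedSpace ℝ F] {f : N → M} {x₀ : M} {z : N}
    {S : LocalSlice n k F f x₀ z} (hS : S.IsInvariant φ) (hφ : IsSmoothFlow φ)
    (hodd : IsOddFlow φ) (hfix : HasNoFixedPoint φ) (hk₁ : 1 < k) (hkn : k < n)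
    (hplanes : HasTotallyInvariantPlanes φ k) {u : EuclideanSpace ℝ (Fin k)} (hu : u ∈ S.U)
    (a b : EuclideanSpace ℝ (Fin k)) :
    ∃ w, covHessian (leviCivita (chartMetric g x₀)) S.h u a b = fderiv ℝ S.h u w := by
  have hy : S.h u ∈ (extChartAt (𝓡 n) x₀).target := S.O_subset (S.mem_O u hu)
  have hG := isChartMetric g x₀
  have hdiag : ∀ ξ, ∃ w, covHessian (leviCivita (chartMetric g x₀)) S.h u ξ ξ =
      fderiv ℝ S.h u w := by
    intro ξ
    rcases eq_or_ne ξ 0 with rfl | hξ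
    · exact ⟨0, by simp [covHessian]⟩
    have hv : fderiv ℝ S.h u ξ ≠ 0 := fun h => hξ (S.injective u hu (h.trans (map_zero _).symm))
    set r := √(chartMetric g x₀ (S.h u) (fderiv ℝ S.h u ξ) (fderiv ℝ S.h u ξ)) with hr
    have hr0 : r ≠ 0 := (Real.sqrt_pos.2 (hG.pos _ hy _ hv)).ne'
    have h1 : chartMetric g x₀ (S.h u) (fderiv ℝ S.h u (r⁻¹ • ξ)) (fderiv ℝ S.h u (r⁻¹ • ξ)) = 1 := by
      rw [map_smul]; exact chartMetric_unitize g hy hv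
    obtain ⟨c, hc⟩ := hφ.exists_chartGenerator_fst hk₁ hkn hplanes hy h1
    have hc0 := hφ.ne_zero_of_chartGenerator_fst hodd hfix hk₁ hkn hplanes hy h1 hc
    obtain ⟨w, hw⟩ := (hS.tangential hφ hodd hu hy h1 hc).1
    refine ⟨(r ^ 2 * c⁻¹) • w, ?_⟩
    rw [map_smul, ← hw, smul_smul]
    simp only [covHessian, map_smul, smul_apply, ← smul_add]
    rw [smul_smul, smul_smul]
    have : r ^ 2 * c⁻¹ * c * r⁻¹ * r⁻¹ = 1 := by field_simp
    rw [this, one_smul]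
  -- Polarize.
  obtain ⟨w₁, h1⟩ := hdiag (a + b)
  obtain ⟨w₂, h2⟩ := hdiag a
  obtain ⟨w₃, h3⟩ := hdiag b
  have hs : covHessian (leviCivita (chartMetric g x₀)) S.h u b a =
      covHessian (leviCivita (chartMetric g x₀)) S.h u a b := by
    rw [covHessian, covHessian, hG.leviCivita_symm hy,
      ContDiffAt.fderiv_fderiv_symm (S.contDiffAt_h u hu)]
  have hadd : covHessian (leviCivita (chartMetric g x₀)) S.h u (a + b) (a + b) =
      covHessian (leviCivita (chartMetric g x₀)) S.h u a a +
      covHessian (leviCivita (chartMetric g x₀)) S.h u a b +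
      covHessian (leviCivita (chartMetric g x₀)) S.h u b a +
      covHessian (leviCivita (chartMetric g x₀)) S.h u b b := by
    simp only [covHessian, map_add, add_apply]
    abel
  rw [hs] at hadd
  refine ⟨(1 / 2 : ℝ) • (w₁ - w₂ - w₃), ?_⟩
  rw [map_smul, map_sub, map_sub, ← h1, ← h2, ← h3, hadd]
  module

/-- The curvature tensor preserves every `k`-plane, since it is tangent to a totally geodesic slice;
so `R(a, b) b` lies in all the `k`-planes containing `a` and `b`. -/
lemma IsSmoothFlow.exists_chartCurvature_eq (hφ : IsSmoothFlow φ)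
    (hodd : IsOddFlow φ) (hfix : HasNoFixedPoint φ) (hk₁ : 1 < k) (hkn : k < n)
    (hplanes : HasTotallyInvariantPlanes φ k) {x₀ : M} {y : EuclideanSpace ℝ (Fin n)}
    (hy : y ∈ (extChartAt (𝓡 n) x₀).target) (a b : EuclideanSpace ℝ (Fin n)) :
    ∃ s t : ℝ, chartCurvature (leviCivita (chartMetric g x₀)) y a b b = s • a + t • b := by
  have h := mem_of_forall_finrank_eq (k := k) (by simpa using hkn) (Submodule.span ℝ {a, b})
    ((finrank_span_le_card (R := ℝ) {a, b}).trans (le_trans (by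
      rw [toFinset_insert, toFinset_singleton]
      exact Finset.card_le_two) hk₁))
    (z := chartCurvature (leviCivita (chartMetric g x₀)) y a b b) fun W hW habW => by
      obtain ⟨N, _, _, F, _, _, f, z, S, hS, rfl, hSW⟩ :=
        hφ.exists_isInvariant_localSlice hplanes hy W hW
      obtain ⟨α, rfl⟩ := (hSW a).1 (habW (Submodule.subset_span (by simp)))
      obtain ⟨β, rfl⟩ := (hSW b).1 (habW (Submodule.subset_span (by simp)))
      have hU := S.isOpen_U.mem_nhds S.mem_U
      obtain ⟨c, hc⟩ := chartCurvature_tangent (Γ := leviCivita (chartMetric g x₀)) (s := S.s)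
        (S.contDiffAt_h _ S.mem_U) ((isChartMetric g x₀).differentiableAt_leviCivita hy)
        (S.contDiffAt_s _ (S.mem_O _ S.mem_U))
        (by filter_upwards [hU] with u hu w using S.fderiv_s_h hu w)
        (fun v hv => S.exists_of_fderiv_s_eq_zero S.mem_U hv)
        (by filter_upwards [hU] with u hu a b using
          hS.exists_covHessian_eq hφ hodd hfix hk₁ hkn hplanes hu a b) α β β
      exact (hSW _).2 ⟨c, hc.symm⟩
  obtain ⟨s, t, hst⟩ := Submodule.mem_span_pair.1 h
  exact ⟨s, t, hst.symm⟩

end GeneratorZeros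

/-! ### Constancy of the curvature -/

section ConstantCurvature

variable {n k : ℕ} {M : Type u} [TopologicalSpace M]
  [ChartedSpace (EuclideanSpace ℝ (Fin n)) M] [IsManifold (𝓡 n) ∞ M]
  {g : SmoothMetric n M} {φ : Flow ℝ (UnitTangentBundle g)}

/-- The Gram determinant of linearly independent vectors is positive. -/
lemma gram_pos {V : Type*} [NormedAddCommGroup V] [NormedSpace ℝ V] {B : V →L[ℝ] V →L[ℝ] ℝ}
    (hs : ∀ a b, B a b = B b a) (hpos : ∀ a, a ≠ 0 → 0 < B a a) {a b : V}
    (hab : LinearIndependent ℝ ![a, b]) : 0 < B a a * B b b - B a b ^ 2 := by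
  have hb : b ≠ 0 := hab.ne_zero 1
  have hbb := hpos b hb
  have hc : B b b • a + (-B a b) • b ≠ 0 := fun h =>
    hbb.ne' (LinearIndependent.pair_iff.1 hab _ _ h).1
  have h1 := hpos _ hc
  simp only [map_add, map_smul, add_apply, smul_apply, smul_eq_mul] at h1
  rw [hs b a] at h1
  have h2 : 0 < B b b * (B a a * B b b - B a b ^ 2) := by nlinarith
  exact pos_of_mul_pos_right h2 hbb.le

lemma chartMetric_self (g : SmoothMetric n M) (x : M) (a b : EuclideanSpace ℝ (Fin n)) :
    chartMetric g x (extChartAt (𝓡 n) x x) a b = metricAt g x a b := by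
  have hx := mem_extChartAt_source (I := 𝓡 n) x
  rw [chartMetric_apply g (mem_extChartAt_target x), extChartAt_to_inv,
    tangentCoordChange_self hx, tangentCoordChange_self hx]

/-- If the curvature tensor has the form of a space form at every point, then it has this form
in every chart. -/
lemma chartCurvature_eq_of_forall {κ : M → ℝ} (hκ : ∀ (x : M) (a b w : EuclideanSpace ℝ (Fin n)),
      chartCurvature (leviCivita (chartMetric g x)) (extChartAt (𝓡 n) x x) a b w =
        κ x • (metricAt g x b w • a - metricAt g x a w • b)) {x₀ : M}
    {y : EuclideanSpace ℝ (Fin n)} (hy : y ∈ (extChartAt (𝓡 n) x₀).target)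
    (a b w : EuclideanSpace ℝ (Fin n)) :
    chartCurvature (leviCivita (chartMetric g x₀)) y a b w =
      κ ((extChartAt (𝓡 n) x₀).symm y) •
        (chartMetric g x₀ y b w • a - chartMetric g x₀ y a w • b) := by
  have hx := (extChartAt (𝓡 n) x₀).map_target hy
  have h := chartCurvature_chartTransition g hx a b w
  rw [hκ, (extChartAt (𝓡 n) x₀).right_inv hy, ← chartMetric_apply g hy,
    ← chartMetric_apply g hy, ← map_smul, ← map_smul, ← map_sub, ← map_smul] at h
  exact (Function.LeftInverse.injective (fun v => tangentCoordChange_inverse hx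
    (mem_extChartAt_source _) v) h).symm

/-- Schur's lemma on a connected manifold. -/
lemma exists_curvature_const [ConnectedSpace M] (hn : 3 ≤ n) {κ : M → ℝ}
    (hκ : ∀ (x : M) (a b w : EuclideanSpace ℝ (Fin n)),
      chartCurvature (leviCivita (chartMetric g x)) (extChartAt (𝓡 n) x x) a b w =
        κ x • (metricAt g x b w • a - metricAt g x a w • b)) : ∃ c, ∀ x, κ x = c := by
  have hloc : IsLocallyConstant κ := by
    refine (IsLocallyConstant.iff_eventually_eq _).2 fun x₀ => ?_
    set ψ := extChartAt (𝓡 n) x₀ with hψ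
    have hG := isChartMetric g x₀
    have hR := fun {y} (hy : y ∈ ψ.target) => chartCurvature_eq_of_forall hκ (x₀ := x₀) hy
    -- In terms of two fixed vectors, the sectional curvature is a differentiable function.
    let a : EuclideanSpace ℝ (Fin n) := EuclideanSpace.single ⟨0, by omega⟩ 1
    let b : EuclideanSpace ℝ (Fin n) := EuclideanSpace.single ⟨1, by omega⟩ 1
    have hab : LinearIndependent ℝ ![a, b] := by
      refine LinearIndependent.pair_iff.2 fun s t hst => ?_
      have h0 := congrArg (fun v : EuclideanSpace ℝ (Fin n) => v ⟨0, by omega⟩) hst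
      have h1 := congrArg (fun v : EuclideanSpace ℝ (Fin n) => v ⟨1, by omega⟩) hst
      simp [a, b] at h0 h1
      exact ⟨h0, h1⟩
    have hd : ∀ y ∈ ψ.target, DifferentiableAt ℝ (κ ∘ ψ.symm) y := by
      intro y hy
      have hgram := gram_pos (hG.symm y hy) (hG.pos y hy) hab
      have hev : κ ∘ ψ.symm =ᶠ[𝓝 y] fun y =>
          chartMetric g x₀ y (chartCurvature (leviCivita (chartMetric g x₀)) y a b b) a /
            (chartMetric g x₀ y a a * chartMetric g x₀ y b b - chartMetric g x₀ y a b ^ 2) := by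
        filter_upwards [hG.isOpen.mem_nhds hy] with y hy
        have hgram := gram_pos (hG.symm y hy) (hG.pos y hy) hab
        rw [hR hy, eq_div_iff hgram.ne']
        simp only [map_smul, map_sub, smul_apply, sub_apply, smul_eq_mul, Function.comp_apply]
        rw [hG.symm y hy b a]
        ring
      have hΓ := (hG.contDiffAt_leviCivita hy).differentiableAt (by simp)
      have hΓ' := ((hG.contDiffAt_leviCivita hy).fderiv_right (m := ∞) (by simp)).differentiableAt
        (by simp)
      have hGd := hG.differentiableAt hy
      refine DifferentiableAt.congr_of_eventuallyEq ?_ hev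
      simp only [div_eq_mul_inv]
      refine DifferentiableAt.fun_mul ?_ (DifferentiableAt.fun_inv ?_ hgram.ne')
      · refine (hGd.clm_apply ?_).clm_apply (differentiableAt_const _)
        unfold chartCurvature
        fun_prop
      · fun_prop
    have hz : ∀ y ∈ ψ.target, fderiv ℝ (κ ∘ ψ.symm) y = 0 := fun y hy =>
      hG.fderiv_eq_zero_of_chartCurvature_eq (by simpa using hn) hy (hd y hy) (by
        filter_upwards [hG.isOpen.mem_nhds hy] with y hy a b w using hR hy a b w)
    obtain ⟨ε, hε, hball⟩ := Metric.isOpen_iff.1 hG.isOpen (ψ x₀) (mem_extChartAt_target x₀)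
    have hc : ContinuousAt ψ x₀ := continuousAt_extChartAt x₀
    filter_upwards [hc.preimage_mem_nhds (Metric.ball_mem_nhds _ hε),
      extChartAt_source_mem_nhds (I := 𝓡 n) x₀] with x hx hxs
    have h1 := Metric.isOpen_ball.is_const_of_fderiv_eq_zero (𝕜 := ℝ)
      (convex_ball (ψ x₀) ε).isPreconnected
      (fun y hy => (hd y (hball hy)).differentiableWithinAt) (fun y hy => hz y (hball hy))
      hx (Metric.mem_ball_self hε)
    simp only [Function.comp_apply] at h1
    rwa [ψ.left_inv hxs, ψ.left_inv (mem_extChartAt_source x₀)] at h1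
  obtain ⟨x₀⟩ : Nonempty M := inferInstance
  exact ⟨κ x₀, fun x => hloc.apply_eq_of_preconnectedSpace x x₀⟩

lemma hasConstantSectionalCurvature_of_forall {κ : M → ℝ} {c : ℝ} (hc : ∀ x, κ x = c)
    (hκ : ∀ (x : M) (a b w : EuclideanSpace ℝ (Fin n)),
      chartCurvature (leviCivita (chartMetric g x)) (extChartAt (𝓡 n) x x) a b w =
        κ x • (metricAt g x b w • a - metricAt g x a w • b)) :
    HasConstantSectionalCurvature g := by
  refine ⟨c, fun x (a : EuclideanSpace ℝ (Fin n)) (b : EuclideanSpace ℝ (Fin n)) hab => ?_⟩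
  have hgram := gram_pos (metricAt_symm g x) (fun a ha => metricAt_pos g x ha) hab
  have h1 : sectionalCurvature g x a b = metricAt g x (c • (metricAt g x b b • a -
      metricAt g x a b • b)) a /
      (metricAt g x a a * metricAt g x b b - metricAt g x a b ^ 2) := by
    rw [← hc x, ← hκ, ← curvature_eq_chartCurvature]
    rfl
  rw [h1, div_eq_iff hgram.ne']
  simp only [map_smul, map_sub, smul_apply, sub_apply, smul_eq_mul]
  rw [metricAt_symm g x b a]
  ring

lemma IsSmoothFlow.hasConstantSectionalCurvature [ConnectedSpace M] (hn : 3 ≤ n)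
    (hφ : IsSmoothFlow φ)
    (hodd : IsOddFlow φ) (hfix : HasNoFixedPoint φ) (hk₁ : 1 < k) (hkn : k < n)
    (hplanes : HasTotallyInvariantPlanes φ k) : HasConstantSectionalCurvature g := by
  choose κ hκ using fun x : M => (isChartMetric g x).exists_chartCurvature_eq
    (by simpa using hn) (mem_extChartAt_target x) fun a b =>
      hφ.exists_chartCurvature_eq hodd hfix hk₁ hkn hplanes (mem_extChartAt_target x) a b
  simp only [chartMetric_self] at hκ
  obtain ⟨c, hc⟩ := exists_curvature_const hn hκ
  exact hasConstantSectionalCurvature_of_forall hc hκ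

end ConstantCurvature

/-! ### The flow as a time-change of the geodesic flow -/

section TimeChange

variable {n k : ℕ} {M : Type u} [TopologicalSpace M]
  [ChartedSpace (EuclideanSpace ℝ (Fin n)) M] [IsManifold (𝓡 n) ∞ M]
  {g : SmoothMetric n M} {φ : Flow ℝ (UnitTangentBundle g)}

/-- The component of the horizontal part of the generator at `(x, v)` along `v`. -/
def speed (φ : Flow ℝ (UnitTangentBundle g)) (p : UnitTangentBundle g) : ℝ :=
  metricAt g p.1.proj (horizontalPart φ p) p.1.snd

lemma IsSmoothFlow.speed_eq (hφ : IsSmoothFlow φ) {x₀ : M} {p : UnitTangentBundle g}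
    (hp : p.1.proj ∈ (extChartAt (𝓡 n) x₀).source) :
    speed φ p = chartMetric g x₀ (tangentChart x₀ p.1).1 (chartGenerator φ x₀ p).1
      (tangentChart x₀ p.1).2 := by
  have hy := (extChartAt (𝓡 n) x₀).map_source hp
  rw [tangentChart_apply, chartMetric_apply g hy, (extChartAt (𝓡 n) x₀).left_inv hp]
  exact congrArg₂ (fun a b => metricAt g p.1.proj a b) (hφ.horizontalPart_eq hp)
    (tangentCoordChange_inverse (v := p.1.snd) (mem_extChartAt_source _) hp).symm

lemma unitVector_tangentChart {x₀ : M} (p : UnitTangentBundle g)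
    (hp : p.1.proj ∈ (extChartAt (𝓡 n) x₀).source) :
    unitVector g (v := (tangentChart x₀ p.1).2) ((extChartAt (𝓡 n) x₀).map_source hp)
      ((mem_unitTangentSet_iff g hp).1 p.2) = p :=
  Subtype.ext ((tangentChart x₀).left_inv (mem_tangentChart_source.2 hp))

lemma IsSmoothFlow.isSmoothFunction_speed (hφ : IsSmoothFlow φ) :
    IsSmoothFunction (speed φ) := by
  classical
  obtain ⟨Φ, hΦ, hΦφ⟩ := id hφ
  refine ⟨fun q => if h : q ∈ unitTangentSet g then speed φ ⟨q, h⟩ else 0, ?_,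
    fun p => by simp⟩
  intro q hq
  set x₀ := q.proj with hx₀
  have hqs : q.proj ∈ (extChartAt (𝓡 n) x₀).source := mem_extChartAt_source q.proj
  have hy : (tangentChart x₀ q).1 ∈ (extChartAt (𝓡 n) x₀).target :=
    (extChartAt (𝓡 n) x₀).map_source hqs
  have hv : chartMetric g x₀ (tangentChart x₀ q).1 (tangentChart x₀ q).2 (tangentChart x₀ q).2 = 1 :=
    (mem_unitTangentSet_iff g hqs).1 hq
  have hv0 : (tangentChart x₀ q).2 ≠ 0 := by
    intro h; rw [h] at hv; simp at hv
  let H : EuclideanSpace ℝ (Fin n) × EuclideanSpace ℝ (Fin n) → ℝ := fun z =>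
    chartMetric g x₀ z.1 (fderiv ℝ (flowChart g Φ x₀) (0, z) (1, 0)).1 z.2
  have hsrc : (Φ (0, unitize g x₀ ((tangentChart x₀ q).1, (tangentChart x₀ q).2))).proj ∈
      (extChartAt (𝓡 n) x₀).source := by
    rw [unitize_of_unit g hv]
    have h1 := hΦφ 0 (unitVector g hy hv)
    rw [φ.map_zero_apply] at h1
    have h2 := unitVector_proj_mem g hy hv
    rw [← h1] at h2
    exact h2
  have hF := contDiffAt_flowChart hΦ hy hv0 hsrc
  have hH : ContDiffAt ℝ ∞ H (tangentChart x₀ q) := by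
    have h1 : ContDiffAt ℝ ∞ (fun z : EuclideanSpace ℝ (Fin n) × EuclideanSpace ℝ (Fin n) =>
        fderiv ℝ (flowChart g Φ x₀) (0, z)) (tangentChart x₀ q) :=
      ContDiffAt.comp (f := fun z : EuclideanSpace ℝ (Fin n) × EuclideanSpace ℝ (Fin n) =>
        ((0 : ℝ), z)) (tangentChart x₀ q) (hF.fderiv_right (m := ∞) (by simp)) (by fun_prop)
    have h2 : ContDiffAt ℝ ∞ (fun z : EuclideanSpace ℝ (Fin n) × EuclideanSpace ℝ (Fin n) =>
        chartMetric g x₀ z.1) (tangentChart x₀ q) :=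
      ContDiffAt.comp (tangentChart x₀ q) ((isChartMetric g x₀).contDiffAt hy) contDiffAt_fst
    exact (h2.clm_apply (h1.clm_apply contDiffAt_const).fst).clm_apply contDiffAt_snd
  have ho : IsOpen (tangentChart (n := n) x₀).source := isOpen_extChartAt_source _
  have hqt : q ∈ (tangentChart x₀).source := mem_tangentChart_source.2 hqs
  have h1 : ContMDiffAt (𝓡 n).tangent 𝓘(ℝ, ℝ) ∞ (fun q => H (tangentChart x₀ q)) q :=
    ContMDiffAt.comp q hH.contMDiffAt
      ((contMDiffOn_tangentChart x₀).contMDiffAt (ho.mem_nhds hqt))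
  have heq : ∀ q' ∈ unitTangentSet g, q' ∈ (tangentChart x₀).source →
      (if h : q' ∈ unitTangentSet g then speed φ ⟨q', h⟩ else 0) = H (tangentChart x₀ q') := by
    intro q' hq' hs
    have hs' := mem_tangentChart_source.1 hs
    have h2 := fderiv_flowChart hΦ hΦφ (x₀ := x₀) ((extChartAt (𝓡 n) x₀).map_source hs')
      ((mem_unitTangentSet_iff g hs').1 hq')
    rw [unitVector_tangentChart ⟨q', hq'⟩ hs'] at h2
    rw [dif_pos hq', hφ.speed_eq (x₀ := x₀) (p := ⟨q', hq'⟩) hs', ← h2]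
    rfl
  refine h1.contMDiffWithinAt.congr_of_eventuallyEq ?_ (heq q hq hqt)
  filter_upwards [self_mem_nhdsWithin, mem_nhdsWithin_of_mem_nhds (ho.mem_nhds hqt)] with q' h h'
  exact heq q' h h'

/-- The horizontal and vertical parts of the generator determine it. -/
lemma generator_eq_of_parts {p : UnitTangentBundle g} {c : ℝ}
    (hH : @Eq (EuclideanSpace ℝ (Fin n)) (horizontalPart φ p)
      (c • (p.1.snd : EuclideanSpace ℝ (Fin n))))
    (hV : @Eq (EuclideanSpace ℝ (Fin n)) (verticalPart φ p) 0) :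
    generator φ p = c • geodesicVectorField g p.1 := by
  have key : ∀ (ζ : EuclideanSpace ℝ (Fin n) × EuclideanSpace ℝ (Fin n))
      (y v : EuclideanSpace ℝ (Fin n)), ζ.1 = c • v →
      ζ.2 + leviCivita (chartMetric g p.1.proj) y ζ.1 v = 0 →
      ζ = c • (v, -christoffel g p.1.proj y v v) := by
    intro ζ y v h1 h2
    rw [h1, map_smul, smul_apply, ← christoffel_eq_leviCivita] at h2
    exact Prod.ext h1 ((eq_neg_of_add_eq_zero_left h2).trans (smul_neg _ _).symm)
  exact key (generator φ p) _ p.1.snd ((mfderiv_proj_eq p.1 (generator φ p)).symm.trans hH)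
    ((connector_eq g p.1 (generator φ p)).symm.trans hV)

lemma IsSmoothFlow.parts_eq (hφ : IsSmoothFlow φ) (hodd : IsOddFlow φ)
    (hfix : HasNoFixedPoint φ) (hk₁ : 1 < k) (hkn : k < n)
    (hplanes : HasTotallyInvariantPlanes φ k) (p : UnitTangentBundle g) :
    speed φ p ≠ 0 ∧ @Eq (EuclideanSpace ℝ (Fin n)) (horizontalPart φ p)
      (speed φ p • (p.1.snd : EuclideanSpace ℝ (Fin n))) ∧
      @Eq (EuclideanSpace ℝ (Fin n)) (verticalPart φ p) 0 := by
  have hp := mem_extChartAt_source (I := 𝓡 n) p.1.proj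
  have hy := (extChartAt (𝓡 n) p.1.proj).map_source hp
  have hv := (mem_unitTangentSet_iff g hp).1 p.2
  obtain ⟨c, hc⟩ := hφ.exists_chartGenerator_fst hk₁ hkn hplanes hy hv
  have hc0 := hφ.ne_zero_of_chartGenerator_fst hodd hfix hk₁ hkn hplanes hy hv hc
  have hV := hφ.chartVertical_eq_zero hodd hk₁ hkn hplanes hy hv
  rw [unitVector_tangentChart p hp] at hc hV
  have hs : speed φ p = c := by
    rw [hφ.speed_eq hp, hc, map_smul, smul_apply, hv, smul_eq_mul, mul_one]
  refine ⟨hs ▸ hc0, (hφ.horizontalPart_eq hp).trans ?_, (hφ.verticalPart_eq hp).trans ?_⟩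
  · rw [hc, map_smul, hs]
    exact congrArg (fun v : EuclideanSpace ℝ (Fin n) => c • v)
      (tangentCoordChange_inverse (v := p.1.snd) hp hp)
  · rw [hV, map_zero]

/-- A semi-spray flow with vanishing vertical part is the geodesic flow. -/
lemma IsSmoothFlow.isGeodesicFlow (hφ : IsSmoothFlow φ) (hs : IsSemiSpray φ)
    (hV : ∀ p : UnitTangentBundle g, @Eq (EuclideanSpace ℝ (Fin n)) (verticalPart φ p) 0) :
    IsGeodesicFlow φ := by
  intro p
  have hproj : ContMDiff (𝓡 n).tangent (𝓡 n) ∞ fun q : TangentBundle (𝓡 n) M => q.proj :=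
    contMDiff_proj (TangentSpace (𝓡 n) : M → Type _)
  have hlift : ∀ t, velocityLift (fun s : ℝ => (φ s p).1.proj) t = (φ t p).1 := by
    intro t
    have h1 : HasMFDerivAt 𝓘(ℝ, ℝ) (𝓡 n) (fun s : ℝ => (φ s p).1.proj) t
        ((mfderiv (𝓡 n).tangent (𝓡 n) (fun q : TangentBundle (𝓡 n) M => q.proj) (φ t p).1).comp
          (mfderiv 𝓘(ℝ, ℝ) (𝓡 n).tangent (fun t : ℝ => (φ t p).1) t)) :=
      HasMFDerivAt.comp t (hproj.mdifferentiableAt (by simp)).hasMFDerivAt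
        (hφ.mdifferentiableAt_orbit p t).hasMFDerivAt
    have h2 : @Eq (EuclideanSpace ℝ (Fin n))
        (mfderiv 𝓘(ℝ, ℝ) (𝓡 n) (fun s : ℝ => (φ s p).1.proj) t (1 : ℝ)) (φ t p).1.snd := by
      refine Eq.trans ?_ (hs (φ t p))
      refine (congrArg (fun L : ℝ →L[ℝ] EuclideanSpace ℝ (Fin n) => L 1) h1.mfderiv).trans ?_
      exact congrArg (mfderiv (𝓡 n).tangent (𝓡 n) (fun q : TangentBundle (𝓡 n) M => q.proj)
        (φ t p).1) (hφ.generator_eq p t).symm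
    exact congrArg (fun v : EuclideanSpace ℝ (Fin n) =>
      (⟨(φ t p).1.proj, v⟩ : TangentBundle (𝓡 n) M)) h2
  refine ⟨⟨hproj.comp (hφ.contMDiff_orbit p), fun t => ?_⟩, hlift⟩
  rw [show velocityLift (fun s : ℝ => (φ s p).1.proj) = fun t => (φ t p).1 from funext hlift]
  exact (congrArg (connector g (φ t p).1) (hφ.generator_eq p t).symm).trans (hV (φ t p))

end TimeChange

end

theorem theoremD {n k : ℕ} (hn : 3 ≤ n) (hk₁ : 1 < k) (hkn : k < n)
    {M : Type u} [TopologicalSpace M] [T2Space M] [SecondCountableTopology M] [ConnectedSpace M]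
    [ChartedSpace (EuclideanSpace ℝ (Fin n)) M] [IsManifold (𝓡 n) ∞ M]
    (g : SmoothMetric n M) (φ : Flow ℝ (UnitTangentBundle g))
    (hsmooth : IsSmoothFlow φ) (hodd : IsOddFlow φ) (hfix : HasNoFixedPoint φ)
    (hplanes : ∀ (x : M) (W : Submodule ℝ (TangentSpace (𝓡 n) x)),
      Module.finrank ℝ W = k → IsTangentToTotallyInvariant φ k x W) :
    HasConstantSectionalCurvature g ∧ IsSmoothTimeChangeOfGeodesicFlow φ ∧
      (IsSemiSpray φ → IsGeodesicFlow φ) := by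
  have hparts := hsmooth.parts_eq hodd hfix hk₁ hkn hplanes
  exact ⟨hsmooth.hasConstantSectionalCurvature hn hodd hfix hk₁ hkn hplanes,
    ⟨speed φ, hsmooth.isSmoothFunction_speed, fun p =>
      ⟨(hparts p).1, generator_eq_of_parts (hparts p).2.1 (hparts p).2.2⟩⟩,
    fun hs => hsmooth.isGeodesicFlow hs fun p => (hparts p).2.2⟩
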